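/- Let $n\ge 0$ be an integer, $S$ an arbitrary scheme, and $\mathcal R=\bigoplus_{d\ge 0}\mathcal R_d$ an arbitrary quasi-coherent $\mathbb N$-graded (commutative) $\mathcal O_S$-algebra, with relative homogeneous spectrum $\operatorname{Proj}(\mathcal R)\to S$. For a morphism of schemes $X\to S$ let $\mathcal{H}ilb^n_{X/S}$ denote the contravariant functor from $S$-schemes to sets that sends $T\to S$ to the set of closed subschemes $Z\subseteq T\times_S X$ such that the projection $p\colon Z\to T$ is finite and $p_*\mathcal O_Z$ is a locally free $\mathcal O_T$-module of rank $n$, and that sends a morphism $T'\to T$ of $S$-schemes to the pullback of closed subschemes along $T'\times_S X\to T\times_S X$. For an affine open subscheme $\operatorname{Spec}(A)\subseteq S$, with $R=\Gamma(\operatorname{Spec}(A),\mathcal R)$, and a homogeneous element $f\in R$ of positive degree, let $R_{(f)}$ be the degree zero part of the localization $R_f$, so that $\operatorname{Spec}(R_{(f)})$ is an open subscheme of $\operatorname{Proj}(\mathcal R)$ lying over $\operatorname{Spec}(A)$. Regard $\mathcal{H}ilb^n_{\operatorname{Spec}(R_{(f)})/\operatorname{Spec}(A)}$ as a functor on $S$-schemes,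 by letting it have no $T$-valued points when $T\to S$ does not factor through $\operatorname{Spec}(A)$; a $T$-valued point, being a closed subscheme of $T\times_{\operatorname{Spec}(A)}\operatorname{Spec}(R_{(f)})$ that is finite over $T$, is also a closed subscheme of $T\times_S\operatorname{Proj}(\mathcal R)$, which defines a natural transformation to $\mathcal{H}ilb^n_{\operatorname{Proj}(\mathcal R)/S}$. Then: 1. The functor $\mathcal{H}ilb^n_{\operatorname{Proj}(\mathcal R)/S}$ is representable by a scheme over $S$. 2. For every affine open $\operatorname{Spec}(A)\subseteq S$ and every homogeneous $f\in R$ of positive degree, the functor $\mathcal{H}ilb^n_{\operatorname{Spec}(R_{(f)})/\operatorname{Spec}(A)}$ is representable (on $A$-schemes by an $A$-scheme, and on $S$-schemes by an $S$-scheme), and it is an open subfunctor of $\mathcal{H}ilb^n_{\operatorname{Proj}(\mathcal R)/S}$: the natural transformation above is a monomorphism, and its pullback along any morphism to $\mathcal{H}ilb^n_{\operatorname{Proj}(\mathcal R)/S}$ from the functor represented by an $S$-scheme $T$ is represented by an open immersion into $T$. 3. These open subfunctors cover $\mathcal{H}ilb^n_{\operatorname{Proj}(\mathcal R)/S}$: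 for every $S$-scheme $T$, every $Z\in\mathcal{H}ilb^n_{\operatorname{Proj}(\mathcal R)/S}(T)$ and every point $t\in T$ there are an open neighbourhood $V\subseteq T$ of $t$, an affine open $\operatorname{Spec}(A)\subseteq S$ and a homogeneous $f\in R$ of positive degree such that the restriction of $Z$ to $V$ lies in $\mathcal{H}ilb^n_{\operatorname{Spec}(R_{(f)})/\operatorname{Spec}(A)}(V)$. -/

import Mathlib

universe u

open CategoryTheory Limits TopologicalSpace Opposite AlgebraicGeometry Graded

noncomputable section

namespace HilbertPoints

/-- A sheaf of commutative `𝒪_S`-algebras on a scheme `S`: a sheaf of commutative rings with a ring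
map from the structure sheaf. -/
structure AlgebraSheaf (S : Scheme.{u}) where
  ring : TopCat.Presheaf CommRingCat.{u} S
  isSheaf : ring.IsSheaf
  unit : S.presheaf ⟶ ring

namespace AlgebraSheaf
variable {S : Scheme.{u}} (R : AlgebraSheaf S)

/-- Sections over `U`. -/
abbrev sec (U : S.Opens) : CommRingCat.{u} := R.ring.obj (.op U)

/-- Restriction of sections. -/
abbrev res {V U : S.Opens} (h : V ≤ U) : R.sec U →+* R.sec V := (R.ring.map (homOfLE h).op).hom

/-- The structure map on sections over `U`. -/
abbrev str (U : S.Opens) : Γ(S, U) →+* R.sec U := (R.unit.app (.op U)).hom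

/-- The underlying sheaf of `𝒪_S`-modules: restriction of scalars along the structure map. -/
def toModules : S.Modules :=
  (SheafOfModules.restrictScalars
    (R := S.ringCatSheaf)
    (R' := (sheafCompose _ (forget₂ CommRingCat RingCat.{u})).obj ⟨R.ring, R.isSheaf⟩)
    ⟨Functor.whiskerRight R.unit (forget₂ CommRingCat RingCat.{u})⟩).obj (SheafOfModules.unit _)

lemma res_str {V U : S.Opens} (h : V ≤ U) (a : Γ(S, U)) :
    R.res h (R.str U a) = R.str V (S.presheaf.map (homOfLE h).op a) :=
  (congr($(R.unit.naturality (homOfLE h).op) a)).symm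

lemma fromSpec_image_le {U : S.Opens} (hU : IsAffineOpen U) (V : (Spec Γ(S, U)).Opens) :
    hU.fromSpec ''ᵁ V ≤ U := by
  conv_rhs => rw [← hU.opensRange_fromSpec]
  exact hU.fromSpec.image_le_opensRange V

lemma smul_eq {U : S.Opens} (hU : IsAffineOpen U) (V : (Spec Γ(S, U)).Opens)
    (r : Γ(S, U)) (x : R.sec (hU.fromSpec ''ᵁ V)) :
    (show R.sec (hU.fromSpec ''ᵁ V) from
     (r • (show (modulesSpecToSheaf.obj (R.toModules.restrict hU.fromSpec)).obj.obj (.op V) from x)))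
     = R.str _ (S.presheaf.map (homOfLE (fromSpec_image_le hU V)).op r) * x := by
  have h0 : hU.fromSpec.appLE U V (by rw [hU.fromSpec_preimage_self]; exact le_top) =
      (Scheme.ΓSpecIso Γ(S, U)).inv ≫ (Spec Γ(S, U)).presheaf.map (homOfLE le_top).op := by
    rw [Scheme.Hom.appLE, hU.fromSpec_app_self, Category.assoc, ← Functor.map_comp]
    rfl
  have h2 : (hU.fromSpec.appIso V).inv ((Spec Γ(S, U)).presheaf.map (homOfLE le_top).op
      ((Scheme.ΓSpecIso Γ(S, U)).inv r)) =
      (S.presheaf.map (homOfLE (fromSpec_image_le hU V)).op r) := by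
    have h1 := Scheme.Hom.appLE_appIso_inv hU.fromSpec (U := U) (V := V)
      (by rw [hU.fromSpec_preimage_self]; exact le_top)
    rw [h0] at h1
    exact congr($h1 r)
  rw [← h2]
  rfl

lemma loc_aux (h : R.toModules.IsQuasicoherent) {U : S.Opens} (hU : IsAffineOpen U) (f : Γ(S, U))
    (W₁ W₂ : S.Opens) (e₁ : U = W₁) (e₂ : S.basicOpen f = W₂) (h12 : W₂ ≤ W₁) :
    (∀ y : R.sec W₂, ∃ (n : ℕ) (x : R.sec W₁),
      R.str _ (S.presheaf.map (homOfLE (e₂ ▸ S.basicOpen_le f : W₂ ≤ U)).op f) ^ n * y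
        = R.res h12 x) ∧
    (∀ x y : R.sec W₁, R.res h12 x = R.res h12 y →
      ∃ n : ℕ, R.str _ (S.presheaf.map (homOfLE e₁.ge).op f) ^ n * x =
        R.str _ (S.presheaf.map (homOfLE e₁.ge).op f) ^ n * y) := by
  have h1 : IsIso (R.toModules.restrict hU.fromSpec).fromTildeΓ := inferInstance
  rw [isIso_fromTildeΓ_iff_isLocalizing] at h1
  have h2 := h1 f
  obtain rfl : W₁ = hU.fromSpec ''ᵁ ⊤ := by
    rw [← e₁, Scheme.Hom.image_top_eq_opensRange, hU.opensRange_fromSpec]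
  obtain rfl : W₂ = hU.fromSpec ''ᵁ (PrimeSpectrum.basicOpen f) := by
    rw [← e₂, ← hU.fromSpec_image_basicOpen]
  constructor
  · intro y
    obtain ⟨⟨x, ⟨_, n, rfl⟩⟩, hx⟩ := h2.surj y
    refine ⟨n, x, ?_⟩
    rw [← map_pow, ← map_pow]
    exact (smul_eq R hU _ (f ^ n) y).symm.trans hx
  · intro x y hxy
    obtain ⟨⟨_, n, rfl⟩, hx⟩ := h2.exists_of_eq hxy
    refine ⟨n, ?_⟩
    rw [← map_pow, ← map_pow]
    exact (smul_eq R hU _ (f ^ n) x).symm.trans (hx.trans (smul_eq R hU _ (f ^ n) y))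

lemma isUnit_res_str {U : S.Opens} (f : Γ(S, U)) :
    IsUnit (R.res (S.basicOpen_le f) (R.str U f)) := by
  rw [res_str]
  exact (RingedSpace.isUnit_res_basicOpen _ f).map _

lemma loc_surj (h : R.toModules.IsQuasicoherent) {U : S.Opens} (hU : IsAffineOpen U) (f : Γ(S, U))
    (y : R.sec (S.basicOpen f)) : ∃ (n : ℕ) (x : R.sec U),
      R.res (S.basicOpen_le f) (R.str U f) ^ n * y = R.res (S.basicOpen_le f) x := by
  obtain ⟨H1, H2⟩ := loc_aux R h hU f U _ rfl rfl (S.basicOpen_le f)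
  rw [res_str]
  exact H1 y

lemma loc_eq (h : R.toModules.IsQuasicoherent) {U : S.Opens} (hU : IsAffineOpen U) (f : Γ(S, U))
    (x : R.sec U) (hx : R.res (S.basicOpen_le f) x = 0) : ∃ n : ℕ, R.str U f ^ n * x = 0 := by
  obtain ⟨H1, H2⟩ := loc_aux R h hU f U _ rfl rfl (S.basicOpen_le f)
  obtain ⟨n, hn⟩ := H2 x 0 (by simpa using hx)
  refine ⟨n, ?_⟩
  rw [mul_zero] at hn
  convert hn
  simp
end AlgebraSheaf

lemma isOpenImmersion_of_isLocalIso {X Y : Scheme.{u}} (f : X ⟶ Y) [IsLocalIso f]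
    (hf : Function.Injective f) : IsOpenImmersion f := by
  have hop : UniversallyOpen f := by
    have hf' : IsLocalIso f := ‹_›
    rw [IsLocalIso.eq_sourceLocalClosure_isOpenImmersion] at hf'
    obtain ⟨𝒰, h⟩ := hf'
    rw [IsZariskiLocalAtSource.iff_of_openCover 𝒰 (P := @UniversallyOpen)]
    intro i
    have := h i
    infer_instance
  have hst (x : X) : IsIso (f.stalkMap x) := by
    obtain ⟨U, hxU, hU⟩ := IsLocalIso.exists_isOpenImmersion (f := f) x
    let y : U.toScheme := ⟨x, hxU⟩
    have h1 : IsIso (f.stalkMap (U.ι y) ≫ U.ι.stalkMap y) := by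
      rw [← Scheme.Hom.stalkMap_comp]
      exact (IsOpenImmersion.iff_isIso_stalkMap.mp hU).2 y
    exact IsIso.of_isIso_comp_right (f.stalkMap (U.ι y)) (U.ι.stalkMap y)
  exact IsOpenImmersion.of_isIso_stalkMap f
    (.of_continuous_injective_isOpenMap f.continuous hf f.isOpenMap)

section ProjLocalization

variable {A B : Type u} [CommRing A] [CommRing B] {𝒜 : ℕ → AddSubgroup A} {ℬ : ℕ → AddSubgroup B}
  [GradedRing 𝒜] [GradedRing ℬ]

/-- The graded ring map `φ` is the localization at powers of the element `a` of degree zero. -/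
structure IsDegreeZeroLocalization (φ : 𝒜 →+*ᵍ ℬ) (a : A) : Prop where
  mem : a ∈ 𝒜 0
  isUnit : IsUnit (φ a)
  surj : ∀ y : B, ∃ (n : ℕ) (x : A), φ a ^ n * y = φ x
  zero : ∀ x : A, φ x = 0 → ∃ n : ℕ, a ^ n * x = 0

namespace IsDegreeZeroLocalization

variable {φ : 𝒜 →+*ᵍ ℬ} {a : A}

lemma pow_mul_mem (h : IsDegreeZeroLocalization φ a) (n : ℕ) {d : ℕ} {x : A} (hx : x ∈ 𝒜 d) :
    a ^ n * x ∈ 𝒜 d := by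
  have := SetLike.mul_mem_graded (SetLike.pow_mem_graded n h.mem) hx
  simpa using this

lemma pow_mul_mem' (h : IsDegreeZeroLocalization φ a) (n : ℕ) {d : ℕ} {y : B} (hy : y ∈ ℬ d) :
    φ a ^ n * y ∈ ℬ d := by
  have := SetLike.mul_mem_graded (SetLike.pow_mem_graded n (map_mem φ h.mem)) hy
  simpa using this

lemma surj_of_mem (h : IsDegreeZeroLocalization φ a) {d : ℕ} {y : B} (hy : y ∈ ℬ d) :
    ∃ (n : ℕ) (x : A), x ∈ 𝒜 d ∧ φ a ^ n * y = φ x := by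
  obtain ⟨n, x, hx⟩ := h.surj y
  refine ⟨n, DirectSum.decompose 𝒜 x d, SetLike.coe_mem _, ?_⟩
  rw [φ.map_directSumDecompose, ← hx]
  exact (DirectSum.decompose_of_mem_same ℬ (h.pow_mul_mem' n hy)).symm

lemma irrelevant_le (h : IsDegreeZeroLocalization φ a) :
    HomogeneousIdeal.irrelevant ℬ ≤ (HomogeneousIdeal.irrelevant 𝒜).map φ := by
  change (HomogeneousIdeal.irrelevant ℬ).toIdeal ≤ ((HomogeneousIdeal.irrelevant 𝒜).map φ).toIdeal
  refine (HomogeneousIdeal.toIdeal_irrelevant_le _).mpr fun i hi y hy ↦ ?_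
  obtain ⟨n, x, hx, e⟩ := h.surj_of_mem hy
  obtain ⟨b, hb⟩ := (h.isUnit.pow n).exists_left_inv
  have : y = b * φ x := by rw [← e, ← mul_assoc, hb, one_mul]
  rw [this]
  refine Ideal.mul_mem_left _ _ (Ideal.mem_map_of_mem φ ?_)
  rw [HomogeneousIdeal.mem_iff]
  exact HomogeneousIdeal.mem_irrelevant_of_mem _ hi hx

lemma exists_inv (h : IsDegreeZeroLocalization φ a) : ∃ b ∈ ℬ 0, φ a * b = 1 := by
  obtain ⟨b, hb⟩ := h.isUnit.exists_right_inv
  refine ⟨DirectSum.decompose ℬ b 0, SetLike.coe_mem _, ?_⟩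
  have := DirectSum.coe_decompose_mul_of_left_mem_zero ℬ (b := b) (j := 0) (map_mem φ h.mem)
  rw [← this, hb]
  exact DirectSum.decompose_of_mem_same ℬ SetLike.GradedOne.one_mem

lemma isLocalization_away (h : IsDegreeZeroLocalization φ a) {d : ℕ} {s : A} (hs : s ∈ 𝒜 d) :
    letI := (HomogeneousLocalization.Away.map φ s).toAlgebra
    IsLocalization.Away (HomogeneousLocalization.fromZeroRingHom 𝒜 (.powers s) ⟨a, h.mem⟩)
      (HomogeneousLocalization.Away ℬ (φ s)) := by
  let := (HomogeneousLocalization.Away.map φ s).toAlgebra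
  set r := HomogeneousLocalization.fromZeroRingHom 𝒜 (.powers s) ⟨a, h.mem⟩ with hr
  have hr' : r = HomogeneousLocalization.Away.mk 𝒜 hs 0 a (by simpa using h.mem) := by
    apply HomogeneousLocalization.val_injective
    simp [hr, HomogeneousLocalization.fromZeroRingHom, HomogeneousLocalization.Away.mk]
    rfl
  have hmap : algebraMap _ (HomogeneousLocalization.Away ℬ (φ s)) r =
      HomogeneousLocalization.Away.mk ℬ (map_mem φ hs) 0 (φ a)
        (by simpa using map_mem φ h.mem) := by
    rw [hr', RingHom.algebraMap_toAlgebra, HomogeneousLocalization.Away.map_mk]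
  have hpow (n : ℕ) : r ^ n = HomogeneousLocalization.Away.mk 𝒜 hs 0 (a ^ n)
      (by simpa using h.pow_mul_mem n (SetLike.GradedOne.one_mem (A := 𝒜))) := by
    apply HomogeneousLocalization.val_injective
    simp [hr', HomogeneousLocalization.Away.val_mk, Localization.mk_pow]
  refine (isLocalization_iff _ _).mpr ?_
  refine ⟨?_, ?_, ?_⟩
  · rintro ⟨_, n, rfl⟩
    simp only [map_pow]
    refine IsUnit.pow n ?_
    obtain ⟨b, hb, e⟩ := h.exists_inv
    refine IsUnit.of_mul_eq_one (HomogeneousLocalization.Away.mk ℬ (map_mem φ hs) 0 b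
      (by simpa using hb)) ?_
    rw [hmap]
    apply HomogeneousLocalization.val_injective
    simp [HomogeneousLocalization.Away.val_mk, Localization.mk_mul, e]
  · intro z
    obtain ⟨k, y, hy, rfl⟩ := HomogeneousLocalization.Away.mk_surjective ℬ (map_mem φ hs) z
    obtain ⟨n, x, hx, e⟩ := h.surj_of_mem hy
    refine ⟨⟨HomogeneousLocalization.Away.mk 𝒜 hs k x hx, ⟨_, n, rfl⟩⟩, ?_⟩
    simp only [map_pow, hmap]
    rw [RingHom.algebraMap_toAlgebra, HomogeneousLocalization.Away.map_mk]
    apply HomogeneousLocalization.val_injective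
    simp [HomogeneousLocalization.Away.val_mk, Localization.mk_mul, Localization.mk_pow, ← e,
      mul_comm]
  · suffices H : ∀ x, algebraMap _ (HomogeneousLocalization.Away ℬ (φ s)) x = 0 →
        ∃ n : ℕ, r ^ n * x = 0 by
      intro x y hxy
      obtain ⟨n, hn⟩ := H (x - y) (by rw [map_sub, hxy, sub_self])
      refine ⟨⟨_, n, rfl⟩, ?_⟩
      rwa [mul_sub, sub_eq_zero] at hn
    intro x hx
    obtain ⟨k, x, hx', rfl⟩ := HomogeneousLocalization.Away.mk_surjective 𝒜 hs x
    rw [RingHom.algebraMap_toAlgebra, HomogeneousLocalization.Away.map_mk] at hx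
    replace hx := congr(HomogeneousLocalization.val $hx)
    rw [HomogeneousLocalization.Away.val_mk, HomogeneousLocalization.val_zero,
      Localization.mk_eq_mk', IsLocalization.mk'_eq_zero_iff] at hx
    obtain ⟨⟨_, m, rfl⟩, hm⟩ := hx
    obtain ⟨n, hn⟩ := h.zero (s ^ m * x) (by simpa using hm)
    refine ⟨n, ?_⟩
    rw [hpow]
    apply HomogeneousLocalization.val_injective
    rw [HomogeneousLocalization.val_mul, HomogeneousLocalization.Away.val_mk,
      HomogeneousLocalization.Away.val_mk, HomogeneousLocalization.val_zero, Localization.mk_mul,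
      Localization.mk_eq_mk', IsLocalization.mk'_eq_zero_iff]
    exact ⟨⟨_, m, rfl⟩, by rw [← hn]; ring⟩

lemma isOpenImmersion_away (h : IsDegreeZeroLocalization φ a) {d : ℕ} {s : A} (hs : s ∈ 𝒜 d) :
    IsOpenImmersion (Spec.map (CommRingCat.ofHom (HomogeneousLocalization.Away.map φ s))) := by
  let := (HomogeneousLocalization.Away.map φ s).toAlgebra
  have := h.isLocalization_away hs
  exact IsOpenImmersion.of_isLocalization
    (HomogeneousLocalization.fromZeroRingHom 𝒜 (.powers s) ⟨a, h.mem⟩)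

lemma injective_map (h : IsDegreeZeroLocalization φ a) :
    Function.Injective (Proj.map φ h.irrelevant_le) := by
  have key (p : Proj ℬ) (y : B) {n : ℕ} {x : A} (e : φ a ^ n * y = φ x) :
      y ∈ p.asHomogeneousIdeal ↔ x ∈ (Proj.map φ h.irrelevant_le p).asHomogeneousIdeal := by
    change _ ↔ φ x ∈ p.asHomogeneousIdeal
    rw [← e, ← HomogeneousIdeal.mem_iff, ← HomogeneousIdeal.mem_iff]
    exact (Ideal.unit_mul_mem_iff_mem _ (h.isUnit.pow n)).symm
  intro p q hpq
  apply ProjectiveSpectrum.ext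
  ext y
  obtain ⟨n, x, e⟩ := h.surj y
  rw [HomogeneousIdeal.mem_iff, HomogeneousIdeal.mem_iff, key p y e, key q y e, hpq]

lemma isLocalIso_away_map (h : IsDegreeZeroLocalization φ a) {d : ℕ} (hd : 0 < d) {s : A}
    (hs : s ∈ 𝒜 d) : IsLocalIso (Proj.awayι ℬ (φ s) (map_mem φ hs) hd ≫
        Proj.map φ h.irrelevant_le) := by
  have := h.isOpenImmersion_away hs
  rw [Proj.awayι_comp_map φ h.irrelevant_le hd s hs]
  exact ⟨fun x ↦ ⟨⊤, trivial, inferInstance⟩⟩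

lemma isOpenImmersion_map (h : IsDegreeZeroLocalization φ a) :
    IsOpenImmersion (Proj.map φ h.irrelevant_le) := by
  have hloc : IsLocalIso (Proj.map φ h.irrelevant_le) := by
    rw [IsZariskiLocalAtSource.iff_of_openCover (P := @IsLocalIso)
      (Proj.mapAffineOpenCover φ h.irrelevant_le).openCover]
    intro s
    exact h.isLocalIso_away_map s.1.2 s.2.2
  exact isOpenImmersion_of_isLocalIso _ h.injective_map

end IsDegreeZeroLocalization
end ProjLocalization

/-- A quasi-coherent graded `𝒪_S`-algebra: a sheaf of `𝒪_S`-algebras whose underlying module is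
quasi-coherent, with subsheaves `piece · d` of additive groups, for `d : ℕ`, such that `𝒪_S` maps to
degree `0`, degrees add under multiplication, and the algebra is the direct sum of its pieces. The
last condition is stated on sections over affine opens. Being closed under multiplication by
degree `0`, the pieces are subsheaves of `𝒪_S`-modules. -/
structure QCohGradedAlgebra (S : Scheme.{u}) extends AlgebraSheaf S where
  isQuasicoherent : toAlgebraSheaf.toModules.IsQuasicoherent
  piece (U : S.Opens) : ℕ → AddSubgroup (toAlgebraSheaf.sec U)
  res_mem {V U : S.Opens} (h : V ≤ U) {d : ℕ} {x : toAlgebraSheaf.sec U} :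
    x ∈ piece U d → toAlgebraSheaf.res h x ∈ piece V d
  mem_of_local (U : S.Opens) (d : ℕ) (x : toAlgebraSheaf.sec U) :
    (∀ p ∈ U, ∃ (V : S.Opens) (h : V ≤ U), p ∈ V ∧ toAlgebraSheaf.res h x ∈ piece V d) →
      x ∈ piece U d
  str_mem (U : S.Opens) (a : Γ(S, U)) : toAlgebraSheaf.str U a ∈ piece U 0
  mul_mem {U : S.Opens} {d e : ℕ} {x y : toAlgebraSheaf.sec U} :
    x ∈ piece U d → y ∈ piece U e → x * y ∈ piece U (d + e)
  isInternal {U : S.Opens} : IsAffineOpen U → DirectSum.IsInternal (piece U)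

namespace QCohGradedAlgebra

variable {S : Scheme.{u}} (R : QCohGradedAlgebra S)

instance gradedRing (U : S.AffineZariskiSite) : GradedRing (R.piece U.1) where
  one_mem := by simpa using R.str_mem U.1 1
  mul_mem _ _ _ _ hx hy := R.mul_mem hx hy
  __ := (R.isInternal U.2).chooseDecomposition

/-- Restriction as a homomorphism of graded rings. -/
def resHom {V U : S.AffineZariskiSite} (h : V ≤ U) : R.piece U.1 →+*ᵍ R.piece V.1 where
  __ := R.res (Scheme.AffineZariskiSite.toOpens_mono h)
  map_mem hx := R.res_mem _ hx

@[simp]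
lemma resHom_apply {V U : S.AffineZariskiSite} (h : V ≤ U) (x : R.sec U.1) :
    R.resHom h x = R.res (Scheme.AffineZariskiSite.toOpens_mono h) x := rfl

lemma resHom_refl (U : S.AffineZariskiSite) : R.resHom (le_refl U) = .id _ := by
  ext x
  change (R.ring.map (𝟙 _)).hom x = x
  simp

lemma resHom_comp {W V U : S.AffineZariskiSite} (h : W ≤ V) (h' : V ≤ U) :
    (R.resHom h).comp (R.resHom h') = R.resHom (h.trans h') := by
  ext x
  change (R.ring.map _ ≫ R.ring.map _).hom x = _
  rw [← Functor.map_comp]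
  rfl

lemma isDegreeZeroLocalization (U : S.AffineZariskiSite) (f : Γ(S, U.1)) :
    IsDegreeZeroLocalization (R.resHom (U.basicOpen_le f)) (R.str U.1 f) where
  mem := R.str_mem _ _
  isUnit := R.isUnit_res_str f
  surj := R.loc_surj R.isQuasicoherent U.2 f
  zero := R.loc_eq R.isQuasicoherent U.2 f

lemma exists_isDegreeZeroLocalization {V U : S.AffineZariskiSite} (h : V ≤ U) :
    ∃ f : Γ(S, U.1), S.basicOpen f = V.1 ∧
      IsDegreeZeroLocalization (R.resHom h) (R.str U.1 f) := by
  obtain ⟨f, hf⟩ := h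
  obtain rfl : U.basicOpen f = V := Subtype.ext hf
  exact ⟨f, rfl, R.isDegreeZeroLocalization U f⟩

lemma irrelevant_le {V U : S.AffineZariskiSite} (h : V ≤ U) :
    HomogeneousIdeal.irrelevant (R.piece V.1) ≤
      (HomogeneousIdeal.irrelevant (R.piece U.1)).map (R.resHom h) :=
  (R.exists_isDegreeZeroLocalization h).choose_spec.2.irrelevant_le

/-- The map of `Proj` induced by restriction to a basic open of an affine open. -/
def projRes {V U : S.AffineZariskiSite} (h : V ≤ U) :
    Proj (R.piece V.1) ⟶ Proj (R.piece U.1) :=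
  Proj.map (R.resHom h) (R.irrelevant_le h)

lemma projMap_congr {A B : Type u} [CommRing A] [CommRing B] {𝒜 : ℕ → AddSubgroup A}
    {ℬ : ℕ → AddSubgroup B} [GradedRing 𝒜] [GradedRing ℬ] {φ ψ : 𝒜 →+*ᵍ ℬ} (e : φ = ψ)
    (h : HomogeneousIdeal.irrelevant ℬ ≤ (HomogeneousIdeal.irrelevant 𝒜).map φ)
    (h' : HomogeneousIdeal.irrelevant ℬ ≤ (HomogeneousIdeal.irrelevant 𝒜).map ψ) :
    Proj.map φ h = Proj.map ψ h' := by
  subst e; rfl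

/-- The schemes `Proj Γ(U, 𝓡)`, for `U` affine open in `S`. -/
def projFunctor : S.AffineZariskiSite ⥤ Scheme.{u} where
  obj U := Proj (R.piece U.1)
  map f := R.projRes f.le
  map_id U := (projMap_congr (R.resHom_refl U) _ (by simp)).trans Proj.map_id
  map_comp f g := by
    rw [projRes, projRes, projRes, ← Proj.map_comp]
    exact projMap_congr (R.resHom_comp f.le g.le).symm _ _

/-- The structure map to the degree zero part. -/
def strZero (U : S.Opens) [GradedRing (R.piece U)] : Γ(S, U) →+* R.piece U 0 :=
  (R.str U).codRestrict (SetLike.GradeZero.subring (R.piece U)) (R.str_mem U)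

/-- The structure morphism `Proj Γ(U, 𝓡) ⟶ Spec Γ(U, 𝒪_S)`. -/
def projToSpec (U : S.AffineZariskiSite) : Proj (R.piece U.1) ⟶ Spec Γ(S, U.1) :=
  Proj.toSpecZero (R.piece U.1) ≫ Spec.map (CommRingCat.ofHom (R.strZero U.1))

lemma awayι_projToSpec (U : S.AffineZariskiSite) {d : ℕ} {s : R.sec U.1} (hs : s ∈ R.piece U.1 d)
    (hd : 0 < d) : Proj.awayι (R.piece U.1) s hs hd ≫ R.projToSpec U =
      Spec.map (CommRingCat.ofHom ((HomogeneousLocalization.fromZeroRingHom (R.piece U.1)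
        (.powers s)).comp (R.strZero U.1))) := by
  rw [projToSpec, Proj.awayι_toSpecZero_assoc, ← Spec.map_comp]
  rfl

lemma away_map_strZero {V U : S.AffineZariskiSite} (h : V ≤ U) (s : R.sec U.1) :
    (HomogeneousLocalization.Away.map (R.resHom h) s).comp
      ((HomogeneousLocalization.fromZeroRingHom (R.piece U.1) (.powers s)).comp (R.strZero U.1)) =
    ((HomogeneousLocalization.fromZeroRingHom (R.piece V.1) (.powers (R.resHom h s))).comp
      (R.strZero V.1)).comp
      (S.presheaf.map (homOfLE (Scheme.AffineZariskiSite.toOpens_mono h)).op).hom := by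
  ext x
  have e : R.resHom h (R.str U.1 x) = R.str V.1
      ((S.presheaf.map (homOfLE (Scheme.AffineZariskiSite.toOpens_mono h)).op).hom x) :=
    R.res_str _ _
  change Localization.mk (R.resHom h (R.str U.1 x)) _ = Localization.mk (R.str V.1 _) _
  rw [e]
  congr 1
  exact Subtype.ext (map_one _)

lemma awayι_projRes_projToSpec {V U : S.AffineZariskiSite} (h : V ≤ U) {d : ℕ} {s : R.sec U.1}
    (hs : s ∈ R.piece U.1 d) (hd : 0 < d) :
    Proj.awayι (R.piece V.1) (R.resHom h s) (map_mem (R.resHom h) hs) hd ≫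
      R.projRes h ≫ R.projToSpec U =
    Proj.awayι (R.piece V.1) (R.resHom h s) (map_mem (R.resHom h) hs) hd ≫ R.projToSpec V ≫
      Spec.map (S.presheaf.map (homOfLE (Scheme.AffineZariskiSite.toOpens_mono h)).op) := by
  rw [projRes, Proj.awayι_comp_map_assoc _ _ hd s hs, awayι_projToSpec,
    reassoc_of% R.awayι_projToSpec V (map_mem (R.resHom h) hs) hd, ← Spec.map_comp,
    ← Spec.map_comp]
  congr 1
  ext1
  exact R.away_map_strZero h s

lemma projRes_projToSpec {V U : S.AffineZariskiSite} (h : V ≤ U) :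
    R.projRes h ≫ R.projToSpec U = R.projToSpec V ≫
      Spec.map (S.presheaf.map (homOfLE (Scheme.AffineZariskiSite.toOpens_mono h)).op) :=
  (Proj.mapAffineOpenCover _ (R.irrelevant_le h)).openCover.hom_ext _ _ fun s ↦
    R.awayι_projRes_projToSpec h s.2.2 s.1.2

instance {V U : S.AffineZariskiSite} (h : V ≤ U) : IsOpenImmersion (R.projRes h) :=
  (R.exists_isDegreeZeroLocalization h).choose_spec.2.isOpenImmersion_map

lemma awayι_mem_range_projRes (U : S.AffineZariskiSite) (f : Γ(S, U.1)) {d : ℕ} {s : R.sec U.1}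
    (hs : s ∈ R.piece U.1 d) (hd : 0 < d)
    (x : Spec (.of (HomogeneousLocalization.Away (R.piece U.1) s)))
    (hp : (Proj.awayι (R.piece U.1) s hs hd ≫ R.projToSpec U) x ∈ PrimeSpectrum.basicOpen f) :
    Proj.awayι (R.piece U.1) s hs hd x ∈ Set.range (R.projRes (U.basicOpen_le f)) := by
  rw [awayι_projToSpec] at hp
  have h := R.isDegreeZeroLocalization U f
  let := (HomogeneousLocalization.Away.map (R.resHom (U.basicOpen_le f)) s).toAlgebra
  have := h.isLocalization_away hs
  have hx : x ∈ Set.range (PrimeSpectrum.comap (algebraMap _ (HomogeneousLocalization.Away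
      (R.piece (U.basicOpen f).1) (R.resHom (U.basicOpen_le f) s)))) := by
    rw [PrimeSpectrum.localization_away_comap_range _
      (HomogeneousLocalization.fromZeroRingHom (R.piece U.1) (.powers s) ⟨R.str U.1 f, h.mem⟩)]
    exact hp
  obtain ⟨y, rfl⟩ := hx
  refine ⟨Proj.awayι _ _ (map_mem (R.resHom (U.basicOpen_le f)) hs) hd y, ?_⟩
  exact congr($(Proj.awayι_comp_map _ (R.irrelevant_le (U.basicOpen_le f)) hd s hs) y)

lemma mem_range_projRes (U : S.AffineZariskiSite) (f : Γ(S, U.1)) (p : Proj (R.piece U.1))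
    (hp : R.projToSpec U p ∈ PrimeSpectrum.basicOpen f) :
    p ∈ Set.range (R.projRes (U.basicOpen_le f)) := by
  obtain ⟨s, x, rfl⟩ := (Proj.affineOpenCover (R.piece U.1)).openCover.exists_eq p
  exact R.awayι_mem_range_projRes U f s.2.2 s.1.2 x hp

lemma isOpenImmersion_specRes {V U : S.AffineZariskiSite} (h : V ≤ U) : IsOpenImmersion
    (Spec.map (S.presheaf.map (homOfLE (Scheme.AffineZariskiSite.toOpens_mono h)).op)) := by
  have := U.2.map_fromSpec V.2 (homOfLE (Scheme.AffineZariskiSite.toOpens_mono h)).op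
  have : IsOpenImmersion (Spec.map (S.presheaf.map
      (homOfLE (Scheme.AffineZariskiSite.toOpens_mono h)).op) ≫ U.2.fromSpec) := by
    rw [this]; infer_instance
  exact IsOpenImmersion.of_comp _ U.2.fromSpec

lemma isPullback_projRes {V U : S.AffineZariskiSite} (h : V ≤ U) :
    IsPullback (R.projRes h) (R.projToSpec V) (R.projToSpec U)
      (Spec.map (S.presheaf.map (homOfLE (Scheme.AffineZariskiSite.toOpens_mono h)).op)) := by
  have := isOpenImmersion_specRes h
  refine (IsOpenImmersion.isPullback _ _ _ _ (R.projRes_projToSpec h) ?_).flip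
  obtain ⟨f, hf⟩ := h
  obtain rfl : U.basicOpen f = V := Subtype.ext hf
  ext p
  constructor
  · rintro ⟨y, hy⟩
    refine R.mem_range_projRes U f p ?_
    have hu : IsUnit ((S.presheaf.map (homOfLE (S.basicOpen_le f)).op).hom f) :=
      RingedSpace.isUnit_res_basicOpen _ f
    rw [← hy]
    exact fun h ↦ y.2.ne_top (Ideal.eq_top_of_isUnit_mem _ h hu)
  · rintro ⟨q, rfl⟩
    exact ⟨_, congr($(R.projRes_projToSpec (U.basicOpen_le f)) q).symm⟩

/-- The structure morphisms are compatible with restriction. -/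
def projToSpecNatTrans : R.projFunctor ⟶
    Scheme.AffineZariskiSite.toOpensFunctor S ⋙ S.presheaf.rightOp ⋙ Scheme.Spec where
  app U := R.projToSpec U
  naturality _ _ f := R.projRes_projToSpec f.le

/-- The schemes `Proj Γ(U, 𝓡)` over the affine opens `U` of `S` form a gluing datum. -/
def gluingData : (Scheme.AffineZariskiSite.directedCover S).RelativeGluingData where
  functor := R.projFunctor
  natTrans := R.projToSpecNatTrans ≫ (Scheme.AffineZariskiSite.restrictIsoSpec S).inv
  equifibered := by
    have : IsIso (Scheme.AffineZariskiSite.restrictIsoSpec S).inv := Iso.isIso_inv _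
    exact NatTrans.Equifibered.comp (fun _ _ f ↦ R.isPullback_projRes f.le)
      (@NatTrans.Equifibered.of_isIso _ _ _ _ _ _ _ this)

instance : (R.gluingData.functor ⋙ Scheme.forget).IsLocallyDirected :=
  Scheme.Cover.RelativeGluingData.instIsLocallyDirectedI₀CompFunctorForgetOfIsThin ..

/-- The relative `Proj` of a quasi-coherent graded algebra, glued from the schemes `Proj Γ(U, 𝓡)`. -/
def proj : Scheme.{u} := R.gluingData.glued

/-- The structure morphism of the relative `Proj`. -/
def projToBase : R.proj ⟶ S := R.gluingData.toBase

/-- The open immersion of `Proj Γ(U, 𝓡)` in the relative `Proj`. -/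
def projChart (U : S.AffineZariskiSite) : Proj (R.piece U.1) ⟶ R.proj :=
  R.gluingData.cover.f U

lemma isPullback_projChart (U : S.AffineZariskiSite) :
    IsPullback (R.projChart U) (R.projToSpec U) R.projToBase U.2.fromSpec := by
  refine (R.gluingData.isPullback_natTrans_ι_toBase U).flip.of_iso (.refl _) (.refl _)
    U.2.isoSpec (.refl _) ?_ ?_ ?_ ?_
  · change 𝟙 _ ≫ R.projChart U = R.projChart U ≫ 𝟙 _
    simp
  · change (R.projToSpec U ≫ U.2.isoSpec.inv) ≫ U.2.isoSpec.hom = 𝟙 _ ≫ R.projToSpec U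
    simp
  · change R.projToBase ≫ 𝟙 _ = 𝟙 _ ≫ R.projToBase
    simp
  · change U.1.ι ≫ 𝟙 _ = U.2.isoSpec.hom ≫ U.2.fromSpec
    rw [← U.2.isoSpec_inv_ι, Iso.hom_inv_id_assoc, Category.comp_id]

instance (U : S.AffineZariskiSite) : IsOpenImmersion (R.projChart U) :=
  MorphismProperty.of_isPullback (R.isPullback_projChart U).flip inferInstance

instance (U : S.AffineZariskiSite) : IsSeparated (R.projToSpec U) := by
  unfold projToSpec; infer_instance

instance : IsSeparated R.projToBase := by
  rw [IsZariskiLocalAtTarget.iff_of_openCover (P := @IsSeparated)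
    (Scheme.AffineZariskiSite.directedCover S)]
  intro U
  have h := R.gluingData.isPullback_natTrans_ι_toBase U
  have : IsSeparated (R.gluingData.natTrans.app U) :=
    inferInstanceAs (IsSeparated (R.projToSpec U ≫ U.2.isoSpec.inv))
  have key : IsSeparated (h.flip.isoPullback.inv ≫ R.gluingData.natTrans.app U) := inferInstance
  rw [h.flip.isoPullback_inv_snd] at key
  exact key

/-- The structure morphism `Spec R_(f) ⟶ Spec A` for `R = Γ(U, 𝓡)`, `A = Γ(U, 𝒪_S)`, `f : R`. -/
def awayToSpec (U : S.AffineZariskiSite) (f : R.sec U.1) :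
    Spec (.of (HomogeneousLocalization.Away (R.piece U.1) f)) ⟶ Spec Γ(S, U.1) :=
  Spec.map (CommRingCat.ofHom ((HomogeneousLocalization.fromZeroRingHom (R.piece U.1)
    (.powers f)).comp (R.strZero U.1)))

/-- The open immersion of `Spec R_(f)` in the relative `Proj`, for `f` homogeneous of positive
degree. -/
def awayToProj (U : S.AffineZariskiSite) {d : ℕ} {f : R.sec U.1} (hf : f ∈ R.piece U.1 d)
    (hd : 0 < d) : Spec (.of (HomogeneousLocalization.Away (R.piece U.1) f)) ⟶ R.proj :=
  Proj.awayι (R.piece U.1) f hf hd ≫ R.projChart U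

instance (U : S.AffineZariskiSite) {d : ℕ} {f : R.sec U.1} (hf : f ∈ R.piece U.1 d)
    (hd : 0 < d) : IsOpenImmersion (R.awayToProj U hf hd) := by
  unfold awayToProj; infer_instance

lemma awayToProj_projToBase (U : S.AffineZariskiSite) {d : ℕ} {f : R.sec U.1}
    (hf : f ∈ R.piece U.1 d) (hd : 0 < d) :
    R.awayToProj U hf hd ≫ R.projToBase = R.awayToSpec U f ≫ U.2.fromSpec := by
  rw [awayToProj, Category.assoc, (R.isPullback_projChart U).w, reassoc_of% awayι_projToSpec]
  rfl

end QCohGradedAlgebra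

lemma bijective_of_isPushout {A B A' B' : CommRingCat.{u}} {f : A ⟶ B} {g : A ⟶ A'} {g' : B ⟶ B'}
    {f' : A' ⟶ B'} (h : IsPushout f g g' f') {n : ℕ} (e : Fin n → B)
    (he : Function.Bijective fun a : Fin n → A ↦ ∑ i, f (a i) * e i) :
    Function.Bijective fun a : Fin n → A' ↦ ∑ i, f' (a i) * g' (e i) := by
  algebraize [f.hom, g.hom, g'.hom, f'.hom, (f ≫ g').hom]
  have : IsScalarTower A A' B' := .of_algebraMap_eq' congr(($h.w).hom)
  have : IsScalarTower A B B' := .of_algebraMap_eq' rfl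
  have hP : Algebra.IsPushout A A' B B' := CommRingCat.isPushout_iff_isPushout.mp h.flip
  let φ : (Fin n → A) ≃ₗ[A] B := .ofBijective
    { toFun a := ∑ i, f (a i) * e i
      map_add' a b := by simp [add_mul, Finset.sum_add_distrib]
      map_smul' r a := by
        simp [Finset.mul_sum, Algebra.smul_def, mul_assoc]; rfl } he
  let b : Module.Basis (Fin n) A B := .ofEquivFun φ.symm
  have hb (i) : b i = e i := by
    simp [b, φ, Module.Basis.coe_ofEquivFun, Pi.single_apply,
      apply_ite f, ite_mul]
  let b' := hP.out.basis b
  convert b'.equivFun.symm.bijective using 2 with a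
  rw [Module.Basis.equivFun_symm_apply]
  refine Finset.sum_congr rfl fun i _ ↦ ?_
  rw [Algebra.smul_def, IsBaseChange.basis_apply, hb]
  rfl

/-- `π_* 𝒪_Z` is a locally free `𝒪_T`-module of rank `n`: locally on `T` there are `n` sections
of `π_* 𝒪_Z` which induce an isomorphism from the `n`-fold power of the structure sheaf. -/
def IsLocallyFreeOfRank (n : ℕ) {Z T : Scheme.{u}} (π : Z ⟶ T) : Prop :=
  ∀ t : T, ∃ U : T.Opens, t ∈ U ∧ ∃ e : Fin n → Γ(Z, π ⁻¹ᵁ U), ∀ (V : T.Opens) (h : V ≤ U),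
    Function.Bijective fun a : Fin n → Γ(T, V) ↦
      ∑ i, π.app V (a i) * Z.presheaf.map (homOfLE (π.preimage_mono h)).op (e i)

section

variable {Z T : Scheme.{u}} (π : Z ⟶ T) {n : ℕ} {U : T.Opens} (e : Fin n → Γ(Z, π ⁻¹ᵁ U))

/-- The map from the `n`-fold power of the structure sheaf to `π_* 𝒪_Z` given by sections `e`. -/
def combination {V : T.Opens} (h : V ≤ U) (a : Fin n → Γ(T, V)) : Γ(Z, π ⁻¹ᵁ V) :=
  ∑ i, π.app V (a i) * Z.presheaf.map (homOfLE (π.preimage_mono h)).op (e i)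

lemma combination_res {V W : T.Opens} (h : V ≤ U) (h' : W ≤ V) (a : Fin n → Γ(T, V)) :
    combination π e (h'.trans h) (fun i ↦ T.presheaf.map (homOfLE h').op (a i)) =
      Z.presheaf.map (homOfLE (π.preimage_mono h')).op (combination π e h a) := by
  simp only [combination, map_sum, map_mul]
  refine Finset.sum_congr rfl fun i _ ↦ ?_
  congr 1
  · exact congr($(π.naturality (homOfLE h').op) (a i))
  · rw [← CommRingCat.comp_apply, ← Functor.map_comp]; rfl

lemma le_iSup_affine (V : T.Opens) :
    V ≤ ⨆ W : {W : T.Opens // IsAffineOpen W ∧ W ≤ V}, W.1 := by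
  intro x hx
  obtain ⟨_, ⟨W, hW, rfl⟩, hxW, hWV⟩ :=
    T.isBasis_affineOpens.exists_subset_of_mem_open hx V.isOpen
  exact Opens.mem_iSup.mpr ⟨⟨W, hW, hWV⟩, hxW⟩

lemma injective_combination
    (H : ∀ {V : T.Opens} (h : V ≤ U), IsAffineOpen V → Function.Injective (combination π e h))
    {V : T.Opens} (h : V ≤ U) : Function.Injective (combination π e h) := by
  intro a b hab
  funext i
  refine T.sheaf.eq_of_locally_eq' _ V (fun W ↦ homOfLE W.2.2) (le_iSup_affine V) _ _ fun W ↦ ?_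
  exact congr_fun (H (W.2.2.trans h) W.2.1 (((combination_res π e h W.2.2 a).trans
    congr(Z.presheaf.map _ $hab)).trans (combination_res π e h W.2.2 b).symm)) i

lemma bijective_combination
    (H : ∀ {V : T.Opens} (h : V ≤ U), IsAffineOpen V → Function.Bijective (combination π e h))
    {V : T.Opens} (h : V ≤ U) : Function.Bijective (combination π e h) := by
  have inj {V : T.Opens} (h : V ≤ U) : Function.Injective (combination π e h) :=
    injective_combination π e (fun h h' ↦ (H h h').1) h
  refine ⟨inj h, fun z ↦ ?_⟩
  choose a ha using fun W : {W : T.Opens // IsAffineOpen W ∧ W ≤ V} ↦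
    (H (W.2.2.trans h) W.2.1).2 (Z.presheaf.map (homOfLE (π.preimage_mono W.2.2)).op z)
  have hc (i) (W W' : {W : T.Opens // IsAffineOpen W ∧ W ≤ V}) :
      T.presheaf.map (homOfLE (inf_le_left : W.1 ⊓ W'.1 ≤ W.1)).op (a W i) =
        T.presheaf.map (homOfLE (inf_le_right : W.1 ⊓ W'.1 ≤ W'.1)).op (a W' i) := by
    refine congr_fun (inj (inf_le_left.trans (W.2.2.trans h))
      (a₁ := fun i ↦ T.presheaf.map (homOfLE (inf_le_left : W.1 ⊓ W'.1 ≤ W.1)).op (a W i))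
      (a₂ := fun i ↦ T.presheaf.map (homOfLE (inf_le_right : W.1 ⊓ W'.1 ≤ W'.1)).op (a W' i)) ?_) i
    refine (combination_res π e (W.2.2.trans h) inf_le_left (a W)).trans
      (.trans ?_ (combination_res π e (W'.2.2.trans h) inf_le_right (a W')).symm)
    rw [ha, ha, ← CommRingCat.comp_apply, ← CommRingCat.comp_apply, ← Functor.map_comp,
      ← Functor.map_comp]
    rfl
  choose b hb using fun i ↦ (T.sheaf.existsUnique_gluing'
    (fun W : {W : T.Opens // IsAffineOpen W ∧ W ≤ V} ↦ W.1) V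
    (fun W ↦ homOfLE W.2.2) (le_iSup_affine V) (fun W ↦ a W i) (hc i)).exists
  refine ⟨b, Z.sheaf.eq_of_locally_eq' (fun W : {W : T.Opens // IsAffineOpen W ∧ W ≤ V} ↦
    π ⁻¹ᵁ W.1) _ (fun W ↦ homOfLE (π.preimage_mono W.2.2)) ?_ _ _ fun W ↦ ?_⟩
  · intro x hx
    obtain ⟨W, hW⟩ := Opens.mem_iSup.mp (le_iSup_affine V hx)
    exact Opens.mem_iSup.mpr ⟨W, hW⟩
  · refine (combination_res π e h W.2.2 b).symm.trans (.trans ?_ (ha W))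
    congr 1
    funext i
    exact hb i W

end

lemma IsLocallyFreeOfRank.of_isPullback {Z T Z' T' : Scheme.{u}} {π : Z ⟶ T} {g : T' ⟶ T}
    {g' : Z' ⟶ Z} {π' : Z' ⟶ T'} [IsAffineHom π] (H : IsPullback g' π' π g) {n : ℕ}
    (h : IsLocallyFreeOfRank n π) : IsLocallyFreeOfRank n π' := by
  intro t'
  obtain ⟨U, hU, e, he⟩ := h (g t')
  obtain ⟨_, ⟨U₀, hU₀, rfl⟩, htU₀, hU₀U⟩ :=
    T.isBasis_affineOpens.exists_subset_of_mem_open hU U.isOpen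
  let e₀ (i : Fin n) : Γ(Z, π ⁻¹ᵁ U₀) := Z.presheaf.map (homOfLE (π.preimage_mono hU₀U)).op (e i)
  have hle {V : T'.Opens} (hV : V ≤ g ⁻¹ᵁ U₀) : π' ⁻¹ᵁ V ≤ g' ⁻¹ᵁ π ⁻¹ᵁ U₀ := by
    rw [← Scheme.Hom.comp_preimage, H.w]
    exact π'.preimage_mono hV
  refine ⟨g ⁻¹ᵁ U₀, htU₀, fun i ↦ g'.appLE _ _ (hle le_rfl) (e₀ i), fun V hV ↦ ?_⟩
  refine bijective_combination π' _ (fun {V} hV hVa ↦ ?_) hV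
  have hp := (isIso_pushoutSection_iff H hV le_rfl (UX := π ⁻¹ᵁ U₀) (UY := π' ⁻¹ᵁ V)
    (inf_eq_right.mpr (hle hV)).symm).mp
      (isIso_pushoutSection_of_isAffineOpen _ _ _ _ hU₀ hVa (hU₀.preimage π))
  have := bijective_of_isPushout hp e₀ (by
    rw [Scheme.Hom.appLE_eq_app]
    exact he U₀ hU₀U)
  convert this using 2 with a
  refine Finset.sum_congr rfl fun i _ ↦ ?_
  congr 1
  · rw [Scheme.Hom.appLE_eq_app]
  · rw [← CommRingCat.comp_apply, Scheme.Hom.appLE_map]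

/-- The `T`-valued points of the Hilbert functor of `n` points of `p : X ⟶ S`, for `t : T ⟶ S`:
closed subschemes `Z` of `T ×_S X`, given by their ideal sheaves, that are finite over `T` and such
that the direct image of `𝒪_Z` is a locally free `𝒪_T`-module of rank `n`. -/
@[ext]
structure HilbPoints (n : ℕ) {X S T : Scheme.{u}} (p : X ⟶ S) (t : T ⟶ S) : Type u where
  ideal : (pullback t p).IdealSheafData
  isFinite : IsFinite (ideal.subschemeι ≫ pullback.fst t p)
  isLocallyFree : IsLocallyFreeOfRank n (ideal.subschemeι ≫ pullback.fst t p)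

/-- The map `T' ×_S X ⟶ T ×_S X` induced by a morphism `g : T' ⟶ T` over `S`. -/
def baseChangeMap {X S T T' : Scheme.{u}} (p : X ⟶ S) {t : T ⟶ S} {t' : T' ⟶ S} (g : T' ⟶ T)
    (e : g ≫ t = t') : pullback t' p ⟶ pullback t p :=
  pullback.lift (pullback.fst t' p ≫ g) (pullback.snd t' p)
    (by rw [Category.assoc, e, pullback.condition])

section

variable {X S T T' T'' : Scheme.{u}} (p : X ⟶ S) {t : T ⟶ S} {t' : T' ⟶ S} {t'' : T'' ⟶ S}
  (g : T' ⟶ T) (e : g ≫ t = t') (g' : T'' ⟶ T') (e' : g' ≫ t' = t'')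

@[simp]
lemma baseChangeMap_fst : baseChangeMap p g e ≫ pullback.fst t p = pullback.fst t' p ≫ g :=
  pullback.lift_fst _ _ _

@[simp]
lemma baseChangeMap_snd : baseChangeMap p g e ≫ pullback.snd t p = pullback.snd t' p :=
  pullback.lift_snd _ _ _

lemma baseChangeMap_id (e : 𝟙 T ≫ t = t) : baseChangeMap p (𝟙 T) e = 𝟙 _ := by
  apply pullback.hom_ext <;> simp

lemma baseChangeMap_comp (e'' : (g' ≫ g) ≫ t = t'') :
    baseChangeMap p (g' ≫ g) e'' = baseChangeMap p g' e' ≫ baseChangeMap p g e := by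
  apply pullback.hom_ext <;> simp [reassoc_of% (baseChangeMap_fst p g' e')]

lemma isPullback_baseChangeMap :
    IsPullback (baseChangeMap p g e) (pullback.fst t' p) (pullback.fst t p) g := by
  refine .of_right ?_ (baseChangeMap_fst p g e) (IsPullback.of_hasPullback t p).flip
  rw [baseChangeMap_snd, e]
  exact (IsPullback.of_hasPullback t' p).flip

lemma isPullback_comap {X Y : Scheme.{u}} (f : X ⟶ Y) (I : Y.IdealSheafData) :
    IsPullback (I.comap f).subschemeι
      (Scheme.IdealSheafData.subschemeMap _ _ f (I.le_map_comap f)) f I.subschemeι :=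
  isPullback_of_isClosedImmersion _ _ _ _ (by simp) (by simp)

lemma ker_eq_comap_of_isPullback {Z Y Z' Y' : Scheme.{u}} {i : Z ⟶ Y} {f : Y' ⟶ Y} {i' : Z' ⟶ Y'}
    {f' : Z' ⟶ Z} [IsClosedImmersion i] (h : IsPullback i' f' f i) : i'.ker = i.ker.comap f := by
  rw [← Scheme.IdealSheafData.ker_fst_of_isClosedImmersion, ← h.isoPullback_hom_fst,
    Scheme.Hom.ker_comp_of_isIso]

lemma isPullback_comap_baseChangeMap (I : (pullback t p).IdealSheafData) :
    IsPullback (Scheme.IdealSheafData.subschemeMap _ _ (baseChangeMap p g e) (I.le_map_comap _))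
      ((I.comap (baseChangeMap p g e)).subschemeι ≫ pullback.fst t' p)
      (I.subschemeι ≫ pullback.fst t p) g :=
  (isPullback_comap _ I).flip.paste_vert (isPullback_baseChangeMap p g e)

end

namespace HilbPoints

variable {n : ℕ} {X S T T' T'' : Scheme.{u}} {p : X ⟶ S} {t : T ⟶ S} {t' : T' ⟶ S} {t'' : T'' ⟶ S}

/-- Pullback of closed subschemes along a morphism `g : T' ⟶ T` over `S`. -/
def map (g : T' ⟶ T) (e : g ≫ t = t') (Z : HilbPoints n p t) : HilbPoints n p t' where
  ideal := Z.ideal.comap (baseChangeMap p g e)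
  isFinite := MorphismProperty.of_isPullback (isPullback_comap_baseChangeMap p g e Z.ideal)
    Z.isFinite
  isLocallyFree := by
    have := Z.isFinite
    exact Z.isLocallyFree.of_isPullback (isPullback_comap_baseChangeMap p g e Z.ideal)

lemma map_id (e : 𝟙 T ≫ t = t) (Z : HilbPoints n p t) : Z.map (𝟙 T) e = Z := by
  ext1
  simp [map, baseChangeMap_id]

lemma map_comp (g : T' ⟶ T) (e : g ≫ t = t') (g' : T'' ⟶ T') (e' : g' ≫ t' = t'')
    (e'' : (g' ≫ g) ≫ t = t'') (Z : HilbPoints n p t) :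
    Z.map (g' ≫ g) e'' = (Z.map g e).map g' e' := by
  ext1
  simp [map, baseChangeMap_comp p g e g' e' e'']

end HilbPoints

/-- The Hilbert functor of `n` points of `p : X ⟶ S`, on the category of schemes over `S`. -/
def hilb (n : ℕ) {X S : Scheme.{u}} (p : X ⟶ S) : (Over S)ᵒᵖ ⥤ Type u where
  obj T := HilbPoints n p T.unop.hom
  map φ := TypeCat.ofHom (HilbPoints.map φ.unop.left (Over.w φ.unop))
  map_id T := by refine ConcreteCategory.hom_ext _ _ fun Z ↦ ?_; exact Z.map_id _
  map_comp φ ψ := by refine ConcreteCategory.hom_ext _ _ fun Z ↦ ?_; exact Z.map_comp _ _ _ _ _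

lemma HilbPoints.sigma_map_eq {n : ℕ} {W U S T T' : Scheme.{u}} {q : W ⟶ U} {i : U ⟶ S}
    {t' : T' ⟶ S} {h : T ⟶ U} {h' : T' ⟶ U} (g : T' ⟶ T) (e : g ≫ h = h') (w : (g ≫ h) ≫ i = t')
    (w' : h' ≫ i = t') (Z : HilbPoints n q h) :
    (⟨⟨g ≫ h, w⟩, Z.map g rfl⟩ : Σ h : {h : T' ⟶ U // h ≫ i = t'}, HilbPoints n q h.1) =
      ⟨⟨h', w'⟩, Z.map g e⟩ := by
  subst e
  rfl

/-- For a monomorphism `i : U ⟶ S` and `q : W ⟶ U`, the Hilbert functor of `q` viewed as a functor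
on schemes over `S`: a `T`-valued point is a point of the Hilbert functor of `q` for the (unique)
factorization of `T ⟶ S` through `U`, and there are none if there is no such factorization. -/
def hilbExt (n : ℕ) {W U S : Scheme.{u}} (q : W ⟶ U) (i : U ⟶ S) : (Over S)ᵒᵖ ⥤ Type u where
  obj T := Σ h : {h : T.unop.left ⟶ U // h ≫ i = T.unop.hom}, HilbPoints n q h.1
  map φ := TypeCat.ofHom fun Z ↦
    ⟨⟨φ.unop.left ≫ Z.1.1, by rw [Category.assoc, Z.1.2, Over.w]⟩, Z.2.map φ.unop.left rfl⟩
  map_id T := by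
    refine ConcreteCategory.hom_ext _ _ fun Z ↦ ?_
    refine (HilbPoints.sigma_map_eq (𝟙 _) (Category.id_comp _) _ Z.1.2 Z.2).trans ?_
    rw [HilbPoints.map_id]
    rfl
  map_comp φ ψ := by
    refine ConcreteCategory.hom_ext _ _ fun Z ↦ ?_
    refine (HilbPoints.sigma_map_eq (ψ.unop.left ≫ φ.unop.left) (Category.assoc _ _ _) _ ?_
      Z.2).trans ?_
    · simp [Z.1.2]
    · rw [HilbPoints.map_comp φ.unop.left rfl ψ.unop.left rfl]
      rfl

section Incl

variable {n : ℕ} {W U X S T T' : Scheme.{u}} {q : W ⟶ U} {i : U ⟶ S} {p : X ⟶ S} {j : W ⟶ X}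

/-- The map `T ×_U W ⟶ T ×_S X` induced by `j : W ⟶ X` over `i : U ⟶ S`. -/
def inclMap (w : j ≫ p = q ≫ i) {h : T ⟶ U} {t : T ⟶ S} (e : h ≫ i = t) :
    pullback h q ⟶ pullback t p :=
  pullback.lift (pullback.fst h q) (pullback.snd h q ≫ j)
    (by rw [← e, pullback.condition_assoc, Category.assoc, w])

@[simp]
lemma inclMap_fst (w : j ≫ p = q ≫ i) {h : T ⟶ U} {t : T ⟶ S} (e : h ≫ i = t) :
    inclMap w e ≫ pullback.fst t p = pullback.fst h q :=
  pullback.lift_fst _ _ _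

@[simp]
lemma inclMap_snd (w : j ≫ p = q ≫ i) {h : T ⟶ U} {t : T ⟶ S} (e : h ≫ i = t) :
    inclMap w e ≫ pullback.snd t p = pullback.snd h q ≫ j :=
  pullback.lift_snd _ _ _

instance mono_inclMap [Mono j] (w : j ≫ p = q ≫ i) {h : T ⟶ U} {t : T ⟶ S} (e : h ≫ i = t) :
    Mono (inclMap w e) where
  right_cancellation a b hab := by
    apply pullback.hom_ext
    · simpa using congr($hab ≫ pullback.fst t p)
    · rw [← cancel_mono j]
      simpa using congr($hab ≫ pullback.snd t p)

lemma isClosedImmersion_incl [Mono j] [IsSeparated p] (w : j ≫ p = q ≫ i) {h : T ⟶ U} {t : T ⟶ S}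
    (e : h ≫ i = t) (Z : HilbPoints n q h) :
    IsClosedImmersion (Z.ideal.subschemeι ≫ inclMap w e) := by
  rw [IsClosedImmersion.iff_isProper_and_mono]
  refine ⟨?_, inferInstance⟩
  have := Z.isFinite
  have : IsProper ((Z.ideal.subschemeι ≫ inclMap w e) ≫ pullback.fst t p) := by
    rw [Category.assoc, inclMap_fst]
    infer_instance
  exact IsProper.of_comp _ (pullback.fst t p)

lemma isPullback_inclMap (w : j ≫ p = q ≫ i) {h : T ⟶ U} {t : T ⟶ S} (e : h ≫ i = t)
    {h' : T' ⟶ U} {t' : T' ⟶ S} (e' : h' ≫ i = t') (g : T' ⟶ T) (eh : g ≫ h = h')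
    (et : g ≫ t = t') :
    IsPullback (inclMap w e') (baseChangeMap q g eh) (baseChangeMap p g et) (inclMap w e) := by
  refine (IsPullback.of_bot ?_ ?_ (isPullback_baseChangeMap p g et)).flip
  · simpa using isPullback_baseChangeMap q g eh
  · apply pullback.hom_ext <;> simp [reassoc_of% (inclMap_fst w e'),
      reassoc_of% (baseChangeMap_snd q g eh)]

lemma exists_isPullback_ker {Z Y : Scheme.{u}} (f : Z ⟶ Y) [IsClosedImmersion f] (a : Y ⟶ T) :
    ∃ φ, IsPullback φ (f.ker.subschemeι ≫ a) (f ≫ a) (𝟙 T) := by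
  have : IsIso f.toImage := inferInstance
  refine ⟨(asIso f.toImage).inv, IsPullback.of_horiz_isIso ⟨?_⟩⟩
  rw [Iso.inv_comp_eq, Category.comp_id, asIso_hom]
  exact congr($(f.toImage_imageι.symm) ≫ a).trans (Category.assoc _ _ _)

lemma exists_isPullback_incl [Mono j] [IsSeparated p] (w : j ≫ p = q ≫ i) {h : T ⟶ U} {t : T ⟶ S}
    (e : h ≫ i = t) (Z : HilbPoints n q h) :
    ∃ φ, IsPullback φ ((Z.ideal.map (inclMap w e)).subschemeι ≫ pullback.fst t p)
      (Z.ideal.subschemeι ≫ pullback.fst h q) (𝟙 T) := by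
  have := isClosedImmersion_incl w e Z
  have := exists_isPullback_ker (Z.ideal.subschemeι ≫ inclMap w e) (pullback.fst t p)
  rwa [Category.assoc (Z.ideal.subschemeι), inclMap_fst] at this

/-- A closed subscheme of `T ×_U W` that is finite over `T`, viewed as a closed subscheme of
`T ×_S X` (it is closed there because `X` is separated over `S`). -/
def HilbPoints.incl [Mono j] [IsSeparated p] (w : j ≫ p = q ≫ i) {h : T ⟶ U} {t : T ⟶ S}
    (e : h ≫ i = t) (Z : HilbPoints n q h) : HilbPoints n p t where
  ideal := Z.ideal.map (inclMap w e)
  isFinite := by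
    obtain ⟨φ, hφ⟩ := exists_isPullback_incl w e Z
    exact MorphismProperty.of_isPullback hφ Z.isFinite
  isLocallyFree := by
    obtain ⟨φ, hφ⟩ := exists_isPullback_incl w e Z
    have := Z.isFinite
    exact Z.isLocallyFree.of_isPullback hφ

lemma HilbPoints.map_incl [Mono j] [IsSeparated p] (w : j ≫ p = q ≫ i) {h : T ⟶ U} {t : T ⟶ S}
    (e : h ≫ i = t) {h' : T' ⟶ U} {t' : T' ⟶ S} (e' : h' ≫ i = t') (g : T' ⟶ T) (eh : g ≫ h = h')
    (et : g ≫ t = t') (Z : HilbPoints n q h) :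
    (Z.map g eh).incl w e' = (Z.incl w e).map g et := by
  ext1
  have := isClosedImmersion_incl w e Z
  exact ker_eq_comap_of_isPullback
    ((isPullback_comap (baseChangeMap q g eh) Z.ideal).paste_horiz
      (isPullback_inclMap w e e' g eh et))

/-- For `j : W ⟶ X` over `i : U ⟶ S`, the natural transformation from the Hilbert functor of `W`
over `U`, viewed as a functor on schemes over `S`, to the Hilbert functor of `X` over `S`, which
regards a closed subscheme of `T ×_U W` as a closed subscheme of `T ×_S X`. -/
def hilbIncl (n : ℕ) [Mono j] [IsSeparated p] (w : j ≫ p = q ≫ i) : hilbExt n q i ⟶ hilb n p where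
  app T := TypeCat.ofHom fun Z ↦ Z.2.incl w Z.1.2
  naturality T T' φ := by
    refine ConcreteCategory.hom_ext _ _ fun Z ↦ ?_
    exact Z.2.map_incl w _ _ _ _ _

end Incl

/-- Open subfunctors: monomorphisms whose pullbacks to representable functors are represented by
open immersions. -/
def IsOpenSubfunctor {S : Scheme.{u}} {F G : (Over S)ᵒᵖ ⥤ Type u} (f : F ⟶ G) : Prop :=
  Mono f ∧ (MorphismProperty.inverseImage @IsOpenImmersion (Over.forget S)).presheaf f

namespace QCohGradedAlgebra

variable {S : Scheme.{u}} (R : QCohGradedAlgebra S)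

/-- The Hilbert functor of `n` points of the relative `Proj` of `𝓡` over `S`. -/
def hilbProj (n : ℕ) : (Over S)ᵒᵖ ⥤ Type u := hilb n R.projToBase

/-- The Hilbert functor of `n` points of `Spec R_(f)` over `Spec A`, on schemes over `Spec A`. -/
def hilbAway (n : ℕ) (U : S.AffineZariskiSite) (f : R.sec U.1) :
    (Over (Spec Γ(S, U.1)))ᵒᵖ ⥤ Type u :=
  hilb n (R.awayToSpec U f)

/-- The Hilbert functor of `n` points of `Spec R_(f)` over `Spec A`, on schemes over `S`. -/
def hilbAwayExt (n : ℕ) (U : S.AffineZariskiSite) (f : R.sec U.1) : (Over S)ᵒᵖ ⥤ Type u :=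
  hilbExt n (R.awayToSpec U f) U.2.fromSpec

/-- The inclusion of the Hilbert functor of `Spec R_(f)` over `Spec A` in that of the relative
`Proj` of `𝓡` over `S`. -/
def hilbAwayIncl (n : ℕ) (U : S.AffineZariskiSite) {d : ℕ} {f : R.sec U.1}
    (hf : f ∈ R.piece U.1 d) (hd : 0 < d) : R.hilbAwayExt n U f ⟶ R.hilbProj n :=
  hilbIncl n (R.awayToProj_projToBase U hf hd)

end QCohGradedAlgebra

end HilbertPoints

end

/-!
Call a closed subscheme `Z` of `T × Spec B`, finite over `T`, framed by `b₁, …, bₙ ∈ B` if these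
restrict to a basis of `p_* 𝒪_Z`. A framed `Z` amounts to the map expressing the elements of `B` in
that basis, so framed `Z` are classified by the spectrum of an explicit ring of coordinates. Being
framed is the invertibility of a determinant, an open condition, and by Nakayama every `Z` is framed
locally on `T` by some `bᵢ`: gluing gives the representability for affine schemes. For `Proj 𝓡`, the
inclusion `Z ⊆ T × Spec R_(f)` is an open condition on `T` because `Z → T` is closed, and a finite
fibre lies in a single `Spec R_(f)` by homogeneous prime avoidance; gluing again gives the theorem.
-/

noncomputable section

namespace HilbertPoints

section LinearCombination

variable {C E C' E' ι : Type*} [CommRing C] [CommRing E] [CommRing C'] [CommRing E'] [Fintype ι]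

/-- The linear combinations of the family `e` with coefficients in `C`, which acts through the ring
homomorphism `α`. -/
def linearCombination (α : C →+* E) (e : ι → E) : (ι → C) →ₛₗ[α] E where
  toFun a := ∑ i, α (a i) * e i
  map_add' a a' := by simp [add_mul, Finset.sum_add_distrib]
  map_smul' r a := by simp [Finset.mul_sum, mul_assoc]

lemma linearCombination_apply (α : C →+* E) (e : ι → E) (a : ι → C) :
    linearCombination α e a = ∑ i, α (a i) * e i := rfl

lemma linearCombination_single [DecidableEq ι] (α : C →+* E) (e : ι → E) (i : ι) :
    linearCombination α e (Pi.single i 1) = e i := by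
  simp [linearCombination_apply, Pi.single_apply, apply_ite α, ite_mul]

lemma map_linearCombination {α : C →+* E} {α' : C' →+* E'} {σ : C →+* C'} {τ : E →+* E'}
    (h : ∀ c, τ (α c) = α' (σ c)) (e : ι → E) (a : ι → C) :
    τ (linearCombination α e a) = linearCombination α' (τ ∘ e) (σ ∘ a) := by
  simp [linearCombination_apply, h]

lemma bijective_linearCombination_iff {α : C →+* E} {α' : C' →+* E'} {σ : C →+* C'} {τ : E →+* E'}
    (hσ : Function.Bijective σ) (hτ : Function.Bijective τ) (h : ∀ c, τ (α c) = α' (σ c))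
    (e : ι → E) : Function.Bijective (linearCombination α e) ↔
      Function.Bijective (linearCombination α' (τ ∘ e)) := by
  have hσ' : Function.Bijective fun a : ι → C ↦ σ ∘ a :=
    ⟨hσ.1.comp_left, hσ.2.comp_left⟩
  rw [← hτ.of_comp_iff' (linearCombination α e),
    ← Function.Bijective.of_comp_iff (linearCombination α' (τ ∘ e)) hσ']
  exact iff_of_eq congr(Function.Bijective $(funext (map_linearCombination h e)))

lemma linearCombination_vecMul (α : C →+* E) {e b : ι → E} (M : Matrix ι ι C)
    (hb : ∀ i, b i = linearCombination α e (M i)) (a : ι → C) :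
    linearCombination α b a = linearCombination α e (Matrix.vecMul a M) := by
  rw [Matrix.vecMul_eq_sum, map_sum]
  simp_rw [map_smulₛₗ]
  exact Finset.sum_congr rfl fun i _ ↦ congr(_ * $(hb i))

end LinearCombination

section Coordinates

open scoped Matrix IsMulCommutative

variable {A B C E ι : Type*} [CommRing A] [CommRing B] [CommRing C] [CommRing E]
  [Fintype ι] [DecidableEq ι]

/-- For ring homomorphisms `φ : A → B`, `θ : A → C` and a family `b` in `B`, the map `c` satisfies
the identities that hold for the coordinates, in the basis `b`, of the image of `B` in a quotient
algebra of `C ⊗ B` that is free over `C` with basis `b`. -/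
structure IsCoordinateMap (φ : A →+* B) (θ : A →+* C) (b : ι → B) (c : B → ι → C) : Prop where
  protected map_add (x y : B) : c (x + y) = c x + c y
  protected map_smul (a : A) (x : B) : c (φ a * x) = θ a • c x
  protected map_basis (i : ι) : c (b i) = Pi.single i 1
  protected map_mul (x y : B) : c (x * y) = ∑ i, c y i • c (x * b i)

lemma exists_isCoordinateMap {φ : A →+* B} {θ : A →+* C} {α : C →+* E} {β : B →+* E}
    (h : ∀ a, α (θ a) = β (φ a)) {b : ι → B}
    (hb : Function.Bijective (linearCombination α (β ∘ b))) :
    ∃ c, IsCoordinateMap φ θ b c ∧ ∀ x, β x = linearCombination α (β ∘ b) (c x) := by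
  choose c hc using fun x ↦ hb.2 (β x)
  refine ⟨c, ⟨fun x y ↦ hb.1 ?_, fun a x ↦ hb.1 ?_, fun i ↦ hb.1 ?_, fun x y ↦ hb.1 ?_⟩,
    fun x ↦ (hc x).symm⟩
  · rw [map_add, hc, hc, hc, map_add]
  · rw [map_smulₛₗ, hc, hc, map_mul, h, smul_eq_mul]
  · rw [linearCombination_single, hc, Function.comp_apply]
  · calc linearCombination α (β ∘ b) (c (x * y))
        = β x * linearCombination α (β ∘ b) (c y) := by rw [hc, hc, map_mul]
      _ = ∑ i, α (c y i) * β (x * b i) := by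
        simp [linearCombination_apply, Finset.mul_sum, mul_left_comm]
      _ = linearCombination α (β ∘ b) (∑ i, c y i • c (x * b i)) := by
        simp_rw [map_sum, map_smulₛₗ, hc, smul_eq_mul]

namespace IsCoordinateMap

variable {φ : A →+* B} {θ : A →+* C} {b : ι → B} {c : B → ι → C}

lemma map_mul_eq_mulVec (h : IsCoordinateMap φ θ b c) (x y : B) :
    c (x * y) = Matrix.of (fun j i ↦ c (x * b i) j) *ᵥ c y := by
  ext j
  simp [h.map_mul x y, Matrix.mulVec, dotProduct, mul_comm]

/-- The matrices, in the basis `b`, of the multiplication by the elements of `B` that a coordinate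
map prescribes. -/
def mulMatrix (h : IsCoordinateMap φ θ b c) : B →+* Matrix ι ι C :=
  .mk' { toFun x := .of fun j i ↦ c (x * b i) j
         map_one' := by
          ext j i
          simp [h.map_basis, Pi.single_apply, Matrix.one_apply]
         map_mul' x y := by
          ext j i
          exact congr_fun (congr(c $(mul_assoc x y (b i))).trans (h.map_mul_eq_mulVec x _)) j }
    fun x y ↦ by
      ext j i
      simp [add_mul, h.map_add]

lemma mulMatrix_mulVec (h : IsCoordinateMap φ θ b c) (x y : B) :
    h.mulMatrix x *ᵥ c y = c (x * y) :=
  (h.map_mul_eq_mulVec x y).symm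

lemma mulMatrix_map (h : IsCoordinateMap φ θ b c) (a : A) :
    h.mulMatrix (φ a) = algebraMap C (Matrix ι ι C) (θ a) := by
  ext j i
  change c (φ a * b i) j = _
  simp [h.map_smul, h.map_basis, Matrix.algebraMap_matrix_apply, Pi.single_apply]

/-- The subalgebra of the matrix algebra generated by the multiplication matrices. It is free with
basis the matrices of the `b i`, and realizes the quotient of `C ⊗ B` that a coordinate map
describes. -/
def mulAlgebra (h : IsCoordinateMap φ θ b c) : Subalgebra C (Matrix ι ι C) :=
  Algebra.adjoin C (Set.range h.mulMatrix)

instance (h : IsCoordinateMap φ θ b c) : IsMulCommutative h.mulAlgebra :=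
  Algebra.isMulCommutative_adjoin C <| by
    rintro _ ⟨x, rfl⟩ _ ⟨y, rfl⟩
    rw [← map_mul, mul_comm, map_mul]

/-- The ring homomorphism from `B` to the algebra generated by the multiplication matrices. -/
def toMulAlgebra (h : IsCoordinateMap φ θ b c) : B →+* h.mulAlgebra :=
  h.mulMatrix.codRestrict h.mulAlgebra fun x ↦ Algebra.subset_adjoin ⟨x, rfl⟩

/-- The structure map of the algebra generated by the multiplication matrices. -/
def scalarHom (h : IsCoordinateMap φ θ b c) : C →+* h.mulAlgebra :=
  algebraMap C h.mulAlgebra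

lemma scalarHom_comp (h : IsCoordinateMap φ θ b c) (a : A) :
    h.scalarHom (θ a) = h.toMulAlgebra (φ a) :=
  Subtype.ext (h.mulMatrix_map a).symm

/-- A matrix of the algebra is determined by its value at the coordinate vector of `1`, because that
vector generates `ι → C` under the commuting matrices of the `b i`. -/
lemma mulVec_one_injective (h : IsCoordinateMap φ θ b c) :
    Function.Injective fun N : h.mulAlgebra ↦ N.1 *ᵥ c 1 := by
  intro N N' e
  refine Subtype.ext (Matrix.ext_of_mulVec_single fun i ↦ ?_)
  have hcomm (P : h.mulAlgebra) : P.1 *ᵥ Pi.single i 1 = h.mulMatrix (b i) *ᵥ (P.1 *ᵥ c 1) := by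
    rw [← h.map_basis, ← mul_one (b i), ← h.mulMatrix_mulVec, mul_one, Matrix.mulVec_mulVec,
      Matrix.mulVec_mulVec]
    exact congr($(mul_comm P (h.toMulAlgebra (b i))).1 *ᵥ c 1)
  rw [hcomm, hcomm]
  exact congr(h.mulMatrix (b i) *ᵥ $e)

lemma linearCombination_mulVec_one (h : IsCoordinateMap φ θ b c) (a : ι → C) :
    (linearCombination h.scalarHom (h.toMulAlgebra ∘ b) a).1 *ᵥ c 1 = a := by
  have hsum : (linearCombination h.scalarHom (h.toMulAlgebra ∘ b) a).1 =
      ∑ i, a i • h.mulMatrix (b i) := by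
    rw [linearCombination_apply]
    refine (map_sum h.mulAlgebra.val _ _).trans (Finset.sum_congr rfl fun i _ ↦ ?_)
    exact (Algebra.smul_def _ _).symm
  ext j
  simp [hsum, Matrix.sum_mulVec, Matrix.smul_mulVec, h.mulMatrix_mulVec, h.map_basis,
    Pi.single_apply]

lemma toMulAlgebra_eq_linearCombination (h : IsCoordinateMap φ θ b c) (x : B) :
    h.toMulAlgebra x = linearCombination h.scalarHom (h.toMulAlgebra ∘ b) (c x) := by
  apply h.mulVec_one_injective
  dsimp only
  rw [linearCombination_mulVec_one]
  exact (h.mulMatrix_mulVec x 1).trans (by rw [mul_one])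

lemma bijective_linearCombination (h : IsCoordinateMap φ θ b c) :
    Function.Bijective (linearCombination h.scalarHom (h.toMulAlgebra ∘ b)) :=
  ⟨Function.LeftInverse.injective (g := fun N : h.mulAlgebra ↦ N.1 *ᵥ c 1)
    h.linearCombination_mulVec_one, fun N ↦
    ⟨N.1 *ᵥ c 1, h.mulVec_one_injective (h.linearCombination_mulVec_one _)⟩⟩

end IsCoordinateMap

/-- The relations that define the universal coordinate map. -/
inductive CoordinateRel (φ : A →+* B) (b : ι → B) :
    MvPolynomial (B × ι) A → MvPolynomial (B × ι) A → Prop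
  | add (x y k) : CoordinateRel φ b (.X (x + y, k)) (.X (x, k) + .X (y, k))
  | smul (a x k) : CoordinateRel φ b (.X (φ a * x, k)) (.C a * .X (x, k))
  | basis (i k) : CoordinateRel φ b (.X (b i, k)) ((Pi.single i 1 : ι → _) k)
  | mul (x y k) : CoordinateRel φ b (.X (x * y, k)) (∑ i, .X (y, i) * .X (x * b i, k))

/-- The ring over which the universal coordinate map is defined. -/
abbrev CoordinateRing (φ : A →+* B) (b : ι → B) : Type _ := RingQuot (CoordinateRel φ b)

/-- The structure map of the coordinate ring. -/
def coordinateRingHom (φ : A →+* B) (b : ι → B) : A →+* CoordinateRing φ b :=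
  (RingQuot.mkRingHom (CoordinateRel φ b)).comp MvPolynomial.C

/-- The universal coordinate map. -/
def coordinateMap (φ : A →+* B) (b : ι → B) (x : B) (k : ι) : CoordinateRing φ b :=
  RingQuot.mkRingHom (CoordinateRel φ b) (.X (x, k))

lemma isCoordinateMap_coordinateMap (φ : A →+* B) (b : ι → B) :
    IsCoordinateMap φ (coordinateRingHom φ b) b (coordinateMap φ b) where
  map_add x y := by
    ext k
    simpa [coordinateMap] using RingQuot.mkRingHom_rel (CoordinateRel.add (φ := φ) (b := b) x y k)
  map_smul a x := by
    ext k
    simpa [coordinateMap, coordinateRingHom] using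
      RingQuot.mkRingHom_rel (CoordinateRel.smul (φ := φ) (b := b) a x k)
  map_basis i := by
    ext k
    simpa [coordinateMap, Pi.single_apply, apply_ite (RingQuot.mkRingHom (CoordinateRel φ b))]
      using RingQuot.mkRingHom_rel (CoordinateRel.basis (φ := φ) (b := b) i k)
  map_mul x y := by
    ext k
    simpa [coordinateMap] using RingQuot.mkRingHom_rel (CoordinateRel.mul (φ := φ) (b := b) x y k)

lemma exists_coordinateRing_hom {φ : A →+* B} {θ : A →+* C} {b : ι → B} {c : B → ι → C}
    (h : IsCoordinateMap φ θ b c) : ∃ g : CoordinateRing φ b →+* C,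
      g.comp (coordinateRingHom φ b) = θ ∧ ∀ x k, g (coordinateMap φ b x k) = c x k := by
  let f : MvPolynomial (B × ι) A →+* C := MvPolynomial.eval₂Hom θ fun x ↦ c x.1 x.2
  have hf : ∀ ⦃x y⦄, CoordinateRel φ b x y → f x = f y := by
    rintro _ _ (⟨x, y, k⟩ | ⟨a, x, k⟩ | ⟨i, k⟩ | ⟨x, y, k⟩)
    · simp [f, h.map_add]
    · simp [f, h.map_smul]
    · simp [f, h.map_basis, Pi.single_apply, apply_ite f]
    · simp [f, h.map_mul x y]
  refine ⟨RingQuot.lift ⟨f, hf⟩, ?_, fun x k ↦ ?_⟩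
  · ext a
    simp [coordinateRingHom, f]
  · simp [coordinateMap, f]

lemma coordinateRing_hom_ext {φ : A →+* B} {b : ι → B} {g g' : CoordinateRing φ b →+* C}
    (h : g.comp (coordinateRingHom φ b) = g'.comp (coordinateRingHom φ b))
    (h' : ∀ x k, g (coordinateMap φ b x k) = g' (coordinateMap φ b x k)) : g = g' := by
  refine RingQuot.ringQuot_ext _ _ (MvPolynomial.ringHom_ext (fun a ↦ congr($h a)) ?_)
  rintro ⟨x, k⟩
  exact h' x k

end Coordinates

section PrimeAvoidance

variable {A σ : Type*} [CommRing A] [SetLike σ A] [AddSubgroupClass σ A] (𝒜 : ℕ → σ)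
  [GradedRing 𝒜]

lemma exists_mem_notMem_of_not_le {I J : HomogeneousIdeal 𝒜} (h : ¬ I ≤ J) :
    ∃ (d : ℕ) (x : A), x ∈ 𝒜 d ∧ x ∈ I ∧ x ∉ J := by
  contrapose! h
  intro x hx
  classical
  rw [← DirectSum.sum_support_decompose 𝒜 x]
  exact sum_mem fun i _ ↦ h i _ (SetLike.coe_mem _) (I.isHomogeneous i hx)

lemma exists_notMem_of_pos (p : ProjectiveSpectrum 𝒜) :
    ∃ (d : ℕ) (x : A), 0 < d ∧ x ∈ 𝒜 d ∧ x ∉ p.asHomogeneousIdeal := by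
  have h := p.not_irrelevant_le
  contrapose! h
  exact (HomogeneousIdeal.irrelevant_le 𝒜).mpr fun i hi x hx ↦ h i x hi hx

lemma exists_notMem_of_forall_not_le (s : Finset (ProjectiveSpectrum 𝒜))
    (p : ProjectiveSpectrum 𝒜) (h : ∀ q ∈ s, ¬ q ≤ p) :
    ∃ (d : ℕ) (g : A), 0 < d ∧ g ∈ 𝒜 d ∧ g ∉ p.asHomogeneousIdeal ∧
      ∀ q ∈ s, g ∈ q.asHomogeneousIdeal := by
  classical
  induction s using Finset.induction_on with
  | empty =>
    obtain ⟨d, x, hd, hx, hxp⟩ := exists_notMem_of_pos 𝒜 p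
    exact ⟨d, x, hd, hx, hxp, by simp⟩
  | insert q s _ ih =>
    rw [Finset.forall_mem_insert] at h
    obtain ⟨d, g, hd, hg, hgp, hgs⟩ := ih h.2
    obtain ⟨e, x, hx, hxq, hxp⟩ := exists_mem_notMem_of_not_le 𝒜 h.1
    refine ⟨d + e, g * x, by omega, SetLike.mul_mem_graded hg hx,
      fun H ↦ (p.isPrime.mem_or_mem H).elim hgp hxp, ?_⟩
    rw [Finset.forall_mem_insert]
    exact ⟨Ideal.mul_mem_left _ _ hxq, fun q' hq' ↦ Ideal.mul_mem_right _ _ (hgs q' hq')⟩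

lemma exists_forall_notMem (s : Finset (ProjectiveSpectrum 𝒜)) :
    ∃ (d : ℕ) (f : A), 0 < d ∧ f ∈ 𝒜 d ∧ ∀ p ∈ s, f ∉ p.asHomogeneousIdeal := by
  classical
  induction s using Finset.strongInduction with
  | H s ih =>
    obtain rfl | hs := s.eq_empty_or_nonempty
    · exact ⟨1, 0, one_pos, zero_mem _, by simp⟩
    obtain ⟨p, hp, hmin⟩ := s.exists_minimal hs
    obtain ⟨d, f, hd, hf, hfs⟩ := ih _ (Finset.erase_ssubset hp)
    rw [← Finset.insert_erase hp]
    simp_rw [Finset.forall_mem_insert]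
    by_cases hfp : f ∈ p.asHomogeneousIdeal
    swap
    · exact ⟨d, f, hd, hf, hfp, hfs⟩
    obtain ⟨e, g, he, hg, hgp, hgs⟩ := exists_notMem_of_forall_not_le 𝒜 (s.erase p) p fun q hq hle ↦
      Finset.ne_of_mem_erase hq (le_antisymm hle (hmin (Finset.mem_of_mem_erase hq) hle))
    refine ⟨e * d, f ^ e + g ^ d, by positivity,
      add_mem (SetLike.pow_mem_graded e hf) (mul_comm d e ▸ SetLike.pow_mem_graded d hg),
      fun h ↦ hgp (p.isPrime.mem_of_pow_mem d ?_),
      fun q hq h ↦ hfs q hq (q.isPrime.mem_of_pow_mem e ?_)⟩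
    · exact (Ideal.add_mem_iff_right _ (Ideal.pow_mem_of_mem _ hfp e he)).mp h
    · exact (Ideal.add_mem_iff_left _ (Ideal.pow_mem_of_mem _ (hgs q hq) d hd)).mp h

end PrimeAvoidance

lemma presheaf_iff_of_injective {C : Type*} [Category.{u} C] {P : MorphismProperty C}
    [P.RespectsIso] (hP : P ≤ .monomorphisms C) {F G : Cᵒᵖ ⥤ Type u} {f : F ⟶ G}
    (hf : ∀ T, Function.Injective (f.app T)) :
    P.presheaf f ↔ ∀ (T : C) (y : G.obj (op T)), ∃ (V : C) (i : V ⟶ T), P i ∧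
      ∀ (T' : C) (g : T' ⟶ T), G.map g.op y ∈ Set.range (f.app (op T')) ↔ ∃ h, h ≫ i = g := by
  refine ⟨fun H T y ↦ ?_, fun H ↦ MorphismProperty.relative.of_exists fun T g ↦ ?_⟩
  · obtain ⟨V, i, x, hpb⟩ := H.rep (yonedaEquiv.symm y)
    refine ⟨V, i, H.property _ _ _ hpb, fun T' g ↦ ?_⟩
    obtain ⟨-, -, hlift⟩ :=
      (Types.isPullback_iff _ _ _ _).mp (hpb.map ((evaluation _ _).obj (op T')))
    constructor
    · rintro ⟨x', hx'⟩
      obtain ⟨h, -, hh⟩ := hlift x' g hx'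
      exact ⟨h, hh⟩
    · rintro ⟨h, rfl⟩
      exact ⟨x.app (op T') h, congr($(hpb.w).app (op T') h)⟩
  · obtain ⟨V, i, hi, hV⟩ := H T (yonedaEquiv g)
    have : Mono i := hP i hi
    obtain ⟨x, hx⟩ := (hV V i).mpr ⟨𝟙 _, Category.id_comp _⟩
    have hg (T' : C) (a : T' ⟶ T) : g.app (op T') a = G.map a.op (yonedaEquiv g) := by
      rw [map_yonedaEquiv]
    have hw : yonedaEquiv.symm x ≫ f = yoneda.map i ≫ g := by
      apply yonedaEquiv.injective
      rw [yonedaEquiv_comp, Equiv.apply_symm_apply, hx, ← yonedaEquiv_naturality]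
    refine ⟨V, yonedaEquiv.symm x, i, IsPullback.of_forall_isPullback_app fun T' ↦ ?_, hi⟩
    refine (Types.isPullback_iff _ _ _ _).mpr
      ⟨congr(($hw).app T'), fun a b h ↦ (cancel_mono i).mp h.2, fun y a hya ↦ ?_⟩
    obtain ⟨h, rfl⟩ := (hV T'.unop a).mp ⟨y, hya.trans (hg _ a)⟩
    exact ⟨h, hf _ ((congr(($hw).app T' h)).trans hya.symm), rfl⟩

section Total

variable {C : Type*} [Category.{u} C] {S : C} {G : (Over S)ᵒᵖ ⥤ Type u}

lemma sigma_map_eq_of_left_eq {T : C} {t t' : T ⟶ S} {U : Over S} (x : G.obj (op U))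
    (φ : Over.mk t ⟶ U) (ψ : Over.mk t' ⟶ U) (h : φ.left = ψ.left) :
    (⟨t, G.map φ.op x⟩ : Σ t : T ⟶ S, G.obj (op (Over.mk t))) = ⟨t', G.map ψ.op x⟩ := by
  obtain rfl : t = t' := (Over.w φ).symm.trans (congr($h ≫ U.hom).trans (Over.w ψ))
  obtain rfl : φ = ψ := Over.OverMorphism.ext h
  rfl

variable (G) in
/-- The presheaf whose value on `T` consists of a morphism `T ⟶ S` together with an element of `G`
over it. -/
def total : Cᵒᵖ ⥤ Type u where
  obj T := Σ t : T.unop ⟶ S, G.obj (op (Over.mk t))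
  map g := TypeCat.ofHom fun x ↦ ⟨g.unop ≫ x.1,
    G.map (Over.homMk g.unop : Over.mk (g.unop ≫ x.1) ⟶ Over.mk x.1).op x.2⟩
  map_id T := by
    refine ConcreteCategory.hom_ext _ _ fun ⟨t, x⟩ ↦ ?_
    refine (sigma_map_eq_of_left_eq x
      (Over.homMk (𝟙 T.unop) : Over.mk (𝟙 T.unop ≫ t) ⟶ Over.mk t) (𝟙 _) rfl).trans ?_
    simp
  map_comp g g' := by
    refine ConcreteCategory.hom_ext _ _ fun ⟨t, x⟩ ↦ ?_
    refine (sigma_map_eq_of_left_eq x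
      (Over.homMk (g'.unop ≫ g.unop) : Over.mk ((g'.unop ≫ g.unop) ≫ t) ⟶ Over.mk t)
      ((Over.homMk g'.unop : Over.mk (g'.unop ≫ g.unop ≫ t) ⟶ Over.mk (g.unop ≫ t)) ≫
        Over.homMk g.unop) rfl).trans ?_
    simp

namespace total

/-- An element of `G` as an element of the total presheaf. -/
def mk {T : Over S} (x : G.obj (op T)) : (total G).obj (op T.left) := ⟨T.hom, x⟩

lemma exists_eq_mk {T : C} (y : (total G).obj (op T)) :
    ∃ (t : T ⟶ S) (x : G.obj (op (Over.mk t))), y = mk x :=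
  ⟨y.1, y.2, rfl⟩

lemma mk_injective {T : Over S} : Function.Injective (mk (G := G) (T := T)) :=
  fun _ _ h ↦ eq_of_heq (Sigma.mk.inj h).2

lemma map_mk {T T' : Over S} (φ : T' ⟶ T) (x : G.obj (op T)) :
    (total G).map φ.left.op (mk x) = mk (G.map φ.op x) :=
  sigma_map_eq_of_left_eq x _ φ rfl

/-- The morphism to the total presheaf induced by an element of `G` over `X`. -/
def desc {X : Over S} (f : yoneda.obj X ⟶ G) : yoneda.obj X.left ⟶ total G :=
  yonedaEquiv.symm (mk (yonedaEquiv f))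

lemma desc_app_left {X T : Over S} (f : yoneda.obj X ⟶ G) (φ : T ⟶ X) :
    (desc f).app (op T.left) φ.left = mk (f.app (op T) φ) :=
  (map_mk φ _).trans congr(mk $(map_yonedaEquiv f φ))

lemma desc_app_injective {X : Over S} {f : yoneda.obj X ⟶ G}
    (hf : ∀ T, Function.Injective (f.app T)) (T : C) :
    Function.Injective ((desc f).app (op T)) := fun (a b : T ⟶ X.left) hab ↦ by
  have e : a ≫ X.hom = b ≫ X.hom := congr(Sigma.fst $hab)
  let φ : Over.mk (b ≫ X.hom) ⟶ X := Over.homMk a e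
  let ψ : Over.mk (b ≫ X.hom) ⟶ X := Over.homMk b
  have h : φ = ψ := hf _ (mk_injective
    ((desc_app_left f φ).symm.trans (hab.trans (desc_app_left f ψ))))
  exact congr(($h).left)

lemma mk_mem_range_desc_app_iff {X T : Over S} {f : yoneda.obj X ⟶ G} {y : G.obj (op T)} :
    mk y ∈ Set.range ((desc f).app (op T.left)) ↔ y ∈ Set.range (f.app (op T)) := by
  constructor
  · rintro ⟨a, ha⟩
    let φ : T ⟶ X := Over.homMk a congr(Sigma.fst $ha)
    exact ⟨φ, mk_injective ((desc_app_left f φ).symm.trans ha)⟩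
  · rintro ⟨φ, rfl⟩
    exact ⟨φ.left, desc_app_left f φ⟩

end total

lemma isRepresentable_of_isRepresentable_total (h : (total G).IsRepresentable) :
    G.IsRepresentable := by
  obtain ⟨X, ⟨r⟩⟩ := h
  obtain ⟨s, x, hx⟩ := total.exists_eq_mk (r.homEquiv (𝟙 X))
  have hr {T : Over S} (φ : T ⟶ Over.mk s) : r.homEquiv φ.left = total.mk (G.map φ.op x) := by
    rw [r.homEquiv_eq, hx]
    exact total.map_mk φ x
  refine ⟨Over.mk s, ⟨⟨fun {T} ↦ .ofBijective (fun φ ↦ G.map φ.op x) ⟨fun φ ψ h ↦ ?_, fun y ↦ ?_⟩,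
    fun φ ψ ↦ congr($(G.map_comp ψ.op φ.op) x)⟩⟩⟩
  · exact Over.OverMorphism.ext (r.homEquiv.injective
      ((hr φ).trans (congr(total.mk $h).trans (hr ψ).symm)))
  · obtain ⟨a, ha⟩ := r.homEquiv.surjective (total.mk y)
    have w : a ≫ s = T.hom := by
      rw [r.homEquiv_eq, hx] at ha
      exact congr(Sigma.fst $ha)
    exact ⟨Over.homMk a w, total.mk_injective ((hr _).symm.trans ha)⟩

end Total

lemma exists_comp_eq_iff_of_isOpenImmersion {V T T' : Scheme.{u}} (i : V ⟶ T) [IsOpenImmersion i]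
    (g : T' ⟶ T) : (∃ h, h ≫ i = g) ↔ ∀ z, g z ∈ i.opensRange := by
  constructor
  · rintro ⟨h, rfl⟩ z
    exact ⟨h z, (Scheme.Hom.comp_apply h i z).symm⟩
  · intro hz
    exact ⟨IsOpenImmersion.lift i g (Set.range_subset_iff.mpr hz), IsOpenImmersion.lift_fac _ _ _⟩

variable {S : Scheme.{u}} {F G : (Over S)ᵒᵖ ⥤ Type u}

lemma exists_over_comp_eq_iff_of_isOpenImmersion {V T T' : Over S} (i : V ⟶ T)
    [IsOpenImmersion i.left] (g : T' ⟶ T) :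
    (∃ h, h ≫ i = g) ↔ ∀ z, g.left z ∈ i.left.opensRange := by
  rw [← exists_comp_eq_iff_of_isOpenImmersion]
  constructor
  · rintro ⟨h, rfl⟩
    exact ⟨h.left, rfl⟩
  · rintro ⟨h, hh⟩
    refine ⟨Over.homMk h ?_, Over.OverMorphism.ext hh⟩
    rw [← Over.w i, reassoc_of% hh, Over.w]

lemma isOpenSubfunctor_iff {f : F ⟶ G} :
    IsOpenSubfunctor f ↔ (∀ T, Function.Injective (f.app T)) ∧
      ∀ (T : Over S) (y : G.obj (op T)), ∃ V : T.left.Opens, ∀ (T' : Over S) (g : T' ⟶ T),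
        G.map g.op y ∈ Set.range (f.app (op T')) ↔ ∀ z, g.left z ∈ V := by
  have hP : MorphismProperty.inverseImage @IsOpenImmersion (Over.forget S) ≤ .monomorphisms _ :=
    fun _ _ i (hi : IsOpenImmersion i.left) ↦ Over.mono_of_mono_left i
  rw [IsOpenSubfunctor, NatTrans.mono_iff_mono_app]
  simp_rw [mono_iff_injective]
  refine and_congr_right fun hf ↦ (presheaf_iff_of_injective hP hf).trans
    (forall₂_congr fun T y ↦ ⟨?_, fun ⟨V, hV⟩ ↦ ?_⟩)
  · rintro ⟨V, i, hi : IsOpenImmersion i.left, hV⟩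
    exact ⟨i.left.opensRange, fun T' g ↦
      (hV T' g).trans (exists_over_comp_eq_iff_of_isOpenImmersion i g)⟩
  · let i : Over.mk (V.ι ≫ T.hom) ⟶ T := Over.homMk V.ι
    have hi : IsOpenImmersion i.left := inferInstanceAs (IsOpenImmersion V.ι)
    refine ⟨_, i, hi, fun T' g ↦ (hV T' g).trans ?_⟩
    rw [exists_over_comp_eq_iff_of_isOpenImmersion, show i.left.opensRange = V from V.opensRange_ι]

/-- The sheaf condition for the Zariski topology, for a presheaf on schemes over `S`. -/
def IsZariskiSheaf (G : (Over S)ᵒᵖ ⥤ Type u) : Prop :=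
  ∀ (T : Over S) (𝒰 : Scheme.OpenCover.{u} T.left) (x : ∀ i, G.obj (op (Over.mk (𝒰.f i ≫ T.hom)))),
    (∀ (i j) (W : Over S) (a : W ⟶ Over.mk (𝒰.f i ≫ T.hom)) (b : W ⟶ Over.mk (𝒰.f j ≫ T.hom)),
      a.left ≫ 𝒰.f i = b.left ≫ 𝒰.f j → G.map a.op (x i) = G.map b.op (x j)) →
    ∃! y : G.obj (op T), ∀ i, G.map (Over.homMk (𝒰.f i) : Over.mk (𝒰.f i ≫ T.hom) ⟶ T).op y = x i

lemma IsZariskiSheaf.isSheaf_total (hG : IsZariskiSheaf G) :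
    Presheaf.IsSheaf Scheme.zariskiTopology.{u} (total G) := by
  rw [isSheaf_iff_isSheaf_of_type,
    Precoverage.isSheaf_toGrothendieck_iff_of_isStableUnderBaseChange_of_small.{u}]
  intro T (𝒰 : Scheme.OpenCover.{u} T)
  refine (Presieve.isSheafFor_arrows_iff _ _).mpr fun x hx ↦ ?_
  let t : T ⟶ S := 𝒰.glueMorphisms (fun i ↦ (x i).1) fun i j ↦
    congr(Sigma.fst $(hx i j _ (pullback.fst _ _) (pullback.snd _ _) pullback.condition))
  have ht (i) : 𝒰.f i ≫ t = (x i).1 := 𝒰.ι_glueMorphisms _ _ _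
  have hx' (i) : ∃ y : G.obj (op (Over.mk (𝒰.f i ≫ t))), total.mk y = x i := by
    obtain ⟨s, y, hy⟩ := total.exists_eq_mk (x i)
    obtain rfl : s = 𝒰.f i ≫ t := by rw [ht, hy]; rfl
    exact ⟨y, hy.symm⟩
  choose y hy using hx'
  obtain ⟨z, hz, huniq⟩ := hG (Over.mk t) 𝒰 y fun i j W a b hab ↦ by
    apply total.mk_injective
    rw [← total.map_mk, ← total.map_mk, hy, hy]
    exact hx i j W.left a.left b.left hab
  refine ⟨total.mk z, fun i ↦ ?_, fun z' hz' ↦ ?_⟩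
  · exact congr(total.mk $(hz i)).trans (hy i)
  · obtain ⟨t', z', rfl⟩ := total.exists_eq_mk z'
    obtain rfl : t' = t := 𝒰.hom_ext _ _ fun i ↦ (congr(Sigma.fst $(hz' i))).trans (ht i).symm
    exact congr(total.mk $(huniq z' fun i ↦ total.mk_injective ((hz' i).trans (hy i).symm)))

lemma IsOpenSubfunctor.presheaf_total_desc {X : Over S} {f : yoneda.obj X ⟶ G}
    (hf : IsOpenSubfunctor f) : IsOpenImmersion.presheaf (total.desc f) := by
  obtain ⟨inj, hopen⟩ := isOpenSubfunctor_iff.mp hf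
  refine (presheaf_iff_of_injective (P := @IsOpenImmersion) IsOpenImmersion.le_monomorphisms
    fun T ↦ total.desc_app_injective inj T.unop).mpr fun T y ↦ ?_
  obtain ⟨t, y, rfl⟩ := total.exists_eq_mk y
  obtain ⟨V, hV⟩ := hopen (Over.mk t) y
  refine ⟨V, V.ι, inferInstance, fun T' g ↦ ?_⟩
  rw [exists_comp_eq_iff_of_isOpenImmersion, V.opensRange_ι]
  exact total.mk_mem_range_desc_app_iff.trans (hV (Over.mk (g ≫ t)) (Over.homMk g))

lemma isLocallySurjective_total_desc {ι : Type u} {X : ι → Over S} (f : ∀ i, yoneda.obj (X i) ⟶ G)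
    (hcov : ∀ (T : Over S) (y : G.obj (op T)) (t : T.left), ∃ V : T.left.Opens, t ∈ V ∧ ∃ i,
      G.map (Over.homMk V.ι : Over.mk (V.ι ≫ T.hom) ⟶ T).op y ∈
        Set.range ((f i).app (op (Over.mk (V.ι ≫ T.hom))))) :
    Presheaf.IsLocallySurjective Scheme.zariskiTopology
      (Sigma.desc fun i ↦ total.desc (f i)) := by
  refine ⟨fun {T} y ↦ ?_⟩
  obtain ⟨t, y, rfl⟩ := total.exists_eq_mk y
  choose V hV i hi using hcov (Over.mk t) y
  let 𝒰 : T.OpenCover := Scheme.openCoverOfIsOpenCover T V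
    (eq_top_iff.mpr fun p _ ↦ Opens.mem_iSup.mpr ⟨p, hV p⟩)
  refine GrothendieckTopology.superset_covering _ ((Sieve.generate_le_iff _ _).mpr ?_)
    𝒰.mem_grothendieckTopology
  rintro _ _ ⟨p⟩
  obtain ⟨a, ha⟩ := total.mk_mem_range_desc_app_iff.mpr (hi p)
  refine ⟨(Sigma.ι (fun i ↦ yoneda.obj (X i).left) (i p)).app _ a, Eq.trans ?_ ha⟩
  exact congr($(Sigma.ι_desc (fun i ↦ total.desc (f i)) (i p)).app _ a)

theorem isRepresentable_of_isOpenSubfunctor (hG : IsZariskiSheaf G) {ι : Type u}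
    (F : ι → (Over S)ᵒᵖ ⥤ Type u) (hF : ∀ i, (F i).IsRepresentable) (f : ∀ i, F i ⟶ G)
    (hf : ∀ i, IsOpenSubfunctor (f i))
    (hcov : ∀ (T : Over S) (y : G.obj (op T)) (t : T.left), ∃ V : T.left.Opens, t ∈ V ∧ ∃ i,
      G.map (Over.homMk V.ι : Over.mk (V.ι ≫ T.hom) ⟶ T).op y ∈
        Set.range ((f i).app (op (Over.mk (V.ι ≫ T.hom))))) :
    G.IsRepresentable := by
  let e (i) : yoneda.obj (F i).reprX ≅ F i := (F i).reprW
  have hrange (i) (T) : Set.range (((e i).hom ≫ f i).app T) = Set.range ((f i).app T) :=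
    ((e i).app T).toEquiv.surjective.range_comp _
  have hef (i) : IsOpenSubfunctor ((e i).hom ≫ f i) := by
    obtain ⟨inj, hopen⟩ := isOpenSubfunctor_iff.mp (hf i)
    refine isOpenSubfunctor_iff.mpr ⟨fun T ↦ (inj T).comp ((e i).app T).toEquiv.injective, ?_⟩
    simpa only [hrange] using hopen
  have := isLocallySurjective_total_desc (fun i ↦ (e i).hom ≫ f i)
    (by simpa only [hrange] using hcov)
  exact isRepresentable_of_isRepresentable_total
    (Scheme.LocalRepresentability.isRepresentable (F := ⟨total G, hG.isSheaf_total⟩)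
      fun i ↦ (hef i).presheaf_total_desc)

section GlueIdeal

lemma app_res {Z Y : Scheme.{u}} (z : Z ⟶ Y) {U V : Y.Opens} (h : V ≤ U) (s : Γ(Y, U)) :
    z.app V (Y.presheaf.map (homOfLE h).op s) =
      Z.presheaf.map (homOfLE (z.preimage_mono h)).op (z.app U s) :=
  congr($(z.naturality (homOfLE h).op) s)

lemma comp_app_apply {X Y Z : Scheme.{u}} (f : X ⟶ Y) (g : Y ⟶ Z) (V : Z.Opens) (s : Γ(Z, V)) :
    (f ≫ g).app V s = f.app (g ⁻¹ᵁ V) (g.app V s) :=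
  congr($(Scheme.Hom.comp_app f g V) s)

lemma res_res {Y : Scheme.{u}} {U V W : Y.Opens} (h : V ≤ U) (h' : W ≤ V) (s : Γ(Y, U)) :
    Y.presheaf.map (homOfLE h').op (Y.presheaf.map (homOfLE h).op s) =
      Y.presheaf.map (homOfLE (h'.trans h)).op s := by
  rw [← CommRingCat.comp_apply, ← Functor.map_comp]
  rfl

lemma exists_pow_mul_app_eq_zero_of_isCompact {Z Y : Scheme.{u}} (z : Z ⟶ Y) {U V : Y.Opens}
    (hVU : V ≤ U) (hV : IsCompact (X := Z) (z ⁻¹ᵁ V)) {f s : Γ(Y, U)}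
    (hs : z.app (Y.basicOpen f) (Y.presheaf.map (homOfLE (Y.basicOpen_le f)).op s) = 0) :
    ∃ N : ℕ, z.app V (Y.presheaf.map (homOfLE hVU).op (f ^ N * s)) = 0 := by
  have hle : Z.basicOpen (z.app V (Y.presheaf.map (homOfLE hVU).op f)) ≤
      z ⁻¹ᵁ (Y.basicOpen f) := by
    rw [← Scheme.preimage_basicOpen, Scheme.basicOpen_res]
    exact z.preimage_mono inf_le_right
  have h₀ : Z.presheaf.map (homOfLE (Z.basicOpen_le
      (z.app V (Y.presheaf.map (homOfLE hVU).op f)))).op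
        (z.app V (Y.presheaf.map (homOfLE hVU).op s)) = 0 := by
    rw [app_res z hVU s]
    have := congr(Z.presheaf.map (homOfLE hle).op
      $((app_res z (Y.basicOpen_le f) s).symm.trans hs))
    rw [map_zero] at this
    exact (res_res _ _ _).trans ((res_res _ _ _).symm.trans this)
  obtain ⟨N, hN⟩ := exists_pow_mul_eq_zero_of_res_basicOpen_eq_zero_of_isCompact Z hV _ _ h₀
  refine ⟨N, ?_⟩
  rwa [map_mul, map_pow, map_mul, map_pow]

section Family

variable {Y : Scheme.{u}} {ι : Type*} {Z : ι → Scheme.{u}} {z : ∀ i, Z i ⟶ Y}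

/-- The morphisms `z i` into `Y` have a common kernel locally on `Y`, computed by a single
quasi-compact member of the family; then their kernels intersect in an ideal sheaf. -/
def HasLocalKernel (z : ∀ i, Z i ⟶ Y) : Prop :=
  ∀ y : Y, ∃ (W : Y.Opens) (i : ι), y ∈ W ∧
    (∀ V ≤ W, IsAffineOpen V → IsCompact (X := Z i) (z i ⁻¹ᵁ V)) ∧
    ∀ V ≤ W, ∀ s : Γ(Y, V), (z i).app V s = 0 → ∀ j, (z j).app V s = 0

lemma HasLocalKernel.exists_pow_mul_app_eq_zero (hz : HasLocalKernel z) {U : Y.Opens}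
    (hU : IsAffineOpen U) {f s : Γ(Y, U)}
    (hs : ∀ j, (z j).app (Y.basicOpen f)
      (Y.presheaf.map (homOfLE (Y.basicOpen_le f)).op s) = 0) :
    ∃ N : ℕ, ∀ j, (z j).app U (f ^ N * s) = 0 := by
  have local_pow (y : U) : ∃ (V : Y.Opens) (hV : V ≤ U) (N : ℕ), y.1 ∈ V ∧
      ∀ j, (z j).app V (Y.presheaf.map (homOfLE hV).op (f ^ N * s)) = 0 := by
    obtain ⟨W, i, hyW, hW, hker⟩ := hz y
    obtain ⟨_, ⟨V, hVa, rfl⟩, hyV, hVUW⟩ := Y.isBasis_affineOpens.exists_subset_of_mem_open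
      (show y.1 ∈ U ⊓ W from ⟨y.2, hyW⟩) (U ⊓ W).isOpen
    have hVU : V ≤ U := fun _ h ↦ (hVUW h).1
    have hVW : V ≤ W := fun _ h ↦ (hVUW h).2
    obtain ⟨N, hN⟩ := exists_pow_mul_app_eq_zero_of_isCompact (z i) hVU (hW V hVW hVa) (hs i)
    exact ⟨V, hVU, N, hyV, hker V hVW _ hN⟩
  choose V hV N hyV hN using local_pow
  obtain ⟨t, ht⟩ := hU.isCompact.elim_finite_subcover (fun y ↦ (V y : Set Y))
    (fun y ↦ (V y).isOpen) fun y hy ↦ Set.mem_iUnion.mpr ⟨⟨y, hy⟩, hyV ⟨y, hy⟩⟩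
  refine ⟨t.sup N, fun j ↦ (Z j).IsSheaf.section_ext fun x hx ↦ ?_⟩
  obtain ⟨y, hy, hxy⟩ := Set.mem_iUnion₂.mp (ht hx)
  refine ⟨z j ⁻¹ᵁ V y, Scheme.Hom.preimage_mono _ (hV y), hxy, ?_⟩
  have hpow : f ^ t.sup N * s = f ^ (t.sup N - N y) * (f ^ N y * s) := by
    rw [← mul_assoc, ← pow_add, Nat.sub_add_cancel (Finset.le_sup hy)]
  refine (app_res _ (hV y) _).symm.trans ?_
  rw [map_zero, hpow, map_mul, map_mul, hN, mul_zero]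

lemma HasLocalKernel.map_iInf_ker (hz : HasLocalKernel z) {U : Y.Opens} (hU : IsAffineOpen U)
    (f : Γ(Y, U)) :
    (⨅ i, RingHom.ker ((z i).app U).hom).map
        (Y.presheaf.map (homOfLE (Y.basicOpen_le f)).op).hom =
      ⨅ i, RingHom.ker ((z i).app (Y.basicOpen f)).hom := by
  let r := Y.presheaf.map (homOfLE (Y.basicOpen_le f)).op
  apply le_antisymm
  · refine Ideal.map_le_iff_le_comap.mpr fun s hs ↦ Ideal.mem_iInf.mpr fun i ↦ ?_
    have hsi : (z i).app U s = 0 := Ideal.mem_iInf.mp hs i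
    refine (app_res _ _ s).trans ?_
    rw [hsi, map_zero]
  · intro s hs
    have := hU.isLocalization_basicOpen f
    obtain ⟨⟨s', _, N, rfl⟩, hs'⟩ := IsLocalization.surj (Submonoid.powers f) s
    replace hs' : s * r (f ^ N) = r s' := hs'
    obtain ⟨M, hM⟩ := hz.exists_pow_mul_app_eq_zero hU (f := f) (s := s') fun j ↦ by
      have hsj : (z j).app _ s = 0 := Ideal.mem_iInf.mp hs j
      rw [← hs', map_mul, hsj, zero_mul]
    have hunit : IsUnit (r f) := RingedSpace.isUnit_res_basicOpen _ f
    refine (Ideal.mul_unit_mem_iff_mem _ ((hunit.pow N).mul (hunit.pow M))).mp ?_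
    have hmul : s * (r f ^ N * r f ^ M) = r (f ^ M * s') := by
      rw [map_mul, ← hs', map_pow, map_pow]
      ring
    rw [hmul]
    exact Ideal.mem_map_of_mem _ (Ideal.mem_iInf.mpr hM)

/-- The ideal sheaf of the sections of `𝒪_Y` killed by all members of a family of morphisms. -/
def HasLocalKernel.ker (hz : HasLocalKernel z) : Y.IdealSheafData where
  ideal U := ⨅ i, RingHom.ker ((z i).app U).hom
  map_ideal_basicOpen U f := hz.map_iInf_ker U.2 f
  supportSet := _
  supportSet_eq_iInter_zeroLocus := rfl

end Family

variable {Y : Scheme.{u}} {𝒰 : Scheme.OpenCover.{u} Y} {I : ∀ i, (𝒰.X i).IdealSheafData}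

/-- Ideal sheaves on the members of an open cover that agree on the overlaps. -/
def IsCompatible (𝒰 : Scheme.OpenCover.{u} Y) (I : ∀ i, (𝒰.X i).IdealSheafData) : Prop :=
  ∀ i j, (I i).comap (pullback.fst (𝒰.f i) (𝒰.f j)) =
    (I j).comap (pullback.snd (𝒰.f i) (𝒰.f j))

lemma IsCompatible.exists_comp_eq (hI : IsCompatible 𝒰 I) (i j : 𝒰.I₀) :
    ∃ k : pullback ((I j).subschemeι ≫ 𝒰.f j) (𝒰.f i) ⟶ (I i).subscheme,
      k ≫ (I i).subschemeι ≫ 𝒰.f i = pullback.fst _ _ ≫ (I j).subschemeι ≫ 𝒰.f j := by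
  let z := (I j).subschemeι ≫ 𝒰.f j
  let a : pullback z (𝒰.f i) ⟶ pullback (𝒰.f i) (𝒰.f j) :=
    pullback.lift (pullback.snd _ _) (pullback.fst _ _ ≫ (I j).subschemeι)
      (by rw [← pullback.condition, Category.assoc])
  have hfst : a ≫ pullback.fst _ _ = pullback.snd _ _ := pullback.lift_fst _ _ _
  have hsnd : a ≫ pullback.snd _ _ = pullback.fst _ _ ≫ (I j).subschemeι := pullback.lift_snd _ _ _
  have hle : I i ≤ (pullback.snd z (𝒰.f i)).ker := by
    rw [← hfst, ← Scheme.IdealSheafData.map_ker, Scheme.IdealSheafData.le_map_iff_comap_le,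
      hI, ← Scheme.IdealSheafData.le_map_iff_comap_le, Scheme.IdealSheafData.map_ker, hsnd]
    exact (I j).ker_subschemeι.ge.trans (Scheme.Hom.le_ker_comp _ _)
  refine ⟨IsClosedImmersion.lift (I i).subschemeι (pullback.snd _ _) ?_, ?_⟩
  · rwa [Scheme.IdealSheafData.ker_subschemeι]
  · rw [IsClosedImmersion.lift_fac_assoc, pullback.condition]

lemma IsCompatible.app_eq_zero (hI : IsCompatible 𝒰 I) {i : 𝒰.I₀} {V : Y.Opens}
    (hV : V ≤ (𝒰.f i).opensRange) {s : Γ(Y, V)} (hs : ((I i).subschemeι ≫ 𝒰.f i).app V s = 0)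
    (j : 𝒰.I₀) : ((I j).subschemeι ≫ 𝒰.f j).app V s = 0 := by
  obtain ⟨k, hk⟩ := hI.exists_comp_eq i j
  let z := (I j).subschemeι ≫ 𝒰.f j
  have hcomp : (k ≫ (I i).subschemeι ≫ 𝒰.f i).app V s = 0 := by
    refine (comp_app_apply k ((I i).subschemeι ≫ 𝒰.f i) V s).trans ?_
    rw [hs, map_zero]
    rfl
  have hfst : (pullback.fst z (𝒰.f i) ≫ z).app V s = 0 := by
    generalize k ≫ (I i).subschemeι ≫ 𝒰.f i = g at hk hcomp
    subst hk
    exact hcomp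
  replace hfst := (comp_app_apply (pullback.fst z (𝒰.f i)) z V s).symm.trans hfst
  have : IsIso ((pullback.fst z (𝒰.f i)).app (z ⁻¹ᵁ V)) := by
    refine Scheme.Hom.isIso_app _ _ ?_
    rw [Scheme.Hom.opensRange_pullbackFst]
    exact Scheme.Hom.preimage_mono _ hV
  exact (map_eq_zero_iff _ (ConcreteCategory.bijective_of_isIso
    ((pullback.fst z (𝒰.f i)).app (z ⁻¹ᵁ V))).1).mp hfst

lemma IsCompatible.hasLocalKernel (hI : IsCompatible 𝒰 I) :
    HasLocalKernel fun i ↦ (I i).subschemeι ≫ 𝒰.f i := by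
  intro y
  obtain ⟨i, x, hx⟩ := 𝒰.exists_eq y
  exact ⟨(𝒰.f i).opensRange, i, ⟨x, hx⟩,
    fun V hV hVa ↦ ((hVa.preimage_of_isOpenImmersion (𝒰.f i) hV).preimage _).isCompact,
    fun V hV s hs ↦ hI.app_eq_zero hV hs⟩

lemma subschemeι_comp_app_eq_zero_iff {X : Scheme.{u}} (f : X ⟶ Y) [IsOpenImmersion f]
    (J : X.IdealSheafData) (W : X.affineOpens) (s : Γ(X, W)) :
    (J.subschemeι ≫ f).app (f ''ᵁ W) ((f.appIso W).inv s) = 0 ↔ s ∈ J.ideal W := by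
  have happ : f.app (f ''ᵁ W) ((f.appIso W).inv s) =
      X.presheaf.map (homOfLE (f.preimage_image_eq W.1).le).op s :=
    congr($(f.appIso_inv_app W) s)
  have hres : IsIso (J.subscheme.presheaf.map
      (homOfLE (J.subschemeι.preimage_mono (f.preimage_image_eq W.1).le)).op) :=
    inferInstanceAs (IsIso (J.subscheme.presheaf.map
      (eqToHom congr(J.subschemeι ⁻¹ᵁ $(f.preimage_image_eq W.1))).op))
  have hcomp := (comp_app_apply J.subschemeι f (f ''ᵁ W) ((f.appIso W).inv s)).trans
    (congr(J.subschemeι.app _ $happ).trans (app_res J.subschemeι (f.preimage_image_eq W.1).le s))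
  rw [← J.ker_subschemeι_app W, RingHom.mem_ker]
  refine (iff_of_eq congr($hcomp = 0)).trans ?_
  exact map_eq_zero_iff _ (ConcreteCategory.bijective_of_isIso (J.subscheme.presheaf.map
    (homOfLE (J.subschemeι.preimage_mono (f.preimage_image_eq W.1).le)).op)).1

lemma mem_ideal_comap_iff {X : Scheme.{u}} (f : X ⟶ Y) [IsOpenImmersion f] (J : Y.IdealSheafData)
    (W : X.affineOpens) (s : Γ(X, W)) : s ∈ (J.comap f).ideal W ↔
      (f.appIso W).inv s ∈ J.ideal ⟨f ''ᵁ W, W.2.image_of_isOpenImmersion _⟩ := by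
  rw [Scheme.IdealSheafData.ideal_comap_of_isOpenImmersion]
  rfl

lemma IsCompatible.comap_ker (hI : IsCompatible 𝒰 I) (i : 𝒰.I₀) :
    hI.hasLocalKernel.ker.comap (𝒰.f i) = I i := by
  ext W s
  rw [mem_ideal_comap_iff, ← subschemeι_comp_app_eq_zero_iff (𝒰.f i)]
  refine Ideal.mem_iInf.trans ⟨fun h ↦ h i, fun h j ↦ ?_⟩
  exact hI.app_eq_zero ((𝒰.f i).image_le_opensRange W) h j

lemma idealSheafData_ext_of_openCover (𝒰 : Scheme.OpenCover.{u} Y) {J J' : Y.IdealSheafData}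
    (h : ∀ i, J.comap (𝒰.f i) = J'.comap (𝒰.f i)) : J = J' := by
  refine Scheme.IdealSheafData.ext_of_iSup_eq_top
    (fun W : Σ i, (𝒰.X i).affineOpens ↦ ⟨𝒰.f W.1 ''ᵁ W.2, W.2.2.image_of_isOpenImmersion _⟩)
    (eq_top_iff.mpr fun y _ ↦ ?_) fun ⟨i, W⟩ ↦ ?_
  · obtain ⟨i, x, rfl⟩ := 𝒰.exists_eq y
    obtain ⟨_, ⟨W, hW, rfl⟩, hxW, -⟩ := (𝒰.X i).isBasis_affineOpens.exists_subset_of_mem_open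
      (Set.mem_univ x) isOpen_univ
    exact Opens.mem_iSup.mpr ⟨⟨i, W, hW⟩, x, hxW, rfl⟩
  · ext s
    obtain ⟨s, rfl⟩ := (ConcreteCategory.bijective_of_isIso ((𝒰.f i).appIso W).inv).2 s
    have hJ := mem_ideal_comap_iff (𝒰.f i) J W s
    rw [h i] at hJ
    exact hJ.symm.trans (mem_ideal_comap_iff (𝒰.f i) J' W s)

end GlueIdeal

section Frames

variable {Z T Z' T' : Scheme.{u}} {n : ℕ}

/-- The linear combinations of the restrictions to `V` of the sections `e` of `π_* 𝒪_Z`, with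
coefficients in `𝒪_T`. -/
def frameMap (π : Z ⟶ T) (e : Fin n → Γ(Z, ⊤)) (V : T.Opens) :
    (Fin n → Γ(T, V)) →ₛₗ[(π.app V).hom] Γ(Z, π ⁻¹ᵁ V) :=
  linearCombination (π.app V).hom fun i ↦ Z.presheaf.map (homOfLE le_top).op (e i)

/-- The sections `e` form a basis of the `𝒪_T`-module `π_* 𝒪_Z`. -/
def IsFrame (π : Z ⟶ T) (e : Fin n → Γ(Z, ⊤)) : Prop :=
  ∀ V : T.Opens, Function.Bijective (frameMap π e V)

lemma IsFrame.bijective_top {π : Z ⟶ T} {e : Fin n → Γ(Z, ⊤)} (h : IsFrame π e) :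
    Function.Bijective (linearCombination π.appTop.hom e) := by
  have htop : Function.Bijective
      (linearCombination π.appTop.hom fun i ↦ Z.presheaf.map (𝟙 _) (e i)) := h ⊤
  simpa using htop

lemma IsFrame.isLocallyFreeOfRank {π : Z ⟶ T} {e : Fin n → Γ(Z, ⊤)} (h : IsFrame π e) :
    IsLocallyFreeOfRank n π :=
  fun _ ↦ ⟨⊤, trivial, e, fun V _ ↦ h V⟩

section Local

variable {π : Z ⟶ T} {e : Fin n → Γ(Z, ⊤)}

lemma frameMap_res {V V' : T.Opens} (h : V' ≤ V) (a : Fin n → Γ(T, V)) :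
    frameMap π e V' (fun i ↦ T.presheaf.map (homOfLE h).op (a i)) =
      Z.presheaf.map (homOfLE (π.preimage_mono h)).op (frameMap π e V a) :=
  combination_res π (U := ⊤) e le_top h a

variable {ι : Type*} {V : T.Opens} {W : ι → T.Opens}

lemma injective_frameMap_of_iSup (hWV : ∀ i, W i ≤ V) (hV : V ≤ ⨆ i, W i)
    (H : ∀ i, Function.Injective (frameMap π e (W i))) :
    Function.Injective (frameMap π e V) := by
  intro a b hab
  funext k
  refine T.sheaf.eq_of_locally_eq' W V (fun i ↦ homOfLE (hWV i)) hV _ _ fun i ↦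
    congr_fun (H i (a₁ := fun k ↦ T.presheaf.map (homOfLE (hWV i)).op (a k))
      (a₂ := fun k ↦ T.presheaf.map (homOfLE (hWV i)).op (b k)) ?_) k
  exact (frameMap_res (hWV i) a).trans
    (congr(Z.presheaf.map _ $hab).trans (frameMap_res (hWV i) b).symm)

lemma bijective_frameMap_of_iSup (hWV : ∀ i, W i ≤ V) (hV : V ≤ ⨆ i, W i)
    (H : ∀ i, Function.Bijective (frameMap π e (W i)))
    (H' : ∀ i j, Function.Injective (frameMap π e (W i ⊓ W j))) :
    Function.Bijective (frameMap π e V) := by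
  refine ⟨injective_frameMap_of_iSup hWV hV fun i ↦ (H i).1, fun z ↦ ?_⟩
  choose a ha using fun i ↦ (H i).2 (Z.presheaf.map (homOfLE (π.preimage_mono (hWV i))).op z)
  have hcompat (k : Fin n) (i j : ι) :
      T.presheaf.map (homOfLE (inf_le_left : W i ⊓ W j ≤ W i)).op (a i k) =
        T.presheaf.map (homOfLE (inf_le_right : W i ⊓ W j ≤ W j)).op (a j k) := by
    refine congr_fun (H' i j (a₁ := fun k ↦ T.presheaf.map (homOfLE inf_le_left).op (a i k))
      (a₂ := fun k ↦ T.presheaf.map (homOfLE inf_le_right).op (a j k)) ?_) k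
    rw [frameMap_res, frameMap_res, ha, ha, res_res, res_res]
  choose b hb using fun k ↦ (T.sheaf.existsUnique_gluing' W V (fun i ↦ homOfLE (hWV i)) hV
    (fun i ↦ a i k) (hcompat k)).exists
  refine ⟨b, Z.sheaf.eq_of_locally_eq' (fun i ↦ π ⁻¹ᵁ W i) _
    (fun i ↦ homOfLE (π.preimage_mono (hWV i))) (fun x hx ↦ ?_) _ _ fun i ↦ ?_⟩
  · obtain ⟨i, hi⟩ := Opens.mem_iSup.mp (hV hx)
    exact Opens.mem_iSup.mpr ⟨i, hi⟩
  · exact (frameMap_res (hWV i) b).symm.trans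
      (congr(frameMap π e (W i) $(funext fun k ↦ hb k i)).trans (ha i))

lemma isFrame_of_forall_exists_bijective
    (H : ∀ V : T.Opens, ∀ t ∈ V, ∃ W ≤ V, t ∈ W ∧ Function.Bijective (frameMap π e W)) :
    IsFrame π e := by
  have hle (V : T.Opens) :
      V ≤ ⨆ W : {W : T.Opens // W ≤ V ∧ Function.Bijective (frameMap π e W)}, W.1 := by
    intro t ht
    obtain ⟨W, hWV, htW, hW⟩ := H V t ht
    exact Opens.mem_iSup.mpr ⟨⟨W, hWV, hW⟩, htW⟩
  exact fun V ↦ bijective_frameMap_of_iSup (fun W ↦ W.2.1) (hle V) (fun W ↦ W.2.2) fun W W' ↦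
    injective_frameMap_of_iSup (fun W'' ↦ W''.2.1) (hle _) fun W'' ↦ W''.2.2.1

end Local

lemma appLE_res_top (g : Z' ⟶ Z) {U : Z.Opens} {U' : Z'.Opens} (h : U' ≤ g ⁻¹ᵁ U) (s : Γ(Z, ⊤)) :
    g.appLE U U' h (Z.presheaf.map (homOfLE le_top).op s) =
      Z'.presheaf.map (homOfLE le_top).op (g.appTop s) := by
  have hcomp : Z.presheaf.map (homOfLE le_top).op ≫ g.appLE U U' h =
      g.appTop ≫ Z'.presheaf.map (homOfLE le_top).op := by
    rw [Scheme.Hom.map_appLE, Scheme.Hom.appLE]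
    rfl
  exact congr($hcomp s)

section Pullback

variable {π : Z ⟶ T} {g : T' ⟶ T} {g' : Z' ⟶ Z} {π' : Z' ⟶ T'}

lemma preimage_le_of_isPullback (H : IsPullback g' π' π g) {U : T.Opens} {V : T'.Opens}
    (hV : V ≤ g ⁻¹ᵁ U) : π' ⁻¹ᵁ V ≤ g' ⁻¹ᵁ π ⁻¹ᵁ U := by
  rw [← Scheme.Hom.comp_preimage, H.w]
  exact π'.preimage_mono hV

lemma bijective_linearCombination_of_isPullback [IsAffineHom π] (H : IsPullback g' π' π g)
    {U : T.Opens} (hU : IsAffineOpen U) {e : Fin n → Γ(Z, π ⁻¹ᵁ U)}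
    (he : Function.Bijective (linearCombination (π.app U).hom e)) {V : T'.Opens}
    (hVa : IsAffineOpen V) (hV : V ≤ g ⁻¹ᵁ U) :
    Function.Bijective (linearCombination (π'.app V).hom fun i ↦
      g'.appLE (π ⁻¹ᵁ U) (π' ⁻¹ᵁ V) (preimage_le_of_isPullback H hV) (e i)) := by
  have hp := (isIso_pushoutSection_iff H hV le_rfl (UX := π ⁻¹ᵁ U) (UY := π' ⁻¹ᵁ V)
    (inf_eq_right.mpr (preimage_le_of_isPullback H hV)).symm).mp
      (isIso_pushoutSection_of_isAffineOpen _ _ _ _ hU hVa (hU.preimage π))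
  rw [Scheme.Hom.appLE_eq_app, Scheme.Hom.appLE_eq_app] at hp
  exact bijective_of_isPushout hp e he

lemma IsFrame.of_isPullback [IsAffineHom π] (H : IsPullback g' π' π g) {e : Fin n → Γ(Z, ⊤)}
    (he : IsFrame π e) : IsFrame π' fun i ↦ g'.appTop (e i) := by
  refine isFrame_of_forall_exists_bijective fun W t' ht' ↦ ?_
  obtain ⟨_, ⟨U, hU, rfl⟩, htU, -⟩ :=
    T.isBasis_affineOpens.exists_subset_of_mem_open (Set.mem_univ (g t')) isOpen_univ
  obtain ⟨_, ⟨V, hVa, rfl⟩, htV, hV⟩ := T'.isBasis_affineOpens.exists_subset_of_mem_open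
    (show t' ∈ W ⊓ g ⁻¹ᵁ U from ⟨ht', htU⟩) (W ⊓ g ⁻¹ᵁ U).isOpen
  have hVW : V ≤ W := fun _ h ↦ (hV h).1
  have hVU : V ≤ g ⁻¹ᵁ U := fun _ h ↦ (hV h).2
  refine ⟨V, hVW, htV, ?_⟩
  convert bijective_linearCombination_of_isPullback H hU (he U) hVa hVU with i
  simp_rw [frameMap, appLE_res_top]

lemma isFrame_of_bijective [IsAffineHom π] [IsAffine T] {e : Fin n → Γ(Z, ⊤)}
    (he : Function.Bijective (linearCombination π.appTop.hom e)) : IsFrame π e := by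
  refine isFrame_of_forall_exists_bijective fun W t ht ↦ ?_
  obtain ⟨_, ⟨V, hVa, rfl⟩, htV, hVW⟩ := T.isBasis_affineOpens.exists_subset_of_mem_open ht W.isOpen
  refine ⟨V, hVW, htV, ?_⟩
  have hid : (𝟙 Z : Z ⟶ Z).appLE ⊤ (π ⁻¹ᵁ V) le_top = Z.presheaf.map (homOfLE le_top).op := by
    simp [Scheme.Hom.appLE]
  convert bijective_linearCombination_of_isPullback (IsPullback.id_horiz π) (isAffineOpen_top T)
    he hVa le_top with i
  exact congr(linearCombination _ fun i ↦ $hid.symm (e i))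

lemma IsLocallyFreeOfRank.exists_isFrame [IsAffineHom π] (h : IsLocallyFreeOfRank n π) (t : T) :
    ∃ U : T.Opens, IsAffineOpen U ∧ t ∈ U ∧ ∀ {Z' : Scheme.{u}} {g' : Z' ⟶ Z} {π' : Z' ⟶ U},
      IsPullback g' π' π U.ι → ∃ e : Fin n → Γ(Z', ⊤), IsFrame π' e := by
  obtain ⟨U, hU, e, he⟩ := h t
  obtain ⟨U₀, hU₀, htU₀, hU₀U⟩ : ∃ U₀ : T.Opens, IsAffineOpen U₀ ∧ t ∈ U₀ ∧ U₀ ≤ U := by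
    obtain ⟨_, ⟨U₀, hU₀, rfl⟩, htU₀, hU₀U⟩ :=
      T.isBasis_affineOpens.exists_subset_of_mem_open hU U.isOpen
    exact ⟨U₀, hU₀, htU₀, hU₀U⟩
  refine ⟨U₀, hU₀, htU₀, fun {Z' g' π'} H ↦ ?_⟩
  have : IsAffineHom π' := MorphismProperty.of_isPullback H ‹_›
  have : IsAffine U₀.toScheme := hU₀
  exact ⟨_, isFrame_of_bijective (bijective_linearCombination_of_isPullback H hU₀ (he U₀ hU₀U)
    (isAffineOpen_top _) U₀.ι_preimage_self.ge)⟩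

lemma isIso_appLE_of_isPullback [IsOpenImmersion g] (H : IsPullback g' π' π g) {V : T.Opens}
    {V' : T'.Opens} (hV : V ≤ g.opensRange) (hV' : g ⁻¹ᵁ V = V') :
    IsIso (g'.appLE (π ⁻¹ᵁ V) (π' ⁻¹ᵁ V') (preimage_le_of_isPullback H hV'.ge)) := by
  have : IsOpenImmersion g' := MorphismProperty.of_isPullback H.flip ‹_›
  have hrange : π ⁻¹ᵁ V ≤ g'.opensRange := by
    intro z hz
    obtain ⟨t, ht⟩ := hV hz
    obtain ⟨y, hy, -⟩ := Scheme.exists_preimage_of_isPullback H z t ht.symm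
    exact ⟨y, hy⟩
  have : IsIso (g'.app (π ⁻¹ᵁ V)) := g'.isIso_app _ hrange
  have hpre : π' ⁻¹ᵁ V' = g' ⁻¹ᵁ π ⁻¹ᵁ V := by
    rw [← hV', ← Scheme.Hom.comp_preimage, ← Scheme.Hom.comp_preimage, H.w]
  have : IsIso (Z'.presheaf.map (homOfLE hpre.le).op) :=
    inferInstanceAs (IsIso (Z'.presheaf.map (eqToHom hpre).op))
  rw [Scheme.Hom.appLE]
  infer_instance

lemma bijective_linearCombination_iff_of_isOpenImmersion [IsOpenImmersion g]
    (H : IsPullback g' π' π g) {V : T.Opens} (hV : V ≤ g.opensRange) (e : Fin n → Γ(Z, π ⁻¹ᵁ V)) :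
    Function.Bijective (linearCombination (π.app V).hom e) ↔
      Function.Bijective (linearCombination (π'.app (g ⁻¹ᵁ V)).hom fun i ↦
        g'.appLE (π ⁻¹ᵁ V) (π' ⁻¹ᵁ g ⁻¹ᵁ V) (preimage_le_of_isPullback H le_rfl) (e i)) := by
  have : IsIso (g.app V) := g.isIso_app _ hV
  have := isIso_appLE_of_isPullback H hV rfl
  have w : π.app V ≫ g'.appLE (π ⁻¹ᵁ V) (π' ⁻¹ᵁ g ⁻¹ᵁ V) (preimage_le_of_isPullback H le_rfl) =
      g.app V ≫ π'.app (g ⁻¹ᵁ V) := by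
    rw [← Scheme.Hom.appLE_eq_app, ← Scheme.Hom.appLE_eq_app, ← Scheme.Hom.appLE_eq_app,
      Scheme.Hom.appLE_comp_appLE, Scheme.Hom.appLE_comp_appLE]
    simp only [H.w]
  exact bijective_linearCombination_iff (σ := (g.app V).hom) (τ := (g'.appLE (π ⁻¹ᵁ V)
      (π' ⁻¹ᵁ g ⁻¹ᵁ V) (preimage_le_of_isPullback H le_rfl)).hom)
    (ConcreteCategory.bijective_of_isIso (g.app V)) (ConcreteCategory.bijective_of_isIso
      (g'.appLE (π ⁻¹ᵁ V) (π' ⁻¹ᵁ g ⁻¹ᵁ V) (preimage_le_of_isPullback H le_rfl)))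
    (fun c ↦ congr($w c)) e

lemma isFrame_of_openCover {e : Fin n → Γ(Z, ⊤)} (H : ∀ t : T, ∃ (T' Z' : Scheme.{u}) (g : T' ⟶ T)
    (g' : Z' ⟶ Z) (π' : Z' ⟶ T') (_ : IsOpenImmersion g), IsPullback g' π' π g ∧
      t ∈ g.opensRange ∧ IsFrame π' fun i ↦ g'.appTop (e i)) : IsFrame π e := by
  refine isFrame_of_forall_exists_bijective fun V t htV ↦ ?_
  obtain ⟨T', Z', g, g', π', _, hp, ht, he⟩ := H t
  refine ⟨V ⊓ g.opensRange, inf_le_left, ⟨htV, ht⟩, ?_⟩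
  rw [frameMap, bijective_linearCombination_iff_of_isOpenImmersion hp inf_le_right]
  simp_rw [appLE_res_top]
  exact he _

lemma isLocallyFreeOfRank_of_openCover (H : ∀ t : T, ∃ (T' Z' : Scheme.{u}) (g : T' ⟶ T)
    (g' : Z' ⟶ Z) (π' : Z' ⟶ T') (_ : IsOpenImmersion g), IsPullback g' π' π g ∧
      t ∈ g.opensRange ∧ IsLocallyFreeOfRank n π') : IsLocallyFreeOfRank n π := by
  intro t
  obtain ⟨T', Z', g, g', π', _, hp, ⟨t', rfl⟩, h⟩ := H t
  obtain ⟨U', ht', e', he'⟩ := h t'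
  have hU' : g ⁻¹ᵁ g ''ᵁ U' = U' := g.preimage_image_eq U'
  have := isIso_appLE_of_isPullback hp (g.image_le_opensRange U') hU'
  choose e he using fun i ↦ (ConcreteCategory.bijective_of_isIso (g'.appLE (π ⁻¹ᵁ g ''ᵁ U')
    (π' ⁻¹ᵁ U') (preimage_le_of_isPullback hp hU'.ge))).2 (e' i)
  refine ⟨g ''ᵁ U', ⟨t', ht', rfl⟩, e, fun V hV ↦ ?_⟩
  refine (bijective_linearCombination_iff_of_isOpenImmersion hp
    (hV.trans (g.image_le_opensRange U')) _).mpr ?_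
  have hV' : g ⁻¹ᵁ V ≤ U' := (g.preimage_mono hV).trans hU'.le
  have hres (i) : g'.appLE (π ⁻¹ᵁ V) (π' ⁻¹ᵁ g ⁻¹ᵁ V) (preimage_le_of_isPullback hp le_rfl)
      (Z.presheaf.map (homOfLE (π.preimage_mono hV)).op (e i)) =
        Z'.presheaf.map (homOfLE (π'.preimage_mono hV')).op (e' i) := by
    rw [← he i, ← CommRingCat.comp_apply, ← CommRingCat.comp_apply, Scheme.Hom.map_appLE,
      Scheme.Hom.appLE_map]
  simp_rw [hres]
  exact he' (g ⁻¹ᵁ V) hV'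

end Pullback

section ChangeOfFrame

variable {π : Z ⟶ T} {e b : Fin n → Γ(Z, ⊤)} {M : Matrix (Fin n) (Fin n) Γ(T, ⊤)}

lemma IsFrame.of_isUnit_det (he : IsFrame π e)
    (hb : ∀ i, b i = linearCombination π.appTop.hom e (M i)) (hM : IsUnit M.det) :
    IsFrame π b := by
  intro V
  let r := T.presheaf.map (homOfLE (le_top : V ≤ ⊤)).op
  let N : Matrix (Fin n) (Fin n) Γ(T, V) := M.map r
  have hN : IsUnit N := by
    rw [Matrix.isUnit_iff_isUnit_det, show N.det = r M.det from (RingHom.map_det r.hom M).symm]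
    exact hM.map r.hom
  have hbV (i) : Z.presheaf.map (homOfLE (le_top : π ⁻¹ᵁ V ≤ ⊤)).op (b i) =
      frameMap π e V (N i) :=
    congr(Z.presheaf.map _ $(hb i)).trans
      (map_linearCombination (fun c ↦ (app_res π le_top c).symm) e (M i))
  have hcomp : ⇑(frameMap π b V) = frameMap π e V ∘ fun a ↦ Matrix.vecMul a N :=
    funext (linearCombination_vecMul _ N hbV)
  rw [hcomp]
  exact (he V).comp
    ⟨Matrix.vecMul_injective_of_isUnit hN, Matrix.vecMul_surjective_iff_isUnit.mpr hN⟩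

lemma IsFrame.isUnit_det (he : IsFrame π e)
    (hb : ∀ i, b i = linearCombination π.appTop.hom e (M i)) (hb' : IsFrame π b) :
    IsUnit M.det := by
  rw [← Matrix.isUnit_iff_isUnit_det, ← Matrix.vecMul_surjective_iff_isUnit]
  intro a
  obtain ⟨c, hc⟩ := hb'.bijective_top.2 (linearCombination π.appTop.hom e a)
  rw [linearCombination_vecMul _ M hb] at hc
  exact ⟨c, he.bijective_top.1 hc⟩

end ChangeOfFrame

end Frames

lemma hasAffineProperty_isFinite :
    HasAffineProperty @IsFinite.{u} (affineAnd RingHom.Finite) :=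
  (HasAffineProperty.affineAnd_iff _ RingHom.finite_respectsIso
    RingHom.finite_localizationPreserves.away RingHom.finite_ofLocalizationSpan).mpr
      fun _ ↦ isFinite_iff _

instance isZariskiLocalAtTarget_isFinite : IsZariskiLocalAtTarget @IsFinite.{u} :=
  hasAffineProperty_isFinite.instIsZariskiLocalAtTarget

section Sheaf

variable {n : ℕ} {X S T : Scheme.{u}} (p : X ⟶ S)

/-- The open cover of `T ×_S X` induced by an open cover of `T`. -/
def baseChangeCover (t : T ⟶ S) (𝒰 : Scheme.OpenCover.{u} T) :
    Scheme.OpenCover.{u} (pullback t p) :=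
  Scheme.Cover.mkOfCovers 𝒰.I₀ (fun i ↦ pullback (𝒰.f i ≫ t) p)
    (fun i ↦ baseChangeMap p (𝒰.f i) rfl)
    (fun x ↦ by
      obtain ⟨i, y, hy⟩ := 𝒰.exists_eq (pullback.fst t p x)
      obtain ⟨z, hz, -⟩ := Scheme.exists_preimage_of_isPullback
        (isPullback_baseChangeMap p (𝒰.f i) rfl) x y hy.symm
      exact ⟨i, z, hz⟩)
    (fun i ↦ MorphismProperty.of_isPullback (isPullback_baseChangeMap p (𝒰.f i) rfl).flip
      (𝒰.map_prop i))

namespace HilbPoints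

variable {p} {t : T ⟶ S} {𝒰 : Scheme.OpenCover.{u} T}

lemma isCompatible_ideal {x : ∀ i, HilbPoints n p (𝒰.f i ≫ t)}
    (hx : ∀ i j, (x i).map (t' := pullback.fst (𝒰.f i) (𝒰.f j) ≫ 𝒰.f i ≫ t)
      (pullback.fst (𝒰.f i) (𝒰.f j)) rfl =
        (x j).map (pullback.snd (𝒰.f i) (𝒰.f j)) (by rw [pullback.condition_assoc])) :
    IsCompatible (baseChangeCover p t 𝒰) fun i ↦ (x i).ideal := by
  intro i j
  change (x i).ideal.comap (pullback.fst (baseChangeMap p (𝒰.f i) (rfl : 𝒰.f i ≫ t = _))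
    (baseChangeMap p (𝒰.f j) (rfl : 𝒰.f j ≫ t = _))) = (x j).ideal.comap (pullback.snd _ _)
  have w := pullback.condition (f := baseChangeMap p (𝒰.f i) (rfl : 𝒰.f i ≫ t = _))
    (g := baseChangeMap p (𝒰.f j) (rfl : 𝒰.f j ≫ t = _))
  have w₁ := congr($w ≫ pullback.fst t p)
  have w₂ := congr($w ≫ pullback.snd t p)
  simp only [Category.assoc, baseChangeMap_fst, baseChangeMap_snd] at w₁ w₂
  have H := isPullback_baseChangeMap p (pullback.fst (𝒰.f i) (𝒰.f j)) (rfl : _ ≫ 𝒰.f i ≫ t = _)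
  let q := pullback.lift (f := 𝒰.f i) (g := 𝒰.f j) (pullback.fst _ _ ≫ pullback.fst _ p)
    (pullback.snd _ _ ≫ pullback.fst _ p) (by simpa only [Category.assoc] using w₁)
  let m := H.lift (pullback.fst _ _) q (pullback.lift_fst _ _ _).symm
  have hm₁ : m ≫ baseChangeMap p (pullback.fst (𝒰.f i) (𝒰.f j)) rfl = pullback.fst _ _ :=
    H.lift_fst _ _ _
  have hq : m ≫ pullback.fst _ p = q := H.lift_snd _ _ _
  have hm₂ : m ≫ baseChangeMap p (pullback.snd (𝒰.f i) (𝒰.f j))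
      (by rw [pullback.condition_assoc]) = pullback.snd _ _ := by
    apply pullback.hom_ext
    · rw [Category.assoc, baseChangeMap_fst, reassoc_of% hq, pullback.lift_snd]
    · rw [Category.assoc, baseChangeMap_snd, ← w₂, ← hm₁, Category.assoc, baseChangeMap_snd]
  rw [← hm₁, ← hm₂, Scheme.IdealSheafData.comap_comp, Scheme.IdealSheafData.comap_comp]
  exact congr(($(hx i j)).ideal.comap m)

lemma exists_ideal_eq_of_openCover (I : (pullback t p).IdealSheafData)
    (x : ∀ i, HilbPoints n p (𝒰.f i ≫ t))
    (hx : ∀ i, I.comap (baseChangeMap p (𝒰.f i) rfl) = (x i).ideal) :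
    ∃ y : HilbPoints n p t, y.ideal = I := by
  have H (i) := isPullback_comap_baseChangeMap p (𝒰.f i) rfl I
  refine ⟨⟨I, ?_, isLocallyFreeOfRank_of_openCover fun t ↦ ?_⟩, rfl⟩
  · rw [IsZariskiLocalAtTarget.iff_of_openCover (P := @IsFinite) 𝒰]
    intro i
    have hfin : IsFinite ((I.comap (baseChangeMap p (𝒰.f i) rfl)).subschemeι ≫
        pullback.fst (𝒰.f i ≫ t) p) := (hx i) ▸ (x i).isFinite
    have hfin' : IsFinite ((H i).isoPullback.inv ≫
        (I.comap (baseChangeMap p (𝒰.f i) rfl)).subschemeι ≫ pullback.fst (𝒰.f i ≫ t) p) :=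
      inferInstance
    rwa [(H i).isoPullback_inv_snd] at hfin'
  · obtain ⟨i, z, hz⟩ := 𝒰.exists_eq t
    exact ⟨_, _, 𝒰.f i, _, _, 𝒰.map_prop i, H i, ⟨z, hz⟩, (hx i) ▸ (x i).isLocallyFree⟩

end HilbPoints

theorem isZariskiSheaf_hilb : IsZariskiSheaf (hilb n p) := by
  intro T 𝒰 x hx
  change ∀ i, HilbPoints n p (𝒰.f i ≫ T.hom) at x
  have hI : IsCompatible (baseChangeCover p T.hom 𝒰) fun i ↦ (x i).ideal :=
    HilbPoints.isCompatible_ideal fun i j ↦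
      hx i j (Over.mk (pullback.fst (𝒰.f i) (𝒰.f j) ≫ 𝒰.f i ≫ T.hom))
        (Over.homMk (pullback.fst (𝒰.f i) (𝒰.f j)))
        (Over.homMk (pullback.snd (𝒰.f i) (𝒰.f j)) (by simp [pullback.condition_assoc]))
        pullback.condition
  obtain ⟨y, hy⟩ := HilbPoints.exists_ideal_eq_of_openCover hI.hasLocalKernel.ker x hI.comap_ker
  have hyx (i) : y.ideal.comap (baseChangeMap p (𝒰.f i) rfl) = (x i).ideal :=
    hy ▸ hI.comap_ker i
  refine ⟨y, fun i ↦ HilbPoints.ext (hyx i), fun y' hy' ↦ HilbPoints.ext ?_⟩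
  exact idealSheafData_ext_of_openCover (baseChangeCover p T.hom 𝒰) fun i ↦
    congr(HilbPoints.ideal $(hy' i)).trans (hyx i).symm

end Sheaf

section SectionsHom

variable {A B : CommRingCat.{u}} {Y Y' : Scheme.{u}}

/-- The ring homomorphism corresponding to a morphism to an affine scheme. -/
def sectionsHom (f : Y ⟶ Spec B) : B →+* Γ(Y, ⊤) :=
  ((Scheme.ΓSpecIso B).inv ≫ f.appTop).hom

lemma appTop_sectionsHom (g : Y' ⟶ Y) (f : Y ⟶ Spec B) (x : B) :
    g.appTop (sectionsHom f x) = sectionsHom (g ≫ f) x := by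
  simp only [sectionsHom, Scheme.Hom.comp_appTop]
  rfl

lemma sectionsHom_comp_SpecMap (f : Y ⟶ Spec B) (φ : A ⟶ B) (a : A) :
    sectionsHom (f ≫ Spec.map φ) a = sectionsHom f (φ a) := by
  rw [← appTop_sectionsHom]
  exact congr(f.appTop ($(Scheme.ΓSpecIso_inv_naturality φ) a)).symm

lemma sectionsHom_injective : Function.Injective (sectionsHom : (Y ⟶ Spec B) → _) :=
  fun _ _ h ↦ ext_to_Spec (CommRingCat.hom_ext h)

lemma sectionsHom_surjective : Function.Surjective (sectionsHom : (Y ⟶ Spec B) → _) :=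
  fun ψ ↦ ⟨_, congr(($(ΓSpecIso_inv_ΓSpec_adjunction_homEquiv (CommRingCat.ofHom ψ))).hom)⟩

end SectionsHom

lemma isPushout_induction {A B C D : CommRingCat.{u}} {f : A ⟶ B} {g : A ⟶ C} {f' : B ⟶ D}
    {g' : C ⟶ D} (h : IsPushout f g f' g') {motive : D → Prop} (zero : motive 0)
    (incl : ∀ b, motive (f' b)) (mul : ∀ c d, motive d → motive (g' c * d))
    (add : ∀ d d', motive d → motive d' → motive (d + d')) (d : D) : motive d := by
  algebraize [f.hom, g.hom, f'.hom, g'.hom, (f ≫ f').hom]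
  have : IsScalarTower A C D := .of_algebraMap_eq' congr(($h.w).hom)
  have : IsScalarTower A B D := .of_algebraMap_eq' rfl
  have hP : Algebra.IsPushout A C B D := CommRingCat.isPushout_iff_isPushout.mp h.flip
  refine hP.out.inductionOn d _ zero incl (fun c d hd ↦ ?_) add
  rw [Algebra.smul_def]
  exact mul c d hd

namespace HilbPoints

variable {n : ℕ} {X S T T' : Scheme.{u}} {p : X ⟶ S} {t' : T' ⟶ S} {t : T ⟶ S}

/-- The structure morphism `Z → T` of a `T`-valued point of the Hilbert functor. -/
def toBase (Z : HilbPoints n p t) : Z.ideal.subscheme ⟶ T :=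
  Z.ideal.subschemeι ≫ pullback.fst t p

/-- The projection `Z → X` of a `T`-valued point of the Hilbert functor of `X`. -/
def toTotal (Z : HilbPoints n p t) : Z.ideal.subscheme ⟶ X :=
  Z.ideal.subschemeι ≫ pullback.snd t p

instance isFinite_toBase (Z : HilbPoints n p t) : IsFinite Z.toBase := Z.isFinite

lemma toBase_comp (Z : HilbPoints n p t) : Z.toBase ≫ t = Z.toTotal ≫ p := by
  simp [toBase, toTotal, pullback.condition]

lemma appTop_toBase (Z : HilbPoints n p t) (c : Γ(T, ⊤)) :
    Z.toBase.appTop c = Z.ideal.subschemeι.appTop ((pullback.fst t p).appTop c) := by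
  rw [toBase, Scheme.Hom.comp_appTop]
  rfl

/-- The projection to a point of the Hilbert functor from its pullback along `g`. -/
def mapHom (Z : HilbPoints n p t) (g : T' ⟶ T) (e : g ≫ t = t') :
    (Z.map g e).ideal.subscheme ⟶ Z.ideal.subscheme :=
  Scheme.IdealSheafData.subschemeMap _ _ (baseChangeMap p g e) (Z.ideal.le_map_comap _)

lemma isPullback_mapHom (Z : HilbPoints n p t) (g : T' ⟶ T) (e : g ≫ t = t') :
    IsPullback (Z.mapHom g e) (Z.map g e).toBase Z.toBase g :=
  isPullback_comap_baseChangeMap p g e Z.ideal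

lemma mapHom_toTotal (Z : HilbPoints n p t) (g : T' ⟶ T) (e : g ≫ t = t') :
    Z.mapHom g e ≫ Z.toTotal = (Z.map g e).toTotal := by
  have h : Z.mapHom g e ≫ Z.ideal.subschemeι =
      (Z.map g e).ideal.subschemeι ≫ baseChangeMap p g e :=
    Scheme.IdealSheafData.subschemeMap_subschemeι _ _ _ _
  rw [toTotal, reassoc_of% h, baseChangeMap_snd]
  rfl

lemma mapHom_appTop_toBase (Z : HilbPoints n p t) (g : T' ⟶ T) (e : g ≫ t = t') (a : Γ(T, ⊤)) :
    (Z.mapHom g e).appTop (Z.toBase.appTop a) = (Z.map g e).toBase.appTop (g.appTop a) := by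
  have h := congr($((Z.isPullback_mapHom g e).w).appTop)
  rw [Scheme.Hom.comp_appTop, Scheme.Hom.comp_appTop] at h
  exact congr($h a)

end HilbPoints

section Affine

variable {n : ℕ} {A B : CommRingCat.{u}} {φ : A ⟶ B} {T T' : Scheme.{u}} {t : T ⟶ Spec A}
  {t' : T' ⟶ Spec A}

namespace HilbPoints

/-- The functions on a closed subscheme of `T ×_A B` induced by elements of `B`. -/
abbrev pull (Z : HilbPoints n (Spec.map φ) t) : B →+* Γ(Z.ideal.subscheme, ⊤) :=
  sectionsHom Z.toTotal

lemma toBase_sectionsHom (Z : HilbPoints n (Spec.map φ) t) (a : A) :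
    Z.toBase.appTop (sectionsHom t a) = Z.pull (φ a) := by
  rw [appTop_sectionsHom, toBase_comp, sectionsHom_comp_SpecMap]

lemma mapHom_pull (Z : HilbPoints n (Spec.map φ) t) (g : T' ⟶ T) (e : g ≫ t = t') (x : B) :
    (Z.mapHom g e).appTop (Z.pull x) = (Z.map g e).pull x := by
  rw [pull, appTop_sectionsHom, mapHom_toTotal]

/-- The functions `c x` are the coordinates of the elements `x` of `B` with respect to the functions
`s` on `Z`. -/
def HasCoordinates (Z : HilbPoints n (Spec.map φ) t) (s : Fin n → Γ(Z.ideal.subscheme, ⊤))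
    (c : B → Fin n → Γ(T, ⊤)) : Prop :=
  ∀ x, Z.pull x = linearCombination Z.toBase.appTop.hom s (c x)

lemma HasCoordinates.map {Z : HilbPoints n (Spec.map φ) t} {s : Fin n → Γ(Z.ideal.subscheme, ⊤)}
    {c : B → Fin n → Γ(T, ⊤)} (h : Z.HasCoordinates s c) (g : T' ⟶ T) (e : g ≫ t = t') :
    (Z.map g e).HasCoordinates ((Z.mapHom g e).appTop ∘ s) fun x ↦ g.appTop ∘ c x := by
  intro x
  rw [← mapHom_pull, h x]
  exact map_linearCombination (σ := g.appTop.hom) (τ := (Z.mapHom g e).appTop.hom)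
    (Z.mapHom_appTop_toBase g e) s (c x)

/-- The elements `b` of `B` induce a basis of the functions on `Z`. -/
def IsFramed (b : Fin n → B) (Z : HilbPoints n (Spec.map φ) t) : Prop :=
  IsFrame Z.toBase (Z.pull ∘ b)

lemma mapHom_comp_pull (Z : HilbPoints n (Spec.map φ) t) (g : T' ⟶ T) (e : g ≫ t = t')
    (b : Fin n → B) : (Z.mapHom g e).appTop ∘ Z.pull ∘ b = (Z.map g e).pull ∘ b :=
  funext fun _ ↦ Z.mapHom_pull g e _

lemma IsFramed.map {b : Fin n → B} {Z : HilbPoints n (Spec.map φ) t} (h : Z.IsFramed b)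
    (g : T' ⟶ T) (e : g ≫ t = t') : (Z.map g e).IsFramed b := by
  rw [IsFramed, ← mapHom_comp_pull]
  exact IsFrame.of_isPullback (Z.isPullback_mapHom g e) h

lemma IsFramed.exists_hasCoordinates {b : Fin n → B} {Z : HilbPoints n (Spec.map φ) t}
    (h : Z.IsFramed b) :
    ∃ c, IsCoordinateMap φ.hom (sectionsHom t) b c ∧ Z.HasCoordinates (Z.pull ∘ b) c :=
  exists_isCoordinateMap Z.toBase_sectionsHom h.bijective_top

lemma HasCoordinates.unique {Z : HilbPoints n (Spec.map φ) t}
    {s : Fin n → Γ(Z.ideal.subscheme, ⊤)} (hs : IsFrame Z.toBase s)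
    {c c' : B → Fin n → Γ(T, ⊤)} (hc : Z.HasCoordinates s c) (hc' : Z.HasCoordinates s c') :
    c = c' :=
  funext fun x ↦ hs.bijective_top.1 ((hc x).symm.trans (hc' x))

lemma induction_of_isAffine [IsAffine T] {motive : Γ(pullback t (Spec.map φ), ⊤) → Prop}
    (zero : motive 0) (incl : ∀ x : B, motive (sectionsHom (pullback.snd t (Spec.map φ)) x))
    (mul : ∀ c d, motive d → motive ((pullback.fst t (Spec.map φ)).appTop c * d))
    (add : ∀ d d', motive d → motive d' → motive (d + d')) (d) : motive d := by
  refine isPushout_induction (isPushout_appTop_of_isPullback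
    (IsPullback.of_hasPullback t (Spec.map φ))).flip zero (fun x ↦ ?_) mul add d
  obtain ⟨x, rfl⟩ := (ConcreteCategory.bijective_of_isIso (Scheme.ΓSpecIso B).inv).2 x
  exact incl x

/-- The combination depends on `c` only, not on the closed subscheme. -/
lemma exists_mem_span_forall_appTop_eq [IsAffine T] (c : B → Fin n → Γ(T, ⊤))
    (d : Γ(pullback t (Spec.map φ), ⊤)) : ∃ v ∈ Submodule.span Γ(T, ⊤) (Set.range c),
      ∀ (Z : HilbPoints n (Spec.map φ) t) (s), Z.HasCoordinates s c →
        Z.ideal.subschemeι.appTop d = linearCombination Z.toBase.appTop.hom s v := by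
  induction d using induction_of_isAffine with
  | zero => exact ⟨0, Submodule.zero_mem _, fun Z s _ ↦ by rw [map_zero, map_zero]⟩
  | incl x =>
    refine ⟨c x, Submodule.subset_span ⟨x, rfl⟩, fun Z s h ↦ ?_⟩
    rw [← h x, appTop_sectionsHom]
    rfl
  | mul r d hd =>
    obtain ⟨v, hv, H⟩ := hd
    refine ⟨r • v, Submodule.smul_mem _ _ hv, fun Z s h ↦ ?_⟩
    rw [map_mul, H Z s h, map_smulₛₗ, ← appTop_toBase]
    rfl
  | add d d' hd hd' =>
    obtain ⟨v, hv, H⟩ := hd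
    obtain ⟨w, hw, H'⟩ := hd'
    exact ⟨v + w, Submodule.add_mem _ hv hw, fun Z s h ↦ by
      rw [map_add, H Z s h, H' Z s h, map_add]⟩

lemma ext_of_hasCoordinates_of_isAffine [IsAffine T] {b : Fin n → B}
    {Z Z' : HilbPoints n (Spec.map φ) t} (h : Z.IsFramed b) (h' : Z'.IsFramed b)
    {c : B → Fin n → Γ(T, ⊤)} (hc : Z.HasCoordinates (Z.pull ∘ b) c)
    (hc' : Z'.HasCoordinates (Z'.pull ∘ b) c) : Z = Z' := by
  have hz (d : Γ(pullback t (Spec.map φ), ⊤)) :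
      Z.ideal.subschemeι.appTop d = 0 ↔ Z'.ideal.subschemeι.appTop d = 0 := by
    obtain ⟨v, -, hv⟩ := exists_mem_span_forall_appTop_eq c d
    rw [hv Z _ hc, hv Z' _ hc', map_eq_zero_iff _ h.bijective_top.1,
      map_eq_zero_iff _ h'.bijective_top.1]
  ext1
  refine Scheme.IdealSheafData.ext_of_isAffine ?_
  ext d
  rw [← Scheme.IdealSheafData.ker_subschemeι_app, ← Scheme.IdealSheafData.ker_subschemeι_app]
  exact hz d

lemma ext_of_openCover {X S : Scheme.{u}} {p : X ⟶ S} {t : T ⟶ S} {Z Z' : HilbPoints n p t}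
    (𝒰 : Scheme.OpenCover.{u} T) (h : ∀ i, Z.map (𝒰.f i) rfl = Z'.map (𝒰.f i) rfl) : Z = Z' :=
  HilbPoints.ext (idealSheafData_ext_of_openCover (baseChangeCover p t 𝒰) fun i ↦
    congr(($(h i)).ideal))

lemma ext_of_hasCoordinates {b : Fin n → B} {Z Z' : HilbPoints n (Spec.map φ) t}
    (h : Z.IsFramed b) (h' : Z'.IsFramed b) {c : B → Fin n → Γ(T, ⊤)}
    (hc : Z.HasCoordinates (Z.pull ∘ b) c) (hc' : Z'.HasCoordinates (Z'.pull ∘ b) c) : Z = Z' := by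
  refine ext_of_openCover T.affineCover fun i ↦ ?_
  have hci := hc.map (T.affineCover.f i) rfl
  have hci' := hc'.map (T.affineCover.f i) rfl
  rw [mapHom_comp_pull] at hci hci'
  exact ext_of_hasCoordinates_of_isAffine (h.map _ _) (h'.map _ _) hci hci'

end HilbPoints

lemma isFinite_of_surjective_linearCombination {Y : Scheme.{u}} {π : Y ⟶ T} [IsAffine T]
    [IsAffine Y] {e : Fin n → Γ(Y, ⊤)}
    (he : Function.Surjective (linearCombination π.appTop.hom e)) : IsFinite π := by
  refine (@HasAffineProperty.iff_of_isAffine _ _ hasAffineProperty_isFinite _ _ π _).mpr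
    ⟨inferInstance, ?_⟩
  algebraize [π.appTop.hom]
  exact Module.Finite.of_surjective (Fintype.linearCombination Γ(T, ⊤) e) he

lemma isClosedImmersion_of_surjective_linearCombination {Y : Scheme.{u}} [IsAffine T] [IsAffine Y]
    {f : Y ⟶ pullback t (Spec.map φ)} {π : Y ⟶ T} {q : Y ⟶ Spec B} (hπ : f ≫ pullback.fst _ _ = π)
    (hq : f ≫ pullback.snd _ _ = q) {b : Fin n → B}
    (hb : Function.Surjective (linearCombination π.appTop.hom (sectionsHom q ∘ b))) :
    IsClosedImmersion f := by
  refine IsClosedImmersion.of_surjective_of_isAffine f fun y ↦ ?_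
  obtain ⟨a, rfl⟩ := hb y
  refine ⟨linearCombination (pullback.fst t (Spec.map φ)).appTop.hom
    (sectionsHom (pullback.snd t (Spec.map φ)) ∘ b) a, ?_⟩
  have hfst (c : Γ(T, ⊤)) : f.appTop ((pullback.fst t (Spec.map φ)).appTop c) = π.appTop c := by
    rw [← hπ, Scheme.Hom.comp_appTop]
    rfl
  refine (map_linearCombination (σ := .id _) (τ := f.appTop.hom) hfst _ a).trans ?_
  congr 2
  exact funext fun i ↦ (appTop_sectionsHom f _ (b i)).trans congr(sectionsHom $hq (b i))

namespace HilbPoints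

lemma exists_of_isClosedImmersion {X S Y : Scheme.{u}} {p : X ⟶ S} {t : T ⟶ S}
    (f : Y ⟶ pullback t p) [IsClosedImmersion f] (hf : IsFinite (f ≫ pullback.fst t p))
    (hl : IsLocallyFreeOfRank n (f ≫ pullback.fst t p)) :
    ∃ (Z : HilbPoints n p t) (k : Z.ideal.subscheme ⟶ Y), IsIso k ∧
      k ≫ f = Z.ideal.subschemeι := by
  have hker : f.ker = f.ker.subschemeι.ker := f.ker.ker_subschemeι.symm
  let k : f.ker.subscheme ⟶ Y := IsClosedImmersion.lift f f.ker.subschemeι hker.le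
  have hk : k ≫ f = f.ker.subschemeι := IsClosedImmersion.lift_fac _ _ _
  have : IsIso k := IsClosedImmersion.isIso_lift _ _ hker
  have H : IsPullback k (f.ker.subschemeι ≫ pullback.fst t p) (f ≫ pullback.fst t p) (𝟙 T) :=
    IsPullback.of_horiz_isIso ⟨by rw [← hk, Category.comp_id, Category.assoc]⟩
  exact ⟨⟨f.ker, MorphismProperty.of_isPullback H hf, hl.of_isPullback H⟩, k, this, hk⟩

lemma exists_isFramed_of_bijective {Y : Scheme.{u}} [IsAffine T] [IsAffine Y] {π : Y ⟶ T}
    {q : Y ⟶ Spec B} (w : π ≫ t = q ≫ Spec.map φ) {b : Fin n → B}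
    (hb : Function.Bijective (linearCombination π.appTop.hom (sectionsHom q ∘ b)))
    {c : B → Fin n → Γ(T, ⊤)}
    (hc : ∀ x, sectionsHom q x = linearCombination π.appTop.hom (sectionsHom q ∘ b) (c x)) :
    ∃ Z : HilbPoints n (Spec.map φ) t, Z.IsFramed b ∧ Z.HasCoordinates (Z.pull ∘ b) c := by
  have hπ : pullback.lift π q w ≫ pullback.fst t (Spec.map φ) = π := pullback.lift_fst _ _ _
  have hq : pullback.lift π q w ≫ pullback.snd t (Spec.map φ) = q := pullback.lift_snd _ _ _
  have := isClosedImmersion_of_surjective_linearCombination hπ hq hb.2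
  have hfin : IsFinite π := isFinite_of_surjective_linearCombination hb.2
  have hframe : IsFrame π (sectionsHom q ∘ b) := isFrame_of_bijective hb
  obtain ⟨Z, k, hk, hkι⟩ := exists_of_isClosedImmersion (n := n) (pullback.lift π q w)
    (hπ.symm ▸ hfin) (hπ.symm ▸ hframe.isLocallyFreeOfRank)
  have hkπ : k ≫ π = Z.toBase := by rw [toBase, ← hkι, Category.assoc, hπ]
  have hkq : k ≫ q = Z.toTotal := by rw [toTotal, ← hkι, Category.assoc, hq]
  have hpull (x : B) : k.appTop (sectionsHom q x) = Z.pull x := by rw [appTop_sectionsHom, hkq]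
  have hbase (a : Γ(T, ⊤)) : k.appTop (π.appTop a) = Z.toBase.appTop a := by
    rw [← hkπ, Scheme.Hom.comp_appTop]
    rfl
  have hkb : k.appTop ∘ sectionsHom q ∘ b = Z.pull ∘ b := funext fun i ↦ hpull (b i)
  refine ⟨Z, ?_, fun x ↦ ?_⟩
  · rw [IsFramed, ← hkb]
    exact hframe.of_isPullback (
      IsPullback.of_horiz_isIso ⟨by rw [hkπ, Category.comp_id]⟩)
  · rw [← hpull, hc x, ← hkb]
    exact map_linearCombination (σ := .id _) (τ := k.appTop.hom) hbase _ _

open scoped IsMulCommutative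

lemma exists_of_isCoordinateMap {C : CommRingCat.{u}} {θ : A ⟶ C} {b : Fin n → B}
    {c : B → Fin n → C} (h : IsCoordinateMap φ.hom θ.hom b c) :
    ∃ Z : HilbPoints n (Spec.map φ) (Spec.map θ), Z.IsFramed b ∧
      Z.HasCoordinates (Z.pull ∘ b) fun x ↦ (Scheme.ΓSpecIso C).inv ∘ c x := by
  let α : C ⟶ .of h.mulAlgebra := CommRingCat.ofHom h.scalarHom
  let β : B ⟶ .of h.mulAlgebra := CommRingCat.ofHom h.toMulAlgebra
  let ι : CommRingCat.of h.mulAlgebra ≅ _ := (Scheme.ΓSpecIso _).symm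
  have hα (a : C) : ι.hom.hom (h.scalarHom a) =
      (Spec.map α).appTop.hom ((Scheme.ΓSpecIso C).inv.hom a) :=
    congr($(Scheme.ΓSpecIso_inv_naturality α) a)
  have hβ (x : B) : ι.hom.hom (h.toMulAlgebra x) = sectionsHom (Spec.map β) x :=
    congr($(Scheme.ΓSpecIso_inv_naturality β) x)
  have hβb : ι.hom.hom ∘ h.toMulAlgebra ∘ b = sectionsHom (Spec.map β) ∘ b :=
    funext fun i ↦ hβ (b i)
  refine exists_isFramed_of_bijective (π := Spec.map α) (q := Spec.map β) ?_ ?_ fun x ↦ ?_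
  · rw [← Spec.map_comp, ← Spec.map_comp]
    congr 1
    exact CommRingCat.hom_ext (RingHom.ext h.scalarHom_comp)
  · rw [← hβb]
    exact (bijective_linearCombination_iff
      (ConcreteCategory.bijective_of_isIso (Scheme.ΓSpecIso C).inv)
      (ConcreteCategory.bijective_of_isIso ι.hom) hα _).mp h.bijective_linearCombination
  · rw [← hβb, ← hβ, h.toMulAlgebra_eq_linearCombination]
    exact map_linearCombination hα _ _

end HilbPoints

end Affine

lemma span_range_comp_eq_top {R K B ι : Type*} [CommRing R] [CommRing K] [Finite ι] (f : R →+* K)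
    {c : B → ι → R} (hc : Submodule.span R (Set.range c) = ⊤) :
    Submodule.span K (Set.range fun x ↦ f ∘ c x) = ⊤ := by
  classical
  let F : (ι → R) →ₛₗ[f] (ι → K) :=
    { toFun v := f ∘ v
      map_add' v w := by ext; simp
      map_smul' r v := by ext; simp }
  have hF : Submodule.span R (Set.range c) ≤
      (Submodule.span K (Set.range fun x ↦ f ∘ c x)).comap F := by
    rw [Submodule.span_le]
    rintro _ ⟨x, rfl⟩
    exact Submodule.subset_span ⟨x, rfl⟩
  rw [eq_top_iff, ← (Pi.basisFun K ι).span_eq, Submodule.span_le]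
  rintro _ ⟨i, rfl⟩
  have hi : Pi.basisFun K ι i = F (Pi.single i 1) := by
    ext j
    simp [F, Pi.single_apply, apply_ite f]
  exact hi ▸ hF (hc ▸ trivial)

lemma exists_isUnit_det_of_span_eq_top {K B : Type*} [Field K] {n : ℕ} {k : B → Fin n → K}
    (hk : Submodule.span K (Set.range k) = ⊤) :
    ∃ b : Fin n → B, IsUnit (Matrix.of (k ∘ b)).det := by
  obtain ⟨v, hv, -, hli⟩ := Submodule.exists_fun_fin_finrank_span_eq K (Set.range k)
  have hn : n = Module.finrank K (Submodule.span K (Set.range k)) := by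
    rw [hk, finrank_top, Module.finrank_fin_fun]
  choose b hb using hv
  refine ⟨b ∘ Fin.cast hn, ?_⟩
  rw [← Matrix.isUnit_iff_isUnit_det, ← Matrix.linearIndependent_rows_iff_isUnit]
  have hrow : (Matrix.of (k ∘ b ∘ Fin.cast hn)).row = v ∘ Fin.cast hn :=
    funext fun i ↦ hb (Fin.cast hn i)
  exact hrow ▸ hli.comp _ (Fin.cast_injective hn)

lemma exists_map_det_ne_zero {R K B : Type*} [CommRing R] [Field K] (f : R →+* K) {n : ℕ}
    {c : B → Fin n → R} (hc : Submodule.span R (Set.range c) = ⊤) :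
    ∃ b : Fin n → B, f (Matrix.of (c ∘ b)).det ≠ 0 := by
  obtain ⟨b, hb⟩ := exists_isUnit_det_of_span_eq_top (span_range_comp_eq_top f hc)
  refine ⟨b, ?_⟩
  rw [RingHom.map_det]
  exact hb.ne_zero

lemma isUnit_ι_appTop {T : Scheme.{u}} (f : Γ(T, ⊤)) : IsUnit ((T.basicOpen f).ι.appTop f) := by
  have hle : (T.basicOpen f).ι ''ᵁ ⊤ ≤ T.basicOpen f := by simp
  have hres : IsUnit (T.presheaf.map (homOfLE hle).op (T.presheaf.map
    (homOfLE (T.basicOpen_le f)).op f)) :=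
      (RingedSpace.isUnit_res_basicOpen _ f).map (T.presheaf.map (homOfLE hle).op).hom
  rw [res_res] at hres
  exact hres

lemma mem_basicOpen_of_isUnit_appTop {T T' : Scheme.{u}} (g : T' ⟶ T) {f : Γ(T, ⊤)}
    (hf : IsUnit (g.appTop f)) (z : T') : g z ∈ T.basicOpen f := by
  have hpre : g ⁻¹ᵁ T.basicOpen f = ⊤ :=
    (Scheme.preimage_basicOpen g f).trans (T'.basicOpen_of_isUnit hf)
  exact hpre.ge (Opens.mem_top z)

lemma HilbPoints.map_map_eq {n : ℕ} {X S T T₁ T₂ T' : Scheme.{u}} {p : X ⟶ S} {t : T ⟶ S}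
    {t₁ : T₁ ⟶ S} {t₂ : T₂ ⟶ S} {t' : T' ⟶ S} (Z : HilbPoints n p t) {g₁ : T₁ ⟶ T} {g₂ : T₂ ⟶ T}
    {h₁ : T' ⟶ T₁} {h₂ : T' ⟶ T₂} (w : h₁ ≫ g₁ = h₂ ≫ g₂) (e₁ : g₁ ≫ t = t₁) (e₂ : g₂ ≫ t = t₂)
    (e₁' : h₁ ≫ t₁ = t') (e₂' : h₂ ≫ t₂ = t') :
    (Z.map g₁ e₁).map h₁ e₁' = (Z.map g₂ e₂).map h₂ e₂' := by
  have e : (h₁ ≫ g₁) ≫ t = t' := by rw [Category.assoc, e₁, e₁']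
  rw [← map_comp g₁ e₁ h₁ e₁' e, ← map_comp g₂ e₂ h₂ e₂' (w ▸ e)]
  simp only [w]

section Affine

variable {n : ℕ} {A B : CommRingCat.{u}} (φ : A ⟶ B) (b : Fin n → B)

/-- The affine scheme over `A` that parametrizes the closed subschemes for which `b` induces a
basis of the functions. -/
def framedBase : Over (Spec A) :=
  Over.mk (Spec.map (CommRingCat.ofHom (coordinateRingHom φ.hom b) :
    A ⟶ CommRingCat.of (CoordinateRing φ.hom b)))

lemma exists_universal : ∃ Z : HilbPoints n (Spec.map φ) (framedBase φ b).hom, Z.IsFramed b ∧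
    Z.HasCoordinates (Z.pull ∘ b) fun x ↦
      (Scheme.ΓSpecIso (CommRingCat.of (CoordinateRing φ.hom b))).inv ∘ coordinateMap φ.hom b x :=
  HilbPoints.exists_of_isCoordinateMap (isCoordinateMap_coordinateMap φ.hom b)

/-- The universal closed subscheme for which `b` induces a basis of the functions. -/
def universal : HilbPoints n (Spec.map φ) (framedBase φ b).hom := (exists_universal φ b).choose

lemma isFramed_universal : (universal φ b).IsFramed b := (exists_universal φ b).choose_spec.1

variable {φ b} {T T' : Scheme.{u}} {t : T ⟶ Spec A} {t' : T' ⟶ Spec A}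

/-- The ring homomorphism corresponding to a morphism to the parameter space. -/
def coordinatesHom (g : T ⟶ (framedBase φ b).left) : CoordinateRing φ.hom b →+* Γ(T, ⊤) :=
  sectionsHom (B := CommRingCat.of (CoordinateRing φ.hom b)) g

lemma coordinatesHom_comp_coordinateRingHom {g : T ⟶ (framedBase φ b).left}
    (e : g ≫ (framedBase φ b).hom = t) :
    (coordinatesHom g).comp (coordinateRingHom φ.hom b) = sectionsHom t := by
  subst e
  exact RingHom.ext fun a ↦ (sectionsHom_comp_SpecMap
    (B := CommRingCat.of (CoordinateRing φ.hom b)) g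
    (CommRingCat.ofHom (coordinateRingHom φ.hom b)) a).symm

lemma hasCoordinates_universal_map (g : T ⟶ (framedBase φ b).left)
    (e : g ≫ (framedBase φ b).hom = t) : ((universal φ b).map g e).HasCoordinates
      (((universal φ b).map g e).pull ∘ b) fun x ↦ coordinatesHom g ∘ coordinateMap φ.hom b x := by
  have h := (exists_universal φ b).choose_spec.2.map g e
  rw [HilbPoints.mapHom_comp_pull] at h
  exact h

lemma universal_map_injective {g g' : T ⟶ (framedBase φ b).left}
    (e : g ≫ (framedBase φ b).hom = t) (e' : g' ≫ (framedBase φ b).hom = t)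
    (h : (universal φ b).map g e = (universal φ b).map g' e') : g = g' := by
  have hg' := hasCoordinates_universal_map g' e'
  rw [← h] at hg'
  have hcoord := HilbPoints.HasCoordinates.unique ((isFramed_universal φ b).map g e)
    (hasCoordinates_universal_map g e) hg'
  have hbase := (coordinatesHom_comp_coordinateRingHom e).trans
    (coordinatesHom_comp_coordinateRingHom e').symm
  have heq : coordinatesHom g = coordinatesHom g' :=
    coordinateRing_hom_ext hbase fun x k ↦ congr_fun (congr_fun hcoord x) k
  exact sectionsHom_injective (B := CommRingCat.of (CoordinateRing φ.hom b)) heq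

namespace HilbPoints

lemma IsFramed.exists_map_universal_eq {Z : HilbPoints n (Spec.map φ) t} (h : Z.IsFramed b) :
    ∃ (g : T ⟶ (framedBase φ b).left) (e : g ≫ (framedBase φ b).hom = t),
      (universal φ b).map g e = Z := by
  obtain ⟨c, hc, hZ⟩ := h.exists_hasCoordinates
  obtain ⟨ψ, hψ, hψc⟩ := exists_coordinateRing_hom hc
  obtain ⟨g : T ⟶ (framedBase φ b).left, hg : coordinatesHom g = ψ⟩ :=
    sectionsHom_surjective (B := CommRingCat.of (CoordinateRing φ.hom b)) ψ
  have e : g ≫ (framedBase φ b).hom = t := by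
    refine sectionsHom_injective ?_
    rw [← coordinatesHom_comp_coordinateRingHom rfl, hg]
    exact hψ
  have hgc : (fun x ↦ coordinatesHom g ∘ coordinateMap φ.hom b x) = c :=
    funext fun x ↦ funext fun k ↦ (congr($hg _)).trans (hψc x k)
  exact ⟨g, e, ext_of_hasCoordinates ((isFramed_universal φ b).map g e) h
    (hgc ▸ hasCoordinates_universal_map g e) hZ⟩

lemma isFramed_iff_exists {Z : HilbPoints n (Spec.map φ) t} : Z.IsFramed b ↔
    ∃ (g : T ⟶ (framedBase φ b).left) (e : g ≫ (framedBase φ b).hom = t),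
      (universal φ b).map g e = Z :=
  ⟨IsFramed.exists_map_universal_eq, fun ⟨g, e, h⟩ ↦ h ▸ (isFramed_universal φ b).map g e⟩

lemma isFramed_of_openCover {Z : HilbPoints n (Spec.map φ) t}
    (h : ∀ z : T, ∃ U : T.Opens, z ∈ U ∧ (Z.map U.ι rfl).IsFramed b) : Z.IsFramed b := by
  refine isFrame_of_openCover fun z ↦ ?_
  obtain ⟨U, hz, hU⟩ := h z
  refine ⟨_, _, U.ι, _, _, inferInstance, Z.isPullback_mapHom U.ι rfl, ⟨⟨z, hz⟩, rfl⟩, ?_⟩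
  rw [IsFramed, ← mapHom_comp_pull] at hU
  exact hU

/-- The largest open subscheme of the base over which `b` induces a basis of the functions. -/
def framedLocus (b : Fin n → B) (Z : HilbPoints n (Spec.map φ) t) : T.Opens :=
  sSup {U | (Z.map U.ι rfl).IsFramed b}

lemma mem_framedLocus {Z : HilbPoints n (Spec.map φ) t} (j : T' ⟶ T) [IsOpenImmersion j]
    (e : j ≫ t = t') (h : (Z.map j e).IsFramed b) (z : T') : j z ∈ Z.framedLocus b := by
  refine Opens.mem_sSup.mpr ⟨j.opensRange, ?_, z, rfl⟩
  have hinv := h.map (t' := j.opensRange.ι ≫ t) j.isoOpensRange.inv (by rw [← e]; simp)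
  rw [← map_comp (e'' := by simp)] at hinv
  simpa using hinv

lemma mem_framedLocus_of_map {Z : HilbPoints n (Spec.map φ) t} (j : T' ⟶ T) [IsOpenImmersion j]
    (e : j ≫ t = t') {z : T'} (h : z ∈ (Z.map j e).framedLocus b) : j z ∈ Z.framedLocus b := by
  obtain ⟨U : T'.Opens, hU, hz⟩ := Opens.mem_sSup.mp h
  have hj : (U.ι ≫ j) ≫ t = U.ι ≫ t' := by rw [Category.assoc, e]
  have hUj : (Z.map (U.ι ≫ j) hj).IsFramed b := by
    rw [map_comp j e U.ι rfl]
    exact hU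
  exact mem_framedLocus (U.ι ≫ j) hj hUj ⟨z, hz⟩

variable {Z : HilbPoints n (Spec.map φ) t} {s : Fin n → Γ(Z.ideal.subscheme, ⊤)}
  {c : B → Fin n → Γ(T, ⊤)}

lemma isFramed_map_iff_isUnit_det (hs : IsFrame Z.toBase s) (hc : Z.HasCoordinates s c)
    (g : T' ⟶ T) (e : g ≫ t = t') :
    (Z.map g e).IsFramed b ↔ IsUnit (g.appTop (Matrix.of (c ∘ b)).det) := by
  have hs' : IsFrame (Z.map g e).toBase ((Z.mapHom g e).appTop ∘ s) :=
    hs.of_isPullback (Z.isPullback_mapHom g e)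
  have hb (i : Fin n) : (Z.map g e).pull (b i) = linearCombination (Z.map g e).toBase.appTop.hom
      ((Z.mapHom g e).appTop ∘ s) ((Matrix.of (c ∘ b)).map g.appTop i) :=
    hc.map g e (b i)
  have hdet : g.appTop (Matrix.of (c ∘ b)).det = ((Matrix.of (c ∘ b)).map g.appTop).det :=
    RingHom.map_det g.appTop.hom _
  rw [hdet]
  exact ⟨fun h ↦ hs'.isUnit_det hb h, fun h ↦ hs'.of_isUnit_det hb h⟩

lemma basicOpen_det_le_framedLocus (hs : IsFrame Z.toBase s) (hc : Z.HasCoordinates s c) :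
    T.basicOpen (Matrix.of (c ∘ b)).det ≤ Z.framedLocus b :=
  fun z hz ↦ mem_framedLocus (T.basicOpen (Matrix.of (c ∘ b)).det).ι rfl
    ((isFramed_map_iff_isUnit_det hs hc _ _).mpr (isUnit_ι_appTop _)) ⟨z, hz⟩

lemma exists_isFrame_restrict (Z : HilbPoints n (Spec.map φ) t) (z : T) :
    ∃ U : T.Opens, IsAffineOpen U ∧ z ∈ U ∧ ∃ s c, IsFrame (Z.map U.ι rfl).toBase s ∧
      (Z.map U.ι rfl).HasCoordinates s c := by
  obtain ⟨U, hU, hz, h⟩ := IsLocallyFreeOfRank.exists_isFrame (π := Z.toBase) Z.isLocallyFree z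
  obtain ⟨s, hs⟩ := h (Z.isPullback_mapHom U.ι rfl)
  choose c hc using fun x ↦ hs.bijective_top.2 ((Z.map U.ι rfl).pull x)
  exact ⟨U, hU, hz, s, c, hs, fun x ↦ (hc x).symm⟩

lemma IsFramed.forall_mem_framedLocus {g : T' ⟶ T} {e : g ≫ t = t'} (h : (Z.map g e).IsFramed b)
    (z : T') : g z ∈ Z.framedLocus b := by
  obtain ⟨U, -, hz, s, c, hs, hc⟩ := Z.exists_isFrame_restrict (g z)
  have hU : (g ∣_ U) ≫ U.ι ≫ t = (g ⁻¹ᵁ U).ι ≫ t' := by rw [morphismRestrict_ι_assoc, e]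
  have hframed : ((Z.map U.ι rfl).map (g ∣_ U) hU).IsFramed b := by
    rw [Z.map_map_eq (morphismRestrict_ι g U) rfl e hU rfl]
    exact h.map _ _
  have hdet := (isFramed_map_iff_isUnit_det hs hc _ hU).mp hframed
  have hmem := mem_framedLocus_of_map U.ι rfl (basicOpen_det_le_framedLocus hs hc
    (mem_basicOpen_of_isUnit_appTop _ hdet ⟨z, hz⟩))
  exact (congr($(morphismRestrict_ι g U) ⟨z, hz⟩) : U.ι ((g ∣_ U) ⟨z, hz⟩) = g z) ▸ hmem

lemma isFramed_map_iff (g : T' ⟶ T) (e : g ≫ t = t') :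
    (Z.map g e).IsFramed b ↔ ∀ z, g z ∈ Z.framedLocus b := by
  refine ⟨IsFramed.forall_mem_framedLocus, fun h ↦ isFramed_of_openCover fun z ↦ ?_⟩
  obtain ⟨U : T.Opens, hU : (Z.map U.ι rfl).IsFramed b, hz⟩ := Opens.mem_sSup.mp (h z)
  have hU' : (g ∣_ U) ≫ U.ι ≫ t = (g ⁻¹ᵁ U).ι ≫ t' := by rw [morphismRestrict_ι_assoc, e]
  refine ⟨g ⁻¹ᵁ U, hz, ?_⟩
  rw [← Z.map_map_eq (morphismRestrict_ι g U) rfl e hU' rfl]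
  exact hU.map _ _

lemma span_range_eq_top [IsAffine T] (hs : IsFrame Z.toBase s) (hc : Z.HasCoordinates s c) :
    Submodule.span Γ(T, ⊤) (Set.range c) = ⊤ := by
  rw [eq_top_iff]
  rintro v -
  obtain ⟨d, hd⟩ := Z.ideal.subschemeι_app_surjective ⟨⊤, isAffineOpen_top _⟩
    (linearCombination Z.toBase.appTop.hom s v)
  obtain ⟨w, hw, hdw⟩ := exists_mem_span_forall_appTop_eq c d
  rwa [hs.bijective_top.1 (hd.symm.trans (hdw Z s hc))]

lemma exists_mem_framedLocus (Z : HilbPoints n (Spec.map φ) t) (z : T) :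
    ∃ b, z ∈ Z.framedLocus b := by
  obtain ⟨U, hU, hz, s, c, hs, hc⟩ := Z.exists_isFrame_restrict z
  have : IsAffine U := hU
  let u : U.toScheme := ⟨z, hz⟩
  obtain ⟨b, hb⟩ := exists_map_det_ne_zero (K := U.toScheme.residueField u)
    (U.toScheme.evaluation ⊤ u trivial).hom (span_range_eq_top hs hc)
  exact ⟨b, mem_framedLocus_of_map U.ι rfl (z := u) (basicOpen_det_le_framedLocus hs hc
    ((U.toScheme.evaluation_ne_zero_iff_mem_basicOpen _ _ _).mp hb))⟩

lemma mem_range_yonedaEquiv_symm_universal_iff {T : Over (Spec A)}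
    {Z : HilbPoints n (Spec.map φ) T.hom} :
    Z ∈ Set.range ((yonedaEquiv (F := hilb n (Spec.map φ)).symm (universal φ b)).app (op T)) ↔
      Z.IsFramed b := by
  rw [isFramed_iff_exists]
  exact ⟨fun ⟨g, hg⟩ ↦ ⟨g.left, Over.w g, hg⟩, fun ⟨g, e, hg⟩ ↦ ⟨Over.homMk g e, hg⟩⟩

end HilbPoints

lemma isOpenSubfunctor_yonedaEquiv_symm_universal :
    IsOpenSubfunctor (yonedaEquiv (F := hilb n (Spec.map φ)).symm (universal φ b)) :=
  isOpenSubfunctor_iff.mpr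
    ⟨fun _ _ _ h ↦ Over.OverMorphism.ext (universal_map_injective (Over.w _) (Over.w _) h),
      fun _ Z ↦ ⟨HilbPoints.framedLocus b Z, fun _ _ ↦
        HilbPoints.mem_range_yonedaEquiv_symm_universal_iff.trans
          (HilbPoints.isFramed_map_iff _ _)⟩⟩

theorem isRepresentable_hilb_SpecMap (n : ℕ) (φ : A ⟶ B) :
    (hilb n (Spec.map φ)).IsRepresentable := by
  refine isRepresentable_of_isOpenSubfunctor (isZariskiSheaf_hilb _)
    (fun b : Fin n → B ↦ yoneda.obj (framedBase φ b)) inferInstance _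
    (fun b ↦ isOpenSubfunctor_yonedaEquiv_symm_universal) fun T Z z ↦ ?_
  obtain ⟨b, hb⟩ := HilbPoints.exists_mem_framedLocus Z z
  exact ⟨HilbPoints.framedLocus b Z, hb, b, HilbPoints.mem_range_yonedaEquiv_symm_universal_iff.mpr
    ((HilbPoints.isFramed_map_iff _ _).mpr fun z ↦ z.2)⟩

end Affine

section Ext

variable {n : ℕ} {W U S : Scheme.{u}} {q : W ⟶ U}

lemma isRepresentable_hilbExt (hq : (hilb n q).IsRepresentable) (i : U ⟶ S) :
    (hilbExt n q i).IsRepresentable := by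
  obtain ⟨H, ⟨r⟩⟩ := hq.has_representation
  let Z : HilbPoints n q H.hom := r.homEquiv (𝟙 H)
  have hZ {T : Over U} (g : T ⟶ H) : r.homEquiv g = Z.map g.left (Over.w g) := r.homEquiv_eq g
  let inv {T : Over S} (Y : (hilbExt n q i).obj (op T)) : Over.mk Y.1.1 ⟶ H :=
    r.homEquiv.symm (show (hilb n q).obj (op (Over.mk Y.1.1)) from Y.2)
  have hinv {T : Over S} (Y : (hilbExt n q i).obj (op T)) :
      Z.map (inv Y).left (Over.w (inv Y)) = Y.2 :=
    (hZ _).symm.trans (r.homEquiv.apply_symm_apply _)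
  have hinv_left {T : Over S} (f : T.left ⟶ H.left) (hf : (f ≫ H.hom) ≫ i = T.hom) :
      (inv (T := T) ⟨⟨f ≫ H.hom, hf⟩, Z.map f rfl⟩).left = f :=
    congr(($(r.homEquiv.symm_apply_eq.mpr
      (hZ (Over.homMk f : Over.mk (f ≫ H.hom) ⟶ H)).symm)).left)
  let x : (hilbExt n q i).obj (op ((Over.map i).obj H)) := ⟨⟨H.hom, rfl⟩, Z⟩
  have hw {T : Over S} (Y : (hilbExt n q i).obj (op T)) :
      (inv Y).left ≫ ((Over.map i).obj H).hom = T.hom :=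
    ((Category.assoc _ _ _).symm.trans congr($(Over.w (inv Y)) ≫ i)).trans Y.1.2
  exact Functor.RepresentableBy.isRepresentable (Y := (Over.map i).obj H)
    { homEquiv :=
        { toFun f := (hilbExt n q i).map f.op x
          invFun Y := Over.homMk (inv Y).left (hw Y)
          left_inv f := Over.OverMorphism.ext (hinv_left f.left _)
          right_inv Y := (HilbPoints.sigma_map_eq (inv Y).left (Over.w (inv Y)) _ Y.1.2 Z).trans
            congr(Sigma.mk Y.1 $(hinv Y)) }
      homEquiv_comp g f := congr($((hilbExt n q i).map_comp f.op g.op) x) }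

end Ext

lemma comap_map_of_mono {Y X : Scheme.{u}} (I : Y.IdealSheafData) (f : Y ⟶ X) [Mono f]
    [IsClosedImmersion (I.subschemeι ≫ f)] : (I.map f).comap f = I := by
  have hι : IsPullback I.subschemeι (𝟙 _) (𝟙 _) I.subschemeι := IsPullback.of_vert_isIso ⟨by simp⟩
  have h := hι.paste_horiz (IsKernelPair.id_of_mono f)
  rw [Category.comp_id] at h
  exact (ker_eq_comap_of_isPullback h).symm.trans I.ker_subschemeι

section Incl

variable {n : ℕ} {W U X S T T' : Scheme.{u}} {q : W ⟶ U} {i : U ⟶ S} {p : X ⟶ S} {j : W ⟶ X}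
  {t : T ⟶ S} {t' : T' ⟶ S}

section

variable [Mono j] [IsSeparated p]

lemma HilbPoints.incl_injective (w : j ≫ p = q ≫ i) {h : T ⟶ U} (e : h ≫ i = t) :
    Function.Injective (HilbPoints.incl (n := n) w e) := by
  intro Z Z' H
  have := isClosedImmersion_incl w e Z
  have := isClosedImmersion_incl w e Z'
  ext1
  rw [← comap_map_of_mono Z.ideal (inclMap w e), ← comap_map_of_mono Z'.ideal (inclMap w e)]
  exact congr(($H).ideal.comap (inclMap w e))

lemma hilbIncl_app_injective [Mono i] (w : j ≫ p = q ≫ i) (T : (Over S)ᵒᵖ) :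
    Function.Injective ((hilbIncl n w).app T) := by
  rintro ⟨⟨h, e⟩, Z⟩ ⟨⟨h', e'⟩, Z'⟩ H
  obtain rfl : h = h' := (cancel_mono i).mp (e.trans e'.symm)
  obtain rfl := HilbPoints.incl_injective w e H
  rfl

lemma HilbPoints.exists_incl_eq [Mono i] (w : j ≫ p = q ≫ i) {h : T ⟶ U} (e : h ≫ i = t)
    (Z : HilbPoints n p t) (k : Z.ideal.subscheme ⟶ W) (hk : k ≫ j = Z.toTotal) :
    ∃ Z₀ : HilbPoints n q h, Z₀.incl w e = Z := by
  have hqk : Z.toBase ≫ h = k ≫ q := by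
    rw [← cancel_mono i, Category.assoc, Category.assoc, e, ← w, reassoc_of% hk, toBase_comp]
  let f : Z.ideal.subscheme ⟶ pullback h q := pullback.lift Z.toBase k hqk
  have hf_fst : f ≫ pullback.fst h q = Z.toBase := pullback.lift_fst _ _ _
  have hf_snd : f ≫ pullback.snd h q = k := pullback.lift_snd _ _ _
  have hf : f ≫ inclMap w e = Z.ideal.subschemeι := by
    apply pullback.hom_ext
    · rw [Category.assoc, inclMap_fst, hf_fst, toBase]
    · rw [Category.assoc, inclMap_snd, reassoc_of% hf_snd, hk, toTotal]
  have : IsClosedImmersion (f ≫ inclMap w e) := hf ▸ inferInstance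
  have : IsClosedImmersion f := IsClosedImmersion.of_comp f (inclMap w e)
  obtain ⟨Z₀, k₀, _, hk₀⟩ := exists_of_isClosedImmersion (n := n) f
    (hf_fst.symm ▸ Z.isFinite) (hf_fst.symm ▸ Z.isLocallyFree)
  refine ⟨Z₀, HilbPoints.ext ?_⟩
  calc (Z₀.incl w e).ideal = (k₀ ≫ Z.ideal.subschemeι).ker := by
        rw [← hf, ← Category.assoc, hk₀]
        rfl
    _ = Z.ideal := by rw [Scheme.Hom.ker_comp_of_isIso, Scheme.IdealSheafData.ker_subschemeι]

lemma HilbPoints.exists_comp_eq_toTotal_incl (w : j ≫ p = q ≫ i) {h : T ⟶ U} (e : h ≫ i = t)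
    (Z : HilbPoints n q h) : ∃ k, k ≫ j = (Z.incl w e).toTotal := by
  have := isClosedImmersion_incl w e Z
  let f := Z.ideal.subschemeι ≫ inclMap w e
  let k : (Z.incl w e).ideal.subscheme ⟶ Z.ideal.subscheme :=
    IsClosedImmersion.lift f f.ker.subschemeι f.ker.ker_subschemeι.ge
  have hk : k ≫ f = (Z.incl w e).ideal.subschemeι := IsClosedImmersion.lift_fac _ _ _
  refine ⟨k ≫ Z.toTotal, ?_⟩
  rw [toTotal, toTotal, ← hk]
  simp only [f, Category.assoc, inclMap_snd]

end

variable [IsOpenImmersion i] [IsOpenImmersion j]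

/-- The open subscheme of the base over which a point of the Hilbert functor of `X` over `S` is
contained in the open subscheme `j : W ⟶ X` lying over `i : U ⟶ S`. It is open because `Z` is
finite, hence closed, over the base. -/
def includedLocus (i : U ⟶ S) [IsOpenImmersion i] (j : W ⟶ X) [IsOpenImmersion j]
    (Z : HilbPoints n p t) : T.Opens :=
  t ⁻¹ᵁ i.opensRange ⊓ ⟨(Z.toBase '' (Z.toTotal ⁻¹ᵁ j.opensRange : Set _)ᶜ)ᶜ,
    (Z.toBase.isClosedMap _ (Z.toTotal ⁻¹ᵁ j.opensRange).isOpen.isClosed_compl).isOpen_compl⟩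

lemma mem_includedLocus {Z : HilbPoints n p t} {z : T} : z ∈ includedLocus i j Z ↔
    t z ∈ i.opensRange ∧ ∀ y, Z.toBase y = z → Z.toTotal y ∈ j.opensRange :=
  and_congr Iff.rfl ⟨fun h y hy ↦ by_contra fun hj ↦ h ⟨y, hj, hy⟩,
    fun h ⟨y, hj, hy⟩ ↦ hj (h y hy)⟩

variable [IsSeparated p]

lemma mem_range_hilbIncl_iff (w : j ≫ p = q ≫ i) {T : Over S} {Z : HilbPoints n p T.hom} :
    Z ∈ Set.range ((hilbIncl n w).app (op T)) ↔
      (∀ z, T.hom z ∈ i.opensRange) ∧ ∀ y, Z.toTotal y ∈ j.opensRange := by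
  rw [← exists_comp_eq_iff_of_isOpenImmersion, ← exists_comp_eq_iff_of_isOpenImmersion]
  constructor
  · rintro ⟨⟨⟨h, e⟩, Z₀⟩, rfl⟩
    exact ⟨⟨h, e⟩, Z₀.exists_comp_eq_toTotal_incl w e⟩
  · rintro ⟨⟨h, e⟩, k, hk⟩
    obtain ⟨Z₀, hZ₀⟩ := Z.exists_incl_eq w e k hk
    exact ⟨⟨⟨h, e⟩, Z₀⟩, hZ₀⟩

lemma map_mem_range_hilbIncl_iff (w : j ≫ p = q ≫ i) {T T' : Over S} (g : T' ⟶ T)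
    (Z : HilbPoints n p T.hom) :
    (hilb n p).map g.op Z ∈ Set.range ((hilbIncl n w).app (op T')) ↔
      ∀ z, g.left z ∈ includedLocus i j Z := by
  have hbase (z) : T.hom (g.left z) = T'.hom z := congr($(Over.w g) z)
  have htotal (y) : (Z.map g.left (Over.w g)).toTotal y =
      Z.toTotal (Z.mapHom g.left (Over.w g) y) :=
    (congr($(Z.mapHom_toTotal g.left (Over.w g)) y)).symm
  have H := Z.isPullback_mapHom g.left (Over.w g)
  refine (mem_range_hilbIncl_iff w (Z := Z.map g.left (Over.w g))).trans ?_
  simp only [mem_includedLocus, forall_and, hbase, htotal]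
  refine and_congr_right fun _ ↦ ⟨fun h z y hy ↦ ?_, fun h y ↦ h _ _ congr($(H.w) y)⟩
  obtain ⟨y', rfl, -⟩ := Scheme.exists_preimage_of_isPullback H y z hy
  exact h y'

lemma isOpenSubfunctor_hilbIncl (w : j ≫ p = q ≫ i) : IsOpenSubfunctor (hilbIncl n w) :=
  isOpenSubfunctor_iff.mpr ⟨hilbIncl_app_injective w,
    fun _ Z ↦ ⟨includedLocus i j Z, fun _ g ↦ map_mem_range_hilbIncl_iff w g Z⟩⟩

end Incl

namespace QCohGradedAlgebra

variable {S : Scheme.{u}} (R : QCohGradedAlgebra S) {n : ℕ}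

lemma exists_projChart_eq (U : S.AffineZariskiSite) {x : R.proj} (hx : R.projToBase x ∈ U.1) :
    ∃ y, R.projChart U y = x := by
  rw [← SetLike.mem_coe, ← U.2.range_fromSpec] at hx
  obtain ⟨u, hu⟩ := hx
  obtain ⟨y, hy, -⟩ := Scheme.exists_preimage_of_isPullback (R.isPullback_projChart U) x u hu.symm
  exact ⟨y, hy⟩

lemma exists_subset_opensRange_awayToProj (U : S.AffineZariskiSite) {s : Set R.proj}
    (hs : s.Finite) (hU : ∀ x ∈ s, R.projToBase x ∈ U.1) :
    ∃ (d : ℕ) (hd : 0 < d) (f : R.sec U.1) (hf : f ∈ R.piece U.1 d),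
      ∀ x ∈ s, x ∈ (R.awayToProj U hf hd).opensRange := by
  choose y hy using fun x : s ↦ R.exists_projChart_eq U (hU x x.2)
  have : Finite s := hs
  obtain ⟨d, f, hd, hf, h⟩ := exists_forall_notMem (R.piece U.1) (Set.finite_range y).toFinset
  refine ⟨d, hd, f, hf, fun x hx ↦ ?_⟩
  have hmem : y ⟨x, hx⟩ ∈ (Proj.awayι (R.piece U.1) f hf hd).opensRange := by
    rw [Proj.opensRange_awayι]
    exact h _ ((Set.finite_range y).mem_toFinset.mpr ⟨_, rfl⟩)
  obtain ⟨v, hv⟩ := hmem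
  exact ⟨v, congr(R.projChart U $hv).trans (hy ⟨x, hx⟩)⟩

lemma exists_mem_includedLocus {T : Over S} (Z : HilbPoints n R.projToBase T.hom) (t : T.left) :
    ∃ (U : S.AffineZariskiSite) (d : ℕ) (hd : 0 < d) (f : R.sec U.1) (hf : f ∈ R.piece U.1 d),
      t ∈ includedLocus U.2.fromSpec (R.awayToProj U hf hd) Z := by
  obtain ⟨_, ⟨U, hU, rfl⟩, htU, -⟩ :=
    S.isBasis_affineOpens.exists_subset_of_mem_open (Set.mem_univ (T.hom t)) isOpen_univ
  let U' : S.AffineZariskiSite := ⟨U, hU⟩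
  have hfiber : (Z.toBase ⁻¹' {t}).Finite := Z.toBase.finite_preimage_singleton t
  have hbase (y) : T.hom (Z.toBase y) = R.projToBase (Z.toTotal y) := congr($(Z.toBase_comp) y)
  obtain ⟨d, hd, f, hf, h⟩ := R.exists_subset_opensRange_awayToProj U'
    (hfiber.image Z.toTotal) (by
      rintro _ ⟨y, rfl, rfl⟩
      exact hbase y ▸ htU)
  exact ⟨U', d, hd, f, hf, mem_includedLocus.mpr
    ⟨hU.opensRange_fromSpec.ge htU, fun y hy ↦ h _ ⟨y, hy, rfl⟩⟩⟩

lemma exists_map_mem_range_hilbAwayIncl (T : Over S) (Z : (R.hilbProj n).obj (op T)) (t : T.left) :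
    ∃ V : T.left.Opens, t ∈ V ∧
      ∃ (U : S.AffineZariskiSite) (d : ℕ) (hd : 0 < d) (f : R.sec U.1) (hf : f ∈ R.piece U.1 d),
        (R.hilbProj n).map (Over.homMk V.ι : Over.mk (V.ι ≫ T.hom) ⟶ T).op Z ∈
          Set.range ((R.hilbAwayIncl n U hf hd).app (op (Over.mk (V.ι ≫ T.hom)))) := by
  obtain ⟨U, d, hd, f, hf, h⟩ := R.exists_mem_includedLocus Z t
  exact ⟨_, h, U, d, hd, f, hf,
    (map_mem_range_hilbIncl_iff (R.awayToProj_projToBase U hf hd) _ Z).mpr fun z ↦ z.2⟩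

lemma isRepresentable_hilbAway (U : S.AffineZariskiSite) (f : R.sec U.1) :
    (R.hilbAway n U f).IsRepresentable :=
  isRepresentable_hilb_SpecMap n _

lemma isRepresentable_hilbAwayExt (U : S.AffineZariskiSite) (f : R.sec U.1) :
    (R.hilbAwayExt n U f).IsRepresentable :=
  isRepresentable_hilbExt (R.isRepresentable_hilbAway U f) _

lemma isOpenSubfunctor_hilbAwayIncl (U : S.AffineZariskiSite) {d : ℕ} (hd : 0 < d)
    {f : R.sec U.1} (hf : f ∈ R.piece U.1 d) : IsOpenSubfunctor (R.hilbAwayIncl n U hf hd) :=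
  isOpenSubfunctor_hilbIncl _

lemma isRepresentable_hilbProj : (R.hilbProj n).IsRepresentable := by
  let ι := Σ U : S.AffineZariskiSite, {f : ℕ × R.sec U.1 // 0 < f.1 ∧ f.2 ∈ R.piece U.1 f.1}
  refine isRepresentable_of_isOpenSubfunctor (isZariskiSheaf_hilb _) (ι := ι)
    (fun k ↦ R.hilbAwayExt n k.1 k.2.1.2) (fun k ↦ R.isRepresentable_hilbAwayExt _ _)
    (fun k ↦ R.hilbAwayIncl n k.1 k.2.2.2 k.2.2.1)
    (fun k ↦ R.isOpenSubfunctor_hilbAwayIncl k.1 k.2.2.1 k.2.2.2) fun T Z t ↦ ?_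
  obtain ⟨V, ht, U, d, hd, f, hf, h⟩ := R.exists_map_mem_range_hilbAwayIncl T Z t
  exact ⟨V, ht, ⟨U, ⟨d, f⟩, hd, hf⟩, h⟩

end QCohGradedAlgebra

end HilbertPoints

end

/-- Representability of the Hilbert functor of `n` points of the relative `Proj` of a
quasi-coherent graded algebra, and its cover by the representable open subfunctors of closed
subschemes contained in `Spec R_(f)`, for affine opens `U = Spec A` of `S`, `R = Γ(U, 𝓡)` and
`f : R` homogeneous of positive degree. -/
theorem theorem5p7 {S : Scheme.{u}} (R : HilbertPoints.QCohGradedAlgebra S) (n : ℕ) :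
    (R.hilbProj n).IsRepresentable ∧
    (∀ (U : S.AffineZariskiSite) (d : ℕ) (hd : 0 < d) (f : R.sec U.1) (hf : f ∈ R.piece U.1 d),
      (R.hilbAway n U f).IsRepresentable ∧
      (R.hilbAwayExt n U f).IsRepresentable ∧
      HilbertPoints.IsOpenSubfunctor (R.hilbAwayIncl n U hf hd)) ∧
    (∀ (T : Over S) (Z : (R.hilbProj n).obj (op T)) (t : T.left),
      ∃ V : T.left.Opens, t ∈ V ∧
        ∃ (U : S.AffineZariskiSite) (d : ℕ) (hd : 0 < d) (f : R.sec U.1) (hf : f ∈ R.piece U.1 d),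
          (R.hilbProj n).map (Over.homMk V.ι : Over.mk (V.ι ≫ T.hom) ⟶ T).op Z ∈
            Set.range ((R.hilbAwayIncl n U hf hd).app (op (Over.mk (V.ι ≫ T.hom))))) :=
  ⟨R.isRepresentable_hilbProj,
    fun U _ hd f hf ↦ ⟨R.isRepresentable_hilbAway U f, R.isRepresentable_hilbAwayExt U f,
      R.isOpenSubfunctor_hilbAwayIncl U hd hf⟩,
    R.exists_map_mem_range_hilbAwayIncl⟩
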